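/- **Setting.** Let $V$ be a finite set, $n=|V|$, and let $f:2^V\to\mathbb R$ be submodular with $f(\emptyset)=0$, given by an evaluation oracle; a query costs $\mathrm{EO}$, and a real arithmetic operation, square root, comparison or elementary index operation costs $1$. For $a\in\mathbb R$ let $a^-=\min\{0,a\}$; for a vector $z$ let $z(S)=\sum_{v\in S}z(v)$ and $z^-(S)=\sum_{v\in S}z(v)^-$. Let $B(g)$ be the base polytope of $g$ and $L_g=\max\{\|z\|_1: z\in B(g)\}$. **Oracle.** An oracle *Approx-SFM* gets a submodular $g:2^X\to\mathbb R$ on a nonempty finite set $X$ with $g(\emptyset)=0$ and $\delta>0$; it returns $W\subseteq X$ and $y\in B(g)$ with $g(W)\le y^-(X)+\delta L_g$, where $y$ is given as a convex combination of at most $K|X|$ extreme bases with their orderings, for a constant $K$. **Ring families.** A preorder $\preceq$ on $V$ represents the family of the sets $X$ such that $v\in X$, $u\preceq v$ imply $u\in X$; equivalent elements are contracted to one. Put $X^\downarrow=\{u:\exists v\in X,\ u\preceq v\}$, $z^\uparrow=\{u: z\preceq u\}$, $\ell(v)=f((V\setminus v^\uparrow)\cup\{v\})-f(V\setminus v^\uparrow)$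 and $f^\downarrow(X)=f(X^\downarrow)-\ell^-(X^\downarrow\setminus X)$. **Algorithm (bucketed scheme).** Let $n$ be the size of the original ground set and $\kappa=Kn$. Start with the trivial preorder, $T=\emptyset$, and replace $f(V)$ by $\min\{0,f(V)\}$. While $\ell^-(V)<0$ for the current $f$ and $V$, repeat: 1. For $t\ge 0$ let $V^t=\{z:\ell(z)\le 2\ell^-(V)/(4\kappa n)^{4t}\}$; let $b\ge1$ be least with $|V^b|\le 2|V^{b-1}|$, and put $\bar V=V^b$, $\bar\delta=(4\kappa n)^{-4b}$, $\delta=(2n^2+1)\bar\delta$. 2. Call Approx-SFM for the restriction of $f^\downarrow$ to $\bar V$ with accuracy $\bar\delta$. Extend the returned bases to extreme bases of $B(f^\downarrow)$ by appending the remaining elements to their orderings in a common order, which gives $y=\sum_{i=1}^k x_ig_i\in B(f^\downarrow)$. 3. For every $z$ with $f(V\setminus z^\uparrow)>-2k|V|\,y^-(V\setminus z^\uparrow)$: choose $i$ maximizing $x_i(f(V\setminus z^\uparrow)-g_i(V\setminus z^\uparrow))$, let $g_i'$ be the extreme base of $f^\downarrow$ for the ordering of $g_i$ with the elements of $z^\uparrow$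 moved to the end, let $y'=y+x_i(g_i'-g_i)$, and add the relation $z\preceq v$ for all $v\in V\setminus z^\uparrow$ with $y'(v)>-y'^-(V\setminus z^\uparrow)$; keep $\preceq$ transitively closed. 4. For every $v$ not yet contracted with $y(v)<2\ell^-(V)\delta$ (with $\ell$ and $V$ as at the start of the iteration): contract $v^\downarrow$, that is, add it to $T$ and replace $f$ by $S\mapsto f(S\cup v^\downarrow)-f(v^\downarrow)$ on $V\setminus v^\downarrow$, and then replace $f(V)$ by $\min\{0,f(V)\}$. At the end, return $T$ (as a subset of the original ground set). **The quantity $\mathrm{AO}^\downarrow$.** Let $\mathrm{AO}^\downarrow(f,\delta)$ be the least $a$ with the following property: for every contraction of $f$ by a set contained in all minimizers (with the value of the full ground set truncated as in the algorithm), every ring family containing all minimizers, the resulting function $f^\downarrow$, every nonempty subset $X$ of its ground set and every $\delta'\in[\delta,1]$, the running time of the oracle on the restriction of $f^\downarrow$ to $X$ with accuracy $\delta'$ is at most $a|X|/n$. (So the running time of the oracle is taken to depend at least linearly on the size of the ground set.) **Rescaling oracle.** Let $g:2^X\to\mathbb R$ and $m=|X|$. For $\mu\ge\max\{0,-g(X)\}$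 let $g_\mu$ be $0$ at $\emptyset$ and $X$ and $g+\mu$ elsewhere; for a positive definite matrix $Q$ let $\|x\|_Q=\sqrt{x^{\mathsf T}Qx}$. Put $\varepsilon=1/(20m)$, $Q=R=I$, $\mu=\max\{0,-g(X)\}$, and $W=X$ if $g(X)<0$, $W=\emptyset$ otherwise. *Rescaling-SFM* repeats the following $5m\max\{1,\lceil\log_2(2m/\delta)\rceil\}$ times. - (Sliding von Neumann.) Start from $y=g_1/\|g_1\|_Q$ for an extreme base $g_1$ of $g_\mu$. While $\|y\|_Q>\varepsilon$: order $X$ by increasing $Qy$ and let $h$ be the extreme base of $g_\mu$ for this ordering; if $y^{\mathsf T}Qh>0$, let $W$ be a prefix of the ordering that minimizes $g_\mu$, set $\mu=-g(W)$, and recompute $h$ for the new $\mu$; then replace $y$ by the point of least $Q$-norm on $[y,h/\|h\|_Q]$. If $h=0$ (or $g_1=0$), the quotient is read as $0$. This gives $y=\sum_i x_ig_i/\|g_i\|_Q$ with $x\ge 0$, $\sum_i x_i=1$, $\|y\|_Q\le\varepsilon$. - If $y=0$, stop. Otherwise replace $R$ by $(1+\varepsilon)^{-2}\bigl(R+\sum_i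 x_i\|g_i\|_Q^{-2}g_ig_i^{\mathsf T}\bigr)$ and $Q$ by the inverse of the new $R$. From its output a dual point is computed. If it stopped with $y=0$, give each base $g_i$ of the last round the weight $x_i/\|g_i\|_Q$ (the weight $x_i$ if $g_i=0$). Otherwise let $v$ be a used base of least $Q$-norm, give it weight $1$, and go back through the rounds: if $Q,R$ are the matrices before and $Q'$ the matrix after the rescaling of a round with bases $g_i$ and coefficients $x_i$, put $u=(1+\varepsilon)^{-2}RQ'v$, $\beta=\max_i g_i^{\mathsf T}Qu/\|g_i\|_Q$, $\nu_i=\frac{x_i}{\|g_i\|_Q}\bigl(\beta-g_i^{\mathsf T}Qu/\|g_i\|_Q\bigr)$, add $\nu_i$ to the weight of $g_i$, and replace $v$ by $v+\sum_i\nu_ig_i$. Normalize the weights to sum $1$, replace each base of $g_\mu$ by the extreme base of $g$ for the same ordering, and reduce the convex combination to at most $m$ bases (Carathéodory). Return $W$ and this combination. **Theorem.** 1. For every $K$ there is a constant $C$ such that, for every Approx-SFM oracle with constant $K$ and every submodular $f$ with $f(\emptyset)=0$, the bucketed scheme terminates and returns a minimizer of $f$, and for $n\ge 2$ its running time is at most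 $$C\left(n\cdot\mathrm{AO}^\downarrow\bigl(f,n^{-C\log n}\bigr)+n^3\cdot\mathrm{EO}+n^4\right).$$ 2. The rescaling oracle is an Approx-SFM oracle with $K=1$. There is a constant $C$ such that the bucketed scheme with this oracle returns a minimizer of every submodular $f$ with $f(\emptyset)=0$, and for $n\ge2$ its running time is at most $C\,(n^5\cdot\mathrm{EO}+n^6)\log^2 n$; in particular it is strongly polynomial, that is, the number of oracle queries and elementary operations is bounded by a polynomial in $n$. -/

import Mathlib

open scoped ENNReal

noncomputable section

namespace SFM

/-! ## The model of computation: real-number programs with an evaluation oracle -/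

/-- Programs on the ground set `Fin n`. A program learns the set function only through `query`.
`step` is one elementary step: a bounded number of real arithmetic operations, square roots and
comparisons, of array accesses and of index operations. A real division by zero returns `0`. -/
inductive Prog (n : ℕ) (α : Type) : Type
  | ret (a : α) : Prog n α
  | step (p : Prog n α) : Prog n α
  | query (S : Finset (Fin n)) (k : ℝ → Prog n α) : Prog n α

namespace Prog

def bind {n : ℕ} {α β : Type} : Prog n α → (α → Prog n β) → Prog n β
  | ret a, g => g a
  | step p, g => step (bind p g)
  | query S k, g => query S (fun r => bind (k r) g)

instance instMonad (n : ℕ) : Monad (Prog n) where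
  pure := ret
  bind := bind

/-- The output of a program when the evaluation oracle is `f`. -/
def result {n : ℕ} {α : Type} (f : Finset (Fin n) → ℝ) : Prog n α → α
  | ret a => a
  | step p => result f p
  | query S k => result f (k (f S))

/-- The running time of a program when the evaluation oracle is `f`: every oracle query costs `EO`,
every elementary step costs `1`. -/
def time {n : ℕ} {α : Type} (f : Finset (Fin n) → ℝ) (EO : ℕ) : Prog n α → ℕ
  | ret _ => 0
  | step p => time f EO p + 1
  | query S k => time f EO (k (f S)) + EO

/-- Spend `k` elementary steps. -/
def tick {n : ℕ} : ℕ → Prog n Unit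
  | 0 => ret ()
  | k + 1 => step (tick k)

/-- One call of the evaluation oracle. -/
def ask {n : ℕ} (S : Finset (Fin n)) : Prog n ℝ := query S ret

/-- A `for` loop over the list `l` with loop variable `b` and loop state `s`; every pass through the
loop costs one step plus the cost of the body. -/
def loop {n : ℕ} {β σ : Type} (l : List β) (s : σ) (body : σ → β → Prog n σ) : Prog n σ :=
  l.foldlM (fun s b => do tick 1; body s b) s

end Prog

open Prog

/-! ## Vectors and matrices indexed by the ground set -/

abbrev Vec (n : ℕ) := Fin n → ℝ
abbrev Mat (n : ℕ) := Fin n → Fin n → ℝ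

/-- `∑ v ∈ X, F v`. It is used only when a single value `F v` takes a bounded number of steps. -/
def sumOver {n : ℕ} (X : List (Fin n)) (F : Fin n → ℝ) : Prog n ℝ :=
  loop X 0 (fun s v => pure (s + F v))

/-- The vector with entries `F v` for `v ∈ X` and zero elsewhere. It is used only when a single value
`F v` takes a bounded number of steps. -/
def tab {n : ℕ} (X : List (Fin n)) (F : Fin n → ℝ) : Prog n (Vec n) :=
  loop X (fun _ => 0) (fun x v => pure (Function.update x v (F v)))

/-- The matrix with entries `F u v` for `u, v ∈ X` and zero elsewhere. -/
def tab2 {n : ℕ} (X : List (Fin n)) (F : Fin n → Fin n → ℝ) : Prog n (Mat n) :=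
  loop X (fun _ _ => 0) (fun M u => do
    let row ← tab X (F u)
    pure (Function.update M u row))

def dot {n : ℕ} (X : List (Fin n)) (x y : Vec n) : Prog n ℝ := sumOver X (fun v => x v * y v)

def matVec {n : ℕ} (X : List (Fin n)) (Q : Mat n) (x : Vec n) : Prog n (Vec n) :=
  loop X (fun _ => 0) (fun w u => do
    let s ← dot X (Q u) x
    pure (Function.update w u s))

/-- The norm `√(xᵀ Q x)`. -/
def normQ {n : ℕ} (X : List (Fin n)) (Q : Mat n) (x : Vec n) : Prog n ℝ := do
  let w ← matVec X Q x
  let s ← dot X x w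
  tick 1
  pure (Real.sqrt s)

/-- Insert `a` into a list sorted by increasing weight `w`. -/
def insertByWeight {n : ℕ} (w : Vec n) (a : Fin n) : List (Fin n) → Prog n (List (Fin n))
  | [] => do tick 1; pure [a]
  | b :: l => do
    tick 1
    if w a ≤ w b then pure (a :: b :: l) else do
      let r ← insertByWeight w a l
      pure (b :: r)

/-- Order the elements of `X` by increasing weight (insertion sort). -/
def sortByWeight {n : ℕ} (w : Vec n) (X : List (Fin n)) : Prog n (List (Fin n)) :=
  loop X [] (fun l a => insertByWeight w a l)

/-- From an ordering `v₁, v₂, …` and a list of numbers `p₁, p₂, …`, the vector with entry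
`pᵢ - pᵢ₋₁` at `vᵢ`, where `p₀` is the last argument. -/
def marginals {n : ℕ} : List (Fin n) → List ℝ → ℝ → Prog n (Vec n)
  | v :: l, p :: ps, p₀ => do
    tick 1
    let x ← marginals l ps p
    pure (Function.update x v (p - p₀))
  | _, _, _ => pure (fun _ => 0)

/-! ## Submodular functions and the base polytope -/

def IsSubmodular {n : ℕ} (f : Finset (Fin n) → ℝ) : Prop :=
  ∀ S T : Finset (Fin n), f (S ∩ T) + f (S ∪ T) ≤ f S + f T

/-- `g`, restricted to the subsets of `X`, is submodular. -/
def IsSubmodularOn {n : ℕ} (X : Finset (Fin n)) (g : Finset (Fin n) → ℝ) : Prop :=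
  ∀ S ⊆ X, ∀ T ⊆ X, g (S ∩ T) + g (S ∪ T) ≤ g S + g T

def IsMinimizer {n : ℕ} (f : Finset (Fin n) → ℝ) (S : Finset (Fin n)) : Prop :=
  ∀ U : Finset (Fin n), f S ≤ f U

/-- The base polytope of `g : 2^X → ℝ` (the coordinates outside `X` are irrelevant). -/
def basePolytope {n : ℕ} (X : Finset (Fin n)) (g : Finset (Fin n) → ℝ) : Set (Vec n) :=
  {z | (∀ S ⊆ X, ∑ v ∈ S, z v ≤ g S) ∧ ∑ v ∈ X, z v = g X}

/-- The complexity parameter `L_g`, the maximum of `‖z‖₁` over the base polytope. -/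
def complexityL {n : ℕ} (X : Finset (Fin n)) (g : Finset (Fin n) → ℝ) : ℝ :=
  sSup ((fun z : Vec n => ∑ v ∈ X, |z v|) '' basePolytope X g)

/-- The values `g {v₁}, g {v₁, v₂}, …` along the ordering `l = v₁, v₂, …`. -/
def prefixValues {n : ℕ} (g : Finset (Fin n) → ℝ) (l : List (Fin n)) : List ℝ :=
  (List.range l.length).map (fun i => g (l.take (i + 1)).toFinset)

/-- The extreme base of `g` defined by the ordering `l`. -/
def extremeBase {n : ℕ} (g : Finset (Fin n) → ℝ) (l : List (Fin n)) : Vec n := fun v =>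
  g (l.take (l.idxOf v + 1)).toFinset - g (l.take (l.idxOf v)).toFinset

/-! ## Approximate-SFM oracles -/

/-- Access to a set function: a procedure that computes the values of the function along an
ordering. -/
abbrev Access (n : ℕ) := List (Fin n) → Prog n (List ℝ)

/-- One term of a convex combination of extreme bases: coefficient, ordering, extreme base. -/
structure Term (n : ℕ) where
  coef : ℝ
  order : List (Fin n)
  base : Vec n

/-- The output of an approximate-SFM oracle. -/
structure ApproxOutput (n : ℕ) where
  W : Finset (Fin n)
  comb : List (Term n)

/-- The point represented by a combination of extreme bases. -/
def combPoint {n : ℕ} (comb : List (Term n)) : Vec n := fun v =>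
  (comb.map (fun e => e.coef * e.base v)).sum

/-- An algorithm whose input is a finite ground set `X` (as a list), access to a set function on `X`,
and an accuracy. -/
abbrev ApproxAlg := ∀ n : ℕ, List (Fin n) → Access n → ℝ → Prog n (ApproxOutput n)

/-- `out` satisfies the requirement of the oracle for `g : 2^X → ℝ`, the accuracy `δ`, and at most
`K |X|` extreme bases. -/
structure IsApproxOutput {n : ℕ} (K : ℕ) (X : List (Fin n)) (g : Finset (Fin n) → ℝ) (δ : ℝ)
    (out : ApproxOutput n) : Prop where
  subset : out.W ⊆ X.toFinset
  length_le : out.comb.length ≤ K * X.length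
  coef_nonneg : ∀ e ∈ out.comb, 0 ≤ e.coef
  coef_sum : (out.comb.map Term.coef).sum = 1
  order_perm : ∀ e ∈ out.comb, e.order.Perm X
  base_eq : ∀ e ∈ out.comb, ∀ v ∈ X, e.base v = extremeBase g e.order v
  approx : g out.W ≤ ∑ v ∈ X.toFinset, min 0 (combPoint out.comb v) + δ * complexityL X.toFinset g

/-- `A` is an approximate-SFM oracle that uses at most `K |X|` extreme bases: its output is right
for every submodular function `g` on every nonempty ground set `X`, however `g` is accessed. -/
def ApproxAlg.IsApproxSFM (A : ApproxAlg) (K : ℕ) : Prop :=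
  ∀ (n : ℕ) (X : List (Fin n)) (acc : Access n) (f g : Finset (Fin n) → ℝ) (δ : ℝ),
    X.Nodup → X ≠ [] → IsSubmodularOn X.toFinset g → g ∅ = 0 →
    (∀ l : List (Fin n), l.Nodup → l ⊆ X → (acc l).result f = prefixValues g l) → 0 < δ →
    IsApproxOutput K X g δ ((A n X acc δ).result f)

/-! ## The bucketed strongly polynomial scheme

The current function is a contraction of the input function on the ground set `Fin n`; the strongly
connected components of the digraph of the ring family are represented by their least elements. -/

/-- `T` is the set of contracted elements and `fT` the value at `T`; `top` is the current (truncated)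
value of the full ground set. `le u v` says `u ≼ v`: the current (transitively closed, reflexive)
digraph has an arc from `v` to `u`, that is, every set of the ring family that contains `v` contains
`u`. -/
structure State (n : ℕ) where
  T : Finset (Fin n)
  fT : ℝ
  top : ℝ
  le : Fin n → Fin n → Bool

namespace State

variable {n : ℕ}

/-- The input function with its value at the full ground set replaced by `top`. -/
def val (s : State n) (f : Finset (Fin n) → ℝ) (U : Finset (Fin n)) : ℝ :=
  if U = Finset.univ then s.top else f U

def valT (s : State n) (U : Finset (Fin n)) : Prog n ℝ := do
  tick n
  if U = Finset.univ then pure s.top else ask U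

/-- `v` is a vertex of the current contracted digraph. -/
def isRep (s : State n) (v : Fin n) : Bool :=
  decide (v ∉ s.T ∧ ∀ u < v, ¬ (s.le u v = true ∧ s.le v u = true))

/-- The current ground set. -/
def reps (s : State n) : List (Fin n) := (List.finRange n).filter (fun v => s.isRep v)

/-- `T ∪ (V \ v↑)`. -/
def outside (s : State n) (v : Fin n) : Finset (Fin n) :=
  Finset.univ.filter (fun u => u ∈ s.T ∨ s.le v u = false)

/-- `T ∪ (V \ v↑) ∪ {v}`. -/
def outsideWith (s : State n) (v : Fin n) : Finset (Fin n) :=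
  Finset.univ.filter (fun u => u ∈ s.T ∨ s.le v u = false ∨ s.le u v = true)

/-- `T ∪ X↓`. -/
def down (s : State n) (X : Finset (Fin n)) : Finset (Fin n) :=
  Finset.univ.filter (fun u => u ∈ s.T ∨ ∃ v ∈ X, s.le u v = true)

/-- The lower bound `ℓ(v)`. -/
def ell (s : State n) (f : Finset (Fin n) → ℝ) (v : Fin n) : ℝ :=
  s.val f (s.outsideWith v) - s.val f (s.outside v)

/-- `ℓ⁻` as a vector on the current ground set. -/
def negEll (s : State n) (f : Finset (Fin n) → ℝ) : Vec n := fun v =>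
  if s.isRep v = true then min 0 (s.ell f v) else 0

/-- Evaluation of the function `f↓(X) = f(X↓) - ℓ⁻(X↓ \ X)` along an ordering, where `f` is the current
function (its value at `X` is the value at `T ∪ X` minus `fT`) and `m` is the vector `ℓ⁻`. The set
`T ∪ X↓` and the number `ℓ⁻(X↓ \ X)` are updated in a linear number of steps when an element is added
to `X`. -/
def downAccess (s : State n) (m : Vec n) : Access n := fun l => do
  let r ← loop l ((s.T, 0, []) : Finset (Fin n) × ℝ × List ℝ) (fun r v => do
    tick n
    let D := r.1 ∪ Finset.univ.filter (fun u => s.le u v = true)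
    let c ← sumOver (List.finRange n) (fun u => if u ∈ D ∧ u ∉ r.1 then m u else 0)
    let q ← s.valT D
    let t := r.2.1 + c - m v
    pure (D, t, r.2.2 ++ [q - s.fT - t]))
  pure r.2.2

/-- The current ground set, computed. -/
def repsT (s : State n) : Prog n (List (Fin n)) := do
  tick (n * n)
  pure s.reps

/-- The values `f(V \ v↑)` and `ℓ(v)` of the current function, for all `v` in the ground set `V`. -/
def lowerBounds (s : State n) (V : List (Fin n)) : Prog n (Vec n × Vec n) :=
  loop V ((fun _ => 0, fun _ => 0) : Vec n × Vec n) (fun r v => do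
    tick (2 * n)
    let a ← s.valT (s.outside v)
    let b ← s.valT (s.outsideWith v)
    pure (Function.update r.1 v (a - s.fT), Function.update r.2 v (b - a)))

end State

/-- Bucketing: starting from `t`, the least `b` with `|V^b| ≤ 2 |V^(b-1)|`, where `V^t` is the set of
all `z` with `ℓ(z) ≤ 2 ℓ⁻(V) / q^t`. Here `l` is `ℓ`, `lm` is `ℓ⁻(V)`, and the first numerical argument
limits the number of values that are tried. -/
def bucketIndex {n : ℕ} (V : List (Fin n)) (l : Vec n) (lm q : ℝ) : ℕ → ℕ → Prog n ℕ
  | 0, t => pure t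
  | k + 1, t => do
    tick (2 * V.length + t)
    if V.countP (fun z => decide (l z ≤ 2 * lm / q ^ t))
        ≤ 2 * V.countP (fun z => decide (l z ≤ 2 * lm / q ^ (t - 1))) then pure t
    else bucketIndex V l lm q k (t + 1)

/-- Add the arc `(v, z)`, that is `z ≼ v`, and restore the transitive closure. -/
def addArc {n : ℕ} (le : Fin n → Fin n → Bool) (v z : Fin n) : Prog n (Fin n → Fin n → Bool) := do
  tick 1
  if le z v = true then pure le else do
    tick (n * n)
    pure (fun a b => le a b || (le a z && le v b))

/-- The step of the scheme that treats `z`, where `y` is the convex combination `gs` of extreme bases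
of `f↓`, and `c` is the value `f(V \ z↑)`: if `c > -2k|V| y⁻(V \ z↑)`, choose the base `gᵢ` that
maximizes `xᵢ (c - gᵢ(V \ z↑))`, compute `gᵢ'` by moving `z↑` to the end of its ordering, set
`y' = y + xᵢ (gᵢ' - gᵢ)`, and add the arc `(v, z)` to the digraph `le₁` for all `v ∈ V \ z↑` with
`y'(v) > - y'⁻(V \ z↑)`. -/
def treatElement {n : ℕ} (s : State n) (V : List (Fin n)) (acc : Access n) (gs : List (Term n))
    (y : Vec n) (c : ℝ) (z : Fin n) (le₁ : Fin n → Fin n → Bool) :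
    Prog n (Fin n → Fin n → Bool) := do
  let yneg ← sumOver V (fun u => if s.le z u = true then 0 else min 0 (y u))
  if c > -(2 * (gs.length : ℝ) * (V.length : ℝ)) * yneg then do
    let best ← loop gs (none : Option (Term n × ℝ)) (fun r e => do
      let a ← sumOver V (fun u => if s.le z u = true then 0 else e.base u)
      let score := e.coef * (c - a)
      match r with
      | none => pure (some (e, score))
      | some (e', score') => pure (if score' < score then some (e, score) else some (e', score')))
    match best with
    | none => pure le₁
    | some (e, _) => do
      tick (2 * e.order.length)
      let τ := e.order.filter (fun u => !s.le z u) ++ e.order.filter (fun u => s.le z u)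
      let ps ← acc τ
      let g' ← marginals τ ps 0
      let y' ← tab V (fun u => y u + e.coef * (g' u - e.base u))
      let yneg' ← sumOver V (fun u => if s.le z u = true then 0 else min 0 (y' u))
      loop V le₁ (fun le₂ v =>
        if s.le z v = false ∧ y' v > -yneg' then addArc le₂ v z else pure le₂)
  else pure le₁

/-- Contraction of `v↓`, followed by the truncation of the value of the full ground set. -/
def contractElement {n : ℕ} (s : State n) (v : Fin n) : Prog n (State n) := do
  tick n
  let U := s.down {v}
  let c ← s.valT U
  pure { s with T := U, fT := c, top := min s.top c }

/-- One iteration of the main loop, with `κ = K n`. The output is `none` if the algorithm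
terminates in the present state. -/
def iteration (K : ℕ) (A : ApproxAlg) {n : ℕ} (s : State n) : Prog n (Option (State n)) := do
  let V ← s.repsT
  let fl ← s.lowerBounds V
  let l := fl.2
  let lm ← sumOver V (fun v => min 0 (l v))
  tick 1
  if lm ≥ 0 then pure none else do
    let q : ℝ := (4 * ((K : ℝ) * (n : ℝ)) * (n : ℝ)) ^ 4
    let b ← bucketIndex V l lm q (n + 2) 1
    tick (b + 2 * V.length)
    let δ' : ℝ := 1 / q ^ b
    let δ : ℝ := (2 * (n : ℝ) ^ 2 + 1) / q ^ b
    let X := V.filter (fun z => decide (l z ≤ 2 * lm / q ^ b))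
    let rest := V.filter (fun z => !decide (l z ≤ 2 * lm / q ^ b))
    let acc := s.downAccess (fun v => min 0 (l v))
    let out ← A n X acc δ'
    -- the extension of the output from `X` to the current ground set
    let ps ← acc (X ++ rest)
    let ext ← marginals (X ++ rest) ps 0
    let gs ← loop out.comb ([] : List (Term n)) (fun r e => do
      tick V.length
      let g ← tab V (fun v => if l v ≤ 2 * lm / q ^ b then e.base v else ext v)
      pure (⟨e.coef, e.order ++ rest, g⟩ :: r))
    let y ← loop gs (fun _ => 0) (fun y e => tab V (fun v => y v + e.coef * e.base v))
    -- new arcs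
    let le₁ ← loop V s.le (fun le₁ z => treatElement s V acc gs y (fl.1 z) z le₁)
    -- contractions
    let s' ← loop V { s with le := le₁ } (fun s' v =>
      if y v < 2 * lm * δ ∧ v ∉ s'.T then contractElement s' v else pure s')
    pure (some s')

/-- The main loop. The first argument limits the number of iterations; the output is `none` if the
limit is reached before the algorithm terminates. -/
def mainLoop (K : ℕ) (A : ApproxAlg) {n : ℕ} : ℕ → State n → Prog n (Option (Finset (Fin n)))
  | 0, _ => pure none
  | k + 1, s => do
    let r ← iteration K A s
    match r with
    | none => pure (some s.T)
    | some s' => mainLoop K A k s'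

/-- The bucketed variant of the strongly polynomial scheme, with the approximate-SFM oracle `A` that
uses at most `K |X|` extreme bases. -/
def bucketedSFM (K : ℕ) (A : ApproxAlg) (n : ℕ) : Prog n (Option (Finset (Fin n))) := do
  let a ← ask Finset.univ
  tick (n * n + 1)
  mainLoop K A (n ^ 2 + n + 1) ⟨∅, 0, min 0 a, fun u v => decide (u = v)⟩

/-- `s` describes a reduction of `f`: a contraction of a set `T` that is contained in every minimizer,
with a truncated value of the full ground set, together with a ring family that contains all
minimizers. -/
structure IsReduction {n : ℕ} (f : Finset (Fin n) → ℝ) (s : State n) : Prop where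
  refl : ∀ u, s.le u u = true
  trans : ∀ u v w, s.le u v = true → s.le v w = true → s.le u w = true
  subset_minimizer : ∀ M, IsMinimizer f M → s.T ⊆ M
  minimizer_closed : ∀ M, IsMinimizer f M → ∀ u v, s.le u v = true → v ∈ M → u ∈ M
  closed : ∀ u v, s.le u v = true → v ∈ s.T → u ∈ s.T
  fT_eq : s.fT = f s.T
  top_eq : s.top = f Finset.univ ∨ ∃ T' ⊆ s.T, s.top = f T'
  top_le_univ : s.top ≤ f Finset.univ
  top_le : s.top ≤ s.fT

/-- `AO↓(f, δ)`, the worst running time of the oracle `A` on the functions `f↓` of the reductions of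
`f` and on their restrictions, for accuracies in `[δ, 1]`. The running time on a ground set `X` is
scaled by `n / |X|`: this is the least number `a` such that the oracle takes time at most `a |X| / n`
on the ground set `X`. -/
def AOdown (A : ApproxAlg) {n : ℕ} (f : Finset (Fin n) → ℝ) (EO : ℕ) (δ : ℝ) : ℝ≥0∞ :=
  ⨆ (s : State n) (_ : IsReduction f s) (X : List (Fin n))
    (_ : X ≠ [] ∧ X.Nodup ∧ ∀ v ∈ X, s.isRep v = true) (δ' : ℝ) (_ : δ ≤ δ' ∧ δ' ≤ 1),
    (n : ℝ≥0∞) / (X.length : ℝ≥0∞) *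
      (((A n X (s.downAccess (s.negEll f)) δ').time f EO : ℕ) : ℝ≥0∞)

/-! ## The oracle given by geometric rescaling -/

/-- A base used by the sliding von Neumann algorithm: its ordering, the extreme bases of `g` and of
`g_μ` for this ordering, its coefficient `x`, and the `Q`-norm of the extreme base of `g_μ`. -/
structure VNTerm (n : ℕ) where
  order : List (Fin n)
  base : Vec n
  gbase : Vec n
  coef : ℝ
  nrm : ℝ

structure VNState (n : ℕ) where
  mu : ℝ
  W : Finset (Fin n)
  y : Vec n
  terms : List (VNTerm n)

/-- The values of `g_μ` along an ordering of the whole ground set, from those of `g`. -/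
def enlarge (mu : ℝ) : List ℝ → List ℝ
  | [] => []
  | [_] => [0]
  | p :: p' :: ps => (p + mu) :: enlarge mu (p' :: ps)

/-- The position of a least entry. -/
def argminIndex {n : ℕ} (qs : List ℝ) : Prog n ℕ :=
  loop (List.range qs.length) 0 (fun b i => pure (if qs.getD i 0 < qs.getD b 0 then i else b))

/-- The sliding von Neumann loop; the first numerical argument limits the number of iterations. -/
def vonNeumannLoop {n : ℕ} (X : List (Fin n)) (acc : Access n) (Q : Mat n) (ε : ℝ) :
    ℕ → VNState n → Prog n (VNState n)
  | 0, s => pure s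
  | k + 1, s => do
    let w ← matVec X Q s.y
    let yy ← dot X s.y w
    tick 1
    if Real.sqrt yy ≤ ε then pure s else do
      let l ← sortByWeight w X
      let ps ← acc l
      tick (2 * X.length)
      let g₀ ← marginals l (enlarge s.mu ps) 0
      let ip ← dot X w g₀
      let i ← argminIndex (enlarge s.mu ps)
      -- sliding
      let mu := if 0 < ip then -(ps.getD i 0) else s.mu
      let W := if 0 < ip then (l.take (i + 1)).toFinset else s.W
      tick (2 * X.length)
      let base ← marginals l ps 0
      let g ← marginals l (enlarge mu ps) 0
      let nrm ← normQ X Q g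
      let d ← tab X (fun v => s.y v - g v / nrm)
      let num ← dot X d w
      let dq ← matVec X Q d
      let den ← dot X d dq
      let lam := num / den
      let y ← tab X (fun v => (1 - lam) * s.y v + lam * (g v / nrm))
      tick s.terms.length
      let old := s.terms.map (fun e => { e with coef := (1 - lam) * e.coef })
      vonNeumannLoop X acc Q ε k ⟨mu, W, y, ⟨l, base, g, lam, nrm⟩ :: old⟩

/-- The sliding von Neumann algorithm, started from the extreme base for the ordering `X`; `ps` are
the values of `g` along this ordering. -/
def slidingVonNeumann {n : ℕ} (X : List (Fin n)) (acc : Access n) (ps : List ℝ) (Q : Mat n) (ε : ℝ)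
    (N : ℕ) (mu : ℝ) (W : Finset (Fin n)) : Prog n (VNState n) := do
  tick X.length
  let base ← marginals X ps 0
  let g ← marginals X (enlarge mu ps) 0
  let nrm ← normQ X Q g
  let y ← tab X (fun v => g v / nrm)
  vonNeumannLoop X acc Q ε N ⟨mu, W, y, [⟨X, base, g, 1, nrm⟩]⟩

/-- The rescaling `R' = (R + ∑ xᵢ / ‖gᵢ‖² gᵢ gᵢᵀ) / (1 + ε)²`, `Q' = R'⁻¹`; the inverse matrix is
maintained under the rank-one updates. The output is `(Q', R')`. -/
def rescale {n : ℕ} (X : List (Fin n)) (ε : ℝ) (Q R : Mat n) (terms : List (VNTerm n)) :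
    Prog n (Mat n × Mat n) := do
  let r ← loop terms (Q, R) (fun r e => do
    let c := e.coef / e.nrm ^ 2
    let q ← matVec X r.1 e.gbase
    let t ← dot X e.gbase q
    let Q' ← tab2 X (fun u v => r.1 u v - c / (1 + c * t) * q u * q v)
    let R' ← tab2 X (fun u v => r.2 u v + c * e.gbase u * e.gbase v)
    pure (Q', R'))
  let Q' ← tab2 X (fun u v => (1 + ε) ^ 2 * r.1 u v)
  let R' ← tab2 X (fun u v => r.2 u v / (1 + ε) ^ 2)
  pure (Q', R')

/-- The data of one rescaling: the matrices before the rescaling and the bases used in it. -/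
structure Round (n : ℕ) where
  Q : Mat n
  R : Mat n
  terms : List (VNTerm n)

/-- Among all bases used, one with least `Q`-norm. -/
def leastNormTerm {n : ℕ} (X : List (Fin n)) (Q : Mat n) (hist : List (Round n)) :
    Prog n (Option (VNTerm n × ℝ)) :=
  loop hist none (fun best r => loop r.terms best (fun best e => do
    let a ← normQ X Q e.gbase
    match best with
    | none => pure (some (e, a))
    | some (e', a') => pure (if a < a' then some (e, a) else some (e', a'))))

/-- Pulling back the vector `v` through one rescaling `r`, where `Q'` is the matrix after the
rescaling: the vector becomes `v + ∑ νᵢ gᵢ`, and the pairs `(gᵢ, νᵢ)` are added to the list. -/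
def pullBackRound {n : ℕ} (X : List (Fin n)) (ε : ℝ) (r : Round n) (Q' : Mat n) (v : Vec n)
    (wts : List (VNTerm n × ℝ)) : Prog n (Vec n × List (VNTerm n × ℝ)) := do
  let a ← matVec X Q' v
  let a' ← matVec X r.R a
  let u ← tab X (fun i => a' i / (1 + ε) ^ 2)
  let qu ← matVec X r.Q u
  -- the pairs of `gᵢ` and `⟨gᵢ, u⟩ / ‖gᵢ‖`, and the maximum `β` of the second entries
  let m ← loop r.terms (([], none) : List (VNTerm n × ℝ) × Option ℝ) (fun m e => do
    let c ← dot X e.gbase qu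
    let t := c / e.nrm
    pure ((e, t) :: m.1, match m.2 with
      | none => some t
      | some β => some (max β t)))
  let β := m.2.getD 0
  loop m.1 (v, wts) (fun s p => do
    let ν := p.1.coef / p.1.nrm * (β - p.2)
    let v' ← tab X (fun i => s.1 i + ν * p.1.gbase i)
    pure (v', (p.1, ν) :: s.2))

/-- Nonnegative weights of bases used in the algorithm such that the weighted average of the bases
has a small norm; the last rescaling comes first in `hist`, and `Q` is the final matrix. -/
def pullBack {n : ℕ} (X : List (Fin n)) (ε : ℝ) (Q : Mat n) (hist : List (Round n)) :
    Prog n (List (VNTerm n × ℝ)) := do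
  let best ← leastNormTerm X Q hist
  match best with
  | none => pure []
  | some (e, _) => do
    let r ← loop hist ((Q, e.gbase, [(e, 1)]) : Mat n × Vec n × List (VNTerm n × ℝ)) (fun s r => do
      let t ← pullBackRound X ε r s.1 s.2.1 s.2.2
      pure (r.Q, t.1, t.2))
    pure r.2.2

/-- The rescaling algorithm with the given number of rescalings left, followed by the pull-back. If
the von Neumann algorithm returns `y = 0`, the algorithm stops with the weights `xᵢ / ‖gᵢ‖`. The
output is the set `W` and the weighted bases. -/
def rescalingLoop {n : ℕ} (X : List (Fin n)) (acc : Access n) (ps : List ℝ) (ε : ℝ) (N : ℕ) :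
    ℕ → ℝ → Finset (Fin n) → Mat n → Mat n → List (Round n) →
      Prog n (Finset (Fin n) × List (VNTerm n × ℝ))
  | 0, _, W, Q, _, hist => do
    let wts ← pullBack X ε Q hist
    pure (W, wts)
  | k + 1, mu, W, Q, R, hist => do
    let s ← slidingVonNeumann X acc ps Q ε N mu W
    let a ← sumOver X (fun v => |s.y v|)
    tick 1
    if a = 0 then do
      tick s.terms.length
      pure (s.W, s.terms.map (fun e => (e, if e.nrm = 0 then e.coef else e.coef / e.nrm)))
    else do
      let r ← rescale X ε Q R s.terms
      rescalingLoop X acc ps ε N k s.mu s.W r.1 r.2 (⟨Q, R, s.terms⟩ :: hist)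

/-- The state of the reduction of a conic combination to linearly independent vectors: a basis of
`ℝ^X` with one vector for each `v ∈ X`, namely the vector of the stored term or an artificial unit
vector, the coefficients, and the inverse of the matrix of the basis. -/
structure CaraState (n : ℕ) where
  slot : Fin n → Option (VNTerm n)
  coef : Vec n
  inv : Mat n

/-- Exchange the basis vector in position `r` for a vector with coordinates `d` in the current
basis. -/
def pivot {n : ℕ} (X : List (Fin n)) (d : Vec n) (r : Fin n) (B : Mat n) : Prog n (Mat n) :=
  tab2 X (fun u v => if u = r then B r v / d r else B u v - d u * (B r v / d r))

/-- Add the term `e`, with the vector `base + shift` and the weight `lam`, to the combination. -/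
def caraAdd {n : ℕ} (X : List (Fin n)) (shift : ℝ) (s : CaraState n) (e : VNTerm n) (lam : ℝ) :
    Prog n (CaraState n) := do
  let a ← tab X (fun v => e.base v + shift)
  let d ← matVec X s.inv a
  -- an artificial position with a nonzero coordinate
  let r ← loop X (none : Option (Fin n)) (fun r v =>
    pure (if (s.slot v).isNone = true ∧ d v ≠ 0 then some v else r))
  match r with
  | some r => do
    let B ← pivot X d r s.inv
    pure ⟨Function.update s.slot r (some e), Function.update s.coef r lam, B⟩
  | none => do
    -- the ratio test
    let t ← loop X (none : Option (Fin n × ℝ)) (fun t v =>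
      pure (if d v < 0 then
        match t with
        | none => some (v, s.coef v / (-d v))
        | some (v', c) => if s.coef v / (-d v) < c then some (v, s.coef v / (-d v)) else some (v', c)
      else t))
    match t with
    | none => do
      let c ← tab X (fun v => s.coef v + lam * d v)
      pure ⟨s.slot, c, s.inv⟩
    | some (r, θ) => do
      if lam ≤ θ then do
        let c ← tab X (fun v => s.coef v + lam * d v)
        pure ⟨s.slot, c, s.inv⟩
      else do
        let c ← tab X (fun v => s.coef v + θ * d v)
        let B ← pivot X d r s.inv
        pure ⟨Function.update s.slot r (some e), Function.update c r (lam - θ), B⟩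

/-- Write the convex combination `∑ λᵢ base i` given by `terms` as a convex combination of at most
`|X|` of the extreme bases; `gX` is the value of the function at the ground set. The shift makes all
coordinate sums equal to `1`, so that the sum of the coefficients is preserved. -/
def caratheodory {n : ℕ} (X : List (Fin n)) (gX : ℝ) (terms : List (VNTerm n × ℝ)) :
    Prog n (List (Term n)) := do
  let B ← tab2 X (fun u v => if u = v then 1 else 0)
  let shift := (1 - gX) / (X.length : ℝ)
  let s ← loop terms (⟨fun _ => none, fun _ => 0, B⟩ : CaraState n)
    (fun s p => caraAdd X shift s p.1 p.2)
  loop X ([] : List (Term n)) (fun out v =>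
    match s.slot v with
    | none => pure out
    | some e => pure (⟨s.coef v, e.order, e.base⟩ :: out))

/-- The approximate-SFM oracle that runs Rescaling-SFM with `T = 5 m p` rescalings, where `m = |X|` and
`p = max {1, ⌈log₂ (2m/δ)⌉}` (computed by repeated doubling), and `ε = 1/(20m)`; then it pulls back a
base of small norm, slides back to the bases of `g`, and reduces the number of bases. -/
def rescalingOracle : ApproxAlg := fun n X acc δ => do
  let m := X.length
  let ε : ℝ := 1 / (20 * (m : ℝ))
  let p := max 1 (Nat.clog 2 ⌈2 * (m : ℝ) / δ⌉₊)
  tick (p + m)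
  let ps ← acc X
  let gX := ps.getLastD 0
  let one ← tab2 X (fun u v => if u = v then 1 else 0)
  let W₀ : Finset (Fin n) := if gX < 0 then X.toFinset else ∅
  let r ← rescalingLoop X acc ps ε (400 * m ^ 2) (5 * m * p) (max 0 (-gX)) W₀ one one []
  let α ← loop r.2 (0 : ℝ) (fun t w => pure (t + w.2))
  tick r.2.length
  let comb ← caratheodory X gX (r.2.map (fun w => (w.1, w.2 / α)))
  pure ⟨r.1, comb⟩

end SFM

end

noncomputable section

namespace SFM

open Prog State

/-! ### Results and running times of programs -/

namespace Prog

variable {n : ℕ} {α β σ : Type} (f : Finset (Fin n) → ℝ) (EO : ℕ)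

/-! Correctness of the scheme. A state keeps a set `T` contained in every minimizer and a preorder
of which every minimizer is an ideal. The inequality behind most of the argument is
`IsReduction.sum_negEll_le`: on ideals, the function `S ↦ f(S) - ℓ⁻(S)` is monotone. An ideal is
built up one equivalence class at a time, and by submodularity a class with representative `r` costs
at least `ℓ(r)`. Monotonicity makes `f↓` submodular, bounds the entries of its bases below by `ℓ⁻`
and, together with the truncated value of the full set, gives `L ≤ -2ℓ⁻(V)`. It also shows that `T`
is a minimizer once `ℓ⁻(V) = 0`.

For an ideal `S` the value `f↓(S)` is `f(S) - f(T)`, and a base `y` of `f↓` satisfies `y(S) ≤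
f↓(S)`. Two tests follow. If `y` comes from the oracle and `y(v)` is very negative, a minimizer
avoiding `v` would have a value above that of the set `W` of the oracle, so `v` lies in all
minimizers (`IsReduction.mem_minimizer_of_lt`). If `y'(v)` outweighs the negative part of a base
`y'` on `V \ z↑`, a minimizer containing `v` but not `z` would be worse than `T`, so `z ≼ v` may be
added (`IsReduction.mem_minimizer_of_arc`).

Progress. If nothing is contracted, `y` is bounded below everywhere, and for `z ∈ V^(b-1)` the value
`f(V \ z↑) = f((V \ z↑) ∪ {z}) - ℓ(z)` is large compared with the negative part of `y`
(`IsReduction.fires`). Exchanging the best of the `k` bases then raises `y(V \ z↑)` by at least a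
`1/k` share of its slack, which forces a new arc with source `z` (`IsReduction.exchange_spec`). So
an iteration either contracts something or adds at least `|V^(b-1)| ≥ |V^b| / 2` arcs.

Running time. The potential `2 · arcs + n · |T|` is at most `3n²` and grows by at least `|V^b|` per
iteration. A call on `X = V^b` costs at most `a |X| / n`, so all calls together cost at most `3na`.
There are `O(n²)` iterations and at most `n²` arcs, and each costs `O(n² + n EO)` besides the
oracle, with a constant depending on `K`. The sets `V^1, V^2, …` at least double in size until `b`
is reached, hence `b ≤ log₂ n + 2` and the accuracies stay above `n^(-C log n)`.

The rescaling oracle. Sliding replaces `μ` by `-g(W)` for a better set `W` whenever the von Neumann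
step would otherwise fail to make progress, so each inner loop reaches `‖y‖_Q ≤ ε` within `400m²`
steps. A rescaling multiplies `det R` by at least `2 / (1+ε)^(2m)`. After `5mp` rescalings `det R ≥
16^(pm)`, while by the arithmetic-geometric mean inequality `det R` is at most `(tr R / m)^m`, and
`tr R` is controlled by the ratios of the Euclidean to the `Q`-norms of the bases. Hence some base
has a tiny `Q`-norm (`Chain.least_norm_le`). Going back through one rescaling, nonnegative multiples
of the bases of that round can be added without increasing the norm (`pullBack_bil_le`). At the
start the norm is Euclidean, so a combination of bases of total weight at least `1` is almost zero.
A base of `g_μ` exceeds the base of `g` for the same ordering by a vector of total mass at most `μ =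
-g(W)`, so the same weights on the bases of `g` certify that `W` is nearly optimal
(`approx_of_sum_abs_le`). Since `δ ≥ n^(-O(log n))`, `p` is `O(log² n)`, and the second bound
follows from the first analysis. -/

@[simp] theorem result_pure (a : α) : (pure a : Prog n α).result f = a := rfl

@[simp] theorem time_pure (a : α) : (pure a : Prog n α).time f EO = 0 := rfl

@[simp] theorem result_bind (p : Prog n α) (g : α → Prog n β) :
    (p >>= g).result f = (g (p.result f)).result f := by
  change (Prog.bind p g).result f = _
  induction p with
  | ret a => rfl
  | step p ih => simpa [Prog.bind, result] using ih
  | query S k ih => simpa [Prog.bind, result] using ih _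

@[simp] theorem time_bind (p : Prog n α) (g : α → Prog n β) :
    (p >>= g).time f EO = p.time f EO + (g (p.result f)).time f EO := by
  change (Prog.bind p g).time f EO = _
  induction p with
  | ret a => simp [Prog.bind, time, result]
  | step p ih => simp [Prog.bind, time, result, ih]; omega
  | query S k ih => simp [Prog.bind, time, result, ih]; omega

@[simp] theorem result_tick (k : ℕ) : (tick k : Prog n Unit).result f = () := rfl

@[simp] theorem time_tick (k : ℕ) : (tick k : Prog n Unit).time f EO = k := by
  induction k with
  | zero => rfl
  | succ k ih => simp [tick, time, ih]

@[simp] theorem result_ask (S : Finset (Fin n)) : (ask S).result f = f S := rfl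

@[simp] theorem time_ask (S : Finset (Fin n)) : (ask S).time f EO = EO := by
  simp [ask, time]

theorem result_ite (c : Prop) [Decidable c] (p q : Prog n α) :
    (if c then p else q).result f = if c then p.result f else q.result f := by
  split_ifs <;> rfl

theorem time_ite (c : Prop) [Decidable c] (p q : Prog n α) :
    (if c then p else q).time f EO = if c then p.time f EO else q.time f EO := by
  split_ifs <;> rfl

@[simp] theorem loop_nil (s : σ) (body : σ → β → Prog n σ) : loop [] s body = pure s := rfl

theorem result_loop_cons (b : β) (l : List β) (s : σ) (body : σ → β → Prog n σ) :
    (loop (b :: l) s body).result f = (loop l ((body s b).result f) body).result f := by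
  simp [loop]

theorem time_loop_cons (b : β) (l : List β) (s : σ) (body : σ → β → Prog n σ) :
    (loop (b :: l) s body).time f EO =
      1 + (body s b).time f EO + (loop l ((body s b).result f) body).time f EO := by
  simp [loop]

theorem result_loop (l : List β) (s : σ) (body : σ → β → Prog n σ) :
    (loop l s body).result f = l.foldl (fun s b => (body s b).result f) s := by
  induction l generalizing s with
  | nil => rfl
  | cons b l ih => rw [result_loop_cons, ih, List.foldl_cons]

/-- The program `p` ends with a result and a running time that satisfy `Q`. -/
def Runs (p : Prog n α) (Q : α → ℕ → Prop) : Prop := Q (p.result f) (p.time f EO)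

variable {f EO}

theorem Runs.mono {p : Prog n α} {Q Q' : α → ℕ → Prop} (h : p.Runs f EO Q)
    (hQ : ∀ a t, Q a t → Q' a t) : p.Runs f EO Q' := hQ _ _ h

theorem Runs.bind {p : Prog n α} {g : α → Prog n β} {P : α → ℕ → Prop} {Q : β → ℕ → Prop}
    (hp : p.Runs f EO P) (hg : ∀ a t, P a t → (g a).Runs f EO (fun b t' => Q b (t + t'))) :
    (p >>= g).Runs f EO Q := by
  unfold Runs
  rw [result_bind, time_bind]
  exact hg _ _ hp

theorem Runs.pure {a : α} {Q : α → ℕ → Prop} (h : Q a 0) :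
    (Pure.pure a : Prog n α).Runs f EO Q := h

/-- The strongest postcondition. It lets `Runs.bind` pass over a subprogram whose result and time
are evaluated only where they are needed. -/
theorem Runs.exact (p : Prog n α) :
    p.Runs f EO (fun a t => a = p.result f ∧ t = p.time f EO) := ⟨rfl, rfl⟩

/-- The rule for `for` loops: the invariant depends on the list of the values of the loop variable
that have been treated, on the loop state, and on the time spent. -/
theorem Runs.loop {l : List β} {s : σ} {body : σ → β → Prog n σ}
    (I : List β → σ → ℕ → Prop) (h0 : I [] s 0)
    (hI : ∀ pre b post, l = pre ++ b :: post → ∀ s t, I pre s t →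
      (body s b).Runs f EO (fun s' t' => I (pre ++ [b]) s' (t + (1 + t')))) :
    (loop l s body).Runs f EO (I l) := by
  suffices H : ∀ post pre s t, l = pre ++ post → I pre s t →
      (Prog.loop post s body).Runs f EO (fun s' t' => I l s' (t + t')) by
    simpa [Runs] using H l [] s 0 rfl h0
  intro post
  induction post with
  | nil =>
    intro pre s t hl hs
    simp only [List.append_nil] at hl
    subst hl
    exact hs
  | cons b post ih =>
    intro pre s t hl hs
    have := ih (pre ++ [b]) _ _ (by simp [hl]) (hI pre b post hl s t hs)
    unfold Runs at this ⊢
    rw [result_loop_cons, time_loop_cons]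
    simpa [add_assoc] using this

theorem time_loop_eq {l : List β} {s : σ} {body : σ → β → Prog n σ} {c : ℕ}
    (h : ∀ s, ∀ b ∈ l, (body s b).time f EO = c) :
    (Prog.loop l s body).time f EO = l.length * (c + 1) := by
  induction l generalizing s with
  | nil => simp
  | cons b l ih =>
    rw [time_loop_cons, List.length_cons, Nat.succ_mul]
    have h1 := h s b (by simp)
    have h2 := ih (s := (body s b).result f) (fun s b hb => h s b (by simp [hb]))
    omega

end Prog

/-! ### Vector operations, sorting and marginal values. -/

section Vectors

variable {n : ℕ} (f : Finset (Fin n) → ℝ) (EO : ℕ) (X : List (Fin n))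

theorem foldl_add_eq {β : Type} (l : List β) (F : β → ℝ) (a : ℝ) :
    l.foldl (fun s b => s + F b) a = a + (l.map F).sum := by
  induction l generalizing a with
  | nil => simp
  | cons b l ih => simp [ih, add_assoc]

@[simp] theorem result_sumOver (F : Fin n → ℝ) : (sumOver X F).result f = (X.map F).sum := by
  simp [sumOver, result_loop, foldl_add_eq]

@[simp] theorem time_sumOver (F : Fin n → ℝ) : (sumOver X F).time f EO = X.length := by
  rw [sumOver, time_loop_eq (c := 0) (by simp)]
  simp

theorem foldl_update_eq {β : Type} (l : List (Fin n)) (F : Fin n → β) (x : Fin n → β) :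
    l.foldl (fun x v => Function.update x v (F v)) x = fun v => if v ∈ l then F v else x v := by
  induction l generalizing x with
  | nil => simp
  | cons b l ih =>
    rw [List.foldl_cons, ih]
    ext v
    by_cases h : v ∈ l
    · simp [h]
    · by_cases hb : v = b
      · subst hb; simp
      · simp [h, hb]

@[simp] theorem result_tab (F : Fin n → ℝ) :
    (tab X F).result f = fun v => if v ∈ X then F v else 0 := by
  simp [tab, result_loop, foldl_update_eq]

@[simp] theorem time_tab (F : Fin n → ℝ) : (tab X F).time f EO = X.length := by
  rw [tab, time_loop_eq (c := 0) (by simp)]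
  simp

@[simp] theorem result_tab2 (F : Fin n → Fin n → ℝ) :
    (tab2 X F).result f = fun u v => if u ∈ X ∧ v ∈ X then F u v else 0 := by
  simp only [tab2, result_loop, result_bind, result_tab, result_pure, foldl_update_eq]
  ext u v
  by_cases hu : u ∈ X <;> simp [hu]

@[simp] theorem time_tab2 (F : Fin n → Fin n → ℝ) :
    (tab2 X F).time f EO = X.length * (X.length + 1) := by
  rw [tab2, time_loop_eq (c := X.length) (by simp)]

@[simp] theorem result_dot (x y : Vec n) :
    (dot X x y).result f = (X.map (fun v => x v * y v)).sum := by
  simp [dot]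

@[simp] theorem time_dot (x y : Vec n) : (dot X x y).time f EO = X.length := by
  simp [dot]

@[simp] theorem result_matVec (Q : Mat n) (x : Vec n) :
    (matVec X Q x).result f =
      fun u => if u ∈ X then (X.map (fun v => Q u v * x v)).sum else 0 := by
  simp [matVec, result_loop, foldl_update_eq]

@[simp] theorem time_matVec (Q : Mat n) (x : Vec n) :
    (matVec X Q x).time f EO = X.length * (X.length + 1) := by
  rw [matVec, time_loop_eq (c := X.length) (by simp)]

theorem insertByWeight_runs (w : Vec n) (a : Fin n) (l : List (Fin n))
    (hl : l.Pairwise (fun u v => w u ≤ w v)) :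
    (insertByWeight w a l).Runs f EO (fun r t => r.Perm (a :: l) ∧
      r.Pairwise (fun u v => w u ≤ w v) ∧ t ≤ l.length + 1) := by
  induction l with
  | nil => simp [insertByWeight, Runs]
  | cons b l ih =>
    rw [insertByWeight]
    rw [List.pairwise_cons] at hl
    refine Runs.bind (Runs.exact _) ?_
    rintro _ _ ⟨rfl, rfl⟩
    split_ifs with h
    · refine Runs.pure ⟨List.Perm.refl _, ?_, by simp⟩
      refine List.pairwise_cons.2 ⟨?_, List.pairwise_cons.2 hl⟩
      intro v hv
      rcases List.mem_cons.1 hv with rfl | hv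
      · exact h
      · exact h.trans (hl.1 v hv)
    · refine Runs.bind (ih hl.2) ?_
      rintro r t ⟨hp, hs, ht⟩
      refine Runs.pure ⟨?_, ?_, ?_⟩
      · exact (hp.cons b).trans (List.Perm.swap a b l)
      · refine List.pairwise_cons.2 ⟨fun v hv => ?_, hs⟩
        rcases List.mem_cons.1 (hp.mem_iff.1 hv) with rfl | hv
        · exact (not_le.1 h).le
        · exact hl.1 v hv
      · simp; omega

theorem sortByWeight_runs (w : Vec n) :
    (sortByWeight w X).Runs f EO (fun r t => r.Perm X ∧
      r.Pairwise (fun u v => w u ≤ w v) ∧ t ≤ X.length * (X.length + 1)) := by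
  refine (Runs.loop (l := X) (fun pre r t => r.Perm pre ∧ r.Pairwise (fun u v => w u ≤ w v) ∧
    t ≤ pre.length * (X.length + 1)) (by simp) ?_).mono (fun a t h => h)
  rintro pre b post hX r t ⟨hp, hs, ht⟩
  refine (insertByWeight_runs f EO w b r hs).mono ?_
  rintro r' t' ⟨hp', hs', ht'⟩
  refine ⟨hp'.trans ((hp.cons b).trans (List.perm_append_singleton b pre).symm), hs', ?_⟩
  have h1 := hp.length_eq
  have h2 : pre.length + 1 ≤ X.length := by rw [hX]; simp
  simp only [List.length_append, List.length_singleton]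
  rw [Nat.succ_mul]
  omega

/-- Only an upper bound holds in general, because the program stops as soon as either of the two
lists is exhausted. -/
theorem time_marginals_le (l : List (Fin n)) (ps : List ℝ) (p₀ : ℝ) :
    (marginals l ps p₀).time f EO ≤ l.length := by
  induction l generalizing ps p₀ with
  | nil => simp [marginals]
  | cons v l ih =>
    cases ps with
    | nil => simp [marginals]
    | cons p ps =>
      have := ih ps p
      simp [marginals]
      omega

@[simp] theorem result_marginals_nil (ps : List ℝ) (p₀ : ℝ) :
    (marginals ([] : List (Fin n)) ps p₀).result f = fun _ => 0 := by
  simp [marginals]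

@[simp] theorem result_marginals_cons (v : Fin n) (l : List (Fin n)) (p : ℝ) (ps : List ℝ)
    (p₀ : ℝ) : (marginals (v :: l) (p :: ps) p₀).result f =
      Function.update ((marginals l ps p).result f) v (p - p₀) := by
  simp [marginals]

end Vectors

/-! ### Extreme bases -/

section Bases

variable {n : ℕ} (g : Finset (Fin n) → ℝ)

@[simp] theorem prefixValues_nil : prefixValues g [] = [] := rfl

theorem prefixValues_cons (a : Fin n) (l : List (Fin n)) :
    prefixValues g (a :: l) = g {a} :: prefixValues (fun U => g (insert a U)) l := by
  simp [prefixValues, List.range_succ_eq_map, Function.comp_def]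

theorem length_prefixValues (l : List (Fin n)) : (prefixValues g l).length = l.length := by
  simp [prefixValues]

theorem extremeBase_cons_self (a : Fin n) (l : List (Fin n)) :
    extremeBase g (a :: l) a = g {a} - g ∅ := by
  simp [extremeBase]

theorem extremeBase_cons_of_ne {a v : Fin n} (l : List (Fin n)) (h : v ≠ a) :
    extremeBase g (a :: l) v = extremeBase (fun U => g (insert a U)) l v := by
  simp [extremeBase, List.idxOf_cons_ne _ h.symm]

theorem result_marginals (f : Finset (Fin n) → ℝ) {l : List (Fin n)} (hl : l.Nodup) (v : Fin n) :
    (marginals l (prefixValues g l) (g ∅)).result f v =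
      if v ∈ l then extremeBase g l v else 0 := by
  induction l generalizing g with
  | nil => simp
  | cons a l ih =>
    rw [List.nodup_cons] at hl
    rw [prefixValues_cons, result_marginals_cons]
    by_cases hv : v = a
    · subst hv; simp [extremeBase_cons_self]
    · have := ih (fun U => g (insert a U)) hl.2
      simp only [insert_empty_eq] at this
      simp [hv, this, extremeBase_cons_of_ne g l hv]

theorem extremeBase_append_left {l₁ : List (Fin n)} (l₂ : List (Fin n)) {v : Fin n} (hv : v ∈ l₁) :
    extremeBase g (l₁ ++ l₂) v = extremeBase g l₁ v := by
  have h := List.idxOf_lt_length_of_mem hv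
  simp only [extremeBase, List.idxOf_append_of_mem hv]
  rw [List.take_append_of_le_length (by omega), List.take_append_of_le_length (by omega)]

theorem extremeBase_append_right {l₁ : List (Fin n)} (l₂ : List (Fin n)) {v : Fin n}
    (hv : v ∉ l₁) :
    extremeBase g (l₁ ++ l₂) v = extremeBase (fun U => g (l₁.toFinset ∪ U)) l₂ v := by
  induction l₁ generalizing g with
  | nil => simp
  | cons a l ih =>
    simp only [List.mem_cons, not_or] at hv
    rw [List.cons_append, extremeBase_cons_of_ne _ _ hv.1, ih _ hv.2]
    simp

theorem sum_extremeBase {l : List (Fin n)} (hl : l.Nodup) :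
    ∑ v ∈ l.toFinset, extremeBase g l v = g l.toFinset - g ∅ := by
  induction l generalizing g with
  | nil => simp
  | cons a l ih =>
    rw [List.nodup_cons] at hl
    have ha : a ∉ l.toFinset := by simpa using hl.1
    rw [List.toFinset_cons, Finset.sum_insert ha, extremeBase_cons_self]
    rw [Finset.sum_congr rfl (fun v hv => extremeBase_cons_of_ne g l
      (ne_of_mem_of_not_mem hv ha)), ih _ hl.2]
    simp

variable {g}

theorem IsSubmodularOn.mono {X Y : Finset (Fin n)} (h : IsSubmodularOn Y g) (hX : X ⊆ Y) :
    IsSubmodularOn X g := fun S hS T hT => h S (hS.trans hX) T (hT.trans hX)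

theorem IsSubmodularOn.insert {X : Finset (Fin n)} {a : Fin n} (h : IsSubmodularOn (insert a X) g) :
    IsSubmodularOn X (fun U => g (insert a U)) := by
  intro S hS T hT
  have := h _ (Finset.insert_subset_insert a hS) _ (Finset.insert_subset_insert a hT)
  rwa [← Finset.insert_inter_distrib, ← Finset.insert_union_distrib] at this

/-- Greedy vectors satisfy the constraints of the base polytope. The first element `a` is peeled
off, which leaves the extreme base of the contracted function `U ↦ g (insert a U)`. If `a ∈ A` the
bounds telescope; otherwise submodularity for `A` and `{a}` compares `g (insert a A) - g {a}` with
`g A - g ∅`. -/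
theorem sum_extremeBase_le {l : List (Fin n)} (hl : l.Nodup) (hg : IsSubmodularOn l.toFinset g)
    {A : Finset (Fin n)} (hA : A ⊆ l.toFinset) :
    ∑ v ∈ A, extremeBase g l v ≤ g A - g ∅ := by
  induction l generalizing g A with
  | nil =>
    have : A = ∅ := by simpa using hA
    simp [this]
  | cons a l ih =>
    rw [List.nodup_cons] at hl
    have ha : a ∉ l.toFinset := by simpa using hl.1
    rw [List.toFinset_cons] at hg hA
    have hsum : ∀ B ⊆ l.toFinset, ∑ v ∈ B, extremeBase g (a :: l) v ≤
        g (insert a B) - g {a} := by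
      intro B hB
      rw [Finset.sum_congr rfl (fun v hv => extremeBase_cons_of_ne g l
        (ne_of_mem_of_not_mem (hB hv) ha))]
      simpa using ih hl.2 hg.insert hB
    by_cases haA : a ∈ A
    · have hB : A.erase a ⊆ l.toFinset := by rwa [← Finset.subset_insert_iff]
      rw [← Finset.insert_erase haA, Finset.sum_insert (Finset.notMem_erase a A),
        extremeBase_cons_self]
      linarith [hsum _ hB]
    · have hB : A ⊆ l.toFinset := (Finset.subset_insert_iff_of_notMem haA).1 hA
      have h1 := hg A hA {a} (by simp)
      rw [Finset.inter_singleton_of_notMem haA, Finset.union_comm, ← Finset.insert_eq] at h1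
      linarith [hsum _ hB]

theorem extremeBase_mem_basePolytope {X : Finset (Fin n)} (hg : IsSubmodularOn X g) (h0 : g ∅ = 0)
    {l : List (Fin n)} (hl : l.Nodup) (hX : l.toFinset = X) :
    extremeBase g l ∈ basePolytope X g := by
  subst hX
  refine ⟨fun S hS => ?_, ?_⟩
  · simpa [h0] using sum_extremeBase_le hl hg hS
  · simpa [h0] using sum_extremeBase g hl

/-- Diminishing returns: the marginal value of an element drops when `a` is placed before the whole
ordering. -/
theorem extremeBase_insert_le {X : Finset (Fin n)} {a : Fin n} (hg : IsSubmodularOn (insert a X) g)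
    (ha : a ∉ X) {l : List (Fin n)} (hl : ∀ v ∈ l, v ∈ X) (v : Fin n) :
    extremeBase (fun U => g (insert a U)) l v ≤ extremeBase g l v := by
  have hsub : ∀ i, (l.take i).toFinset ⊆ X := fun i u hu =>
    hl u (List.mem_of_mem_take (List.mem_toFinset.1 hu))
  simp only [extremeBase]
  set P := (l.take (l.idxOf v)).toFinset
  set P' := (l.take (l.idxOf v + 1)).toFinset
  have hPP' : P ⊆ P' := by
    intro u hu
    simp only [P, P', List.mem_toFinset] at hu ⊢
    exact (List.take_sublist_take_left (by omega)).subset hu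
  have h1 := hg P' ((hsub _).trans (Finset.subset_insert _ _)) (insert a P)
    (Finset.insert_subset_insert _ (hsub _))
  have haP' : a ∉ P' := fun h => ha (hsub _ h)
  rw [Finset.inter_insert_of_notMem haP', Finset.inter_eq_right.2 hPP', Finset.union_insert,
    Finset.union_eq_left.2 hPP'] at h1
  linarith

/-- Moving elements to the end of an ordering does not decrease the other entries of the extreme
base. -/
theorem extremeBase_le_filter {l : List (Fin n)} (hl : l.Nodup) (hg : IsSubmodularOn l.toFinset g)
    (p : Fin n → Bool) {v : Fin n} (hv : v ∈ l) (hp : p v = true) :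
    extremeBase g l v ≤ extremeBase g (l.filter p) v := by
  induction l generalizing g with
  | nil => simp at hv
  | cons a l ih =>
    rw [List.nodup_cons] at hl
    have ha : a ∉ l.toFinset := by simpa using hl.1
    rw [List.toFinset_cons] at hg
    by_cases hva : v = a
    · subst hva
      rw [List.filter_cons_of_pos hp, extremeBase_cons_self, extremeBase_cons_self]
    · have hvl : v ∈ l := by simpa [hva] using hv
      rw [extremeBase_cons_of_ne g l hva]
      by_cases hpa : p a = true
      · rw [List.filter_cons_of_pos hpa, extremeBase_cons_of_ne _ _ hva]
        exact ih hl.2 hg.insert hvl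
      · rw [List.filter_cons_of_neg (by simpa using hpa)]
        -- Removing one earlier element `a` can only increase the marginal value of `v`; the filter
        -- removes such elements one at a time.
        refine le_trans ?_ (ih hl.2 (hg.mono (Finset.subset_insert _ _)) hvl)
        exact extremeBase_insert_le hg ha (fun u hu => List.mem_toFinset.2 hu) v

theorem basePolytope_lower {X : Finset (Fin n)} {z : Vec n} (hz : z ∈ basePolytope X g) {v : Fin n}
    (hv : v ∈ X) : g X - g (X.erase v) ≤ z v := by
  have h1 := hz.1 _ (Finset.erase_subset v X)
  have h2 := Finset.add_sum_erase X z hv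
  have h3 := hz.2
  linarith

/-- Needed because `sSup` of an unbounded set of reals is `0`: without boundedness, `complexityL`
would not dominate the norms of the bases. -/
theorem bddAbove_basePolytope (X : Finset (Fin n)) (g : Finset (Fin n) → ℝ) :
    BddAbove ((fun z : Vec n => ∑ v ∈ X, |z v|) '' basePolytope X g) := by
  refine ⟨∑ v ∈ X, (|g X - g (X.erase v)| + |g {v}|), ?_⟩
  rintro _ ⟨z, hz, rfl⟩
  refine Finset.sum_le_sum (fun v hv => ?_)
  have h1 := basePolytope_lower hz hv
  have h2 := hz.1 {v} (by simpa using hv)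
  rw [Finset.sum_singleton] at h2
  rw [abs_le]
  constructor
  · linarith [neg_abs_le (g X - g (X.erase v)), abs_nonneg (g {v})]
  · linarith [le_abs_self (g {v}), abs_nonneg (g X - g (X.erase v))]

theorem le_complexityL {X : Finset (Fin n)} {z : Vec n} (hz : z ∈ basePolytope X g) :
    ∑ v ∈ X, |z v| ≤ complexityL X g :=
  le_csSup (bddAbove_basePolytope X g) ⟨z, hz, rfl⟩

end Bases

/-! ### Reductions of a submodular function -/

namespace State

variable {n : ℕ}

/-- The current ground set as a finite set. -/
def ground (s : State n) : Finset (Fin n) := Finset.univ.filter (fun v => s.isRep v = true)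

/-- The function `f↓`, where `m` is the vector `ℓ⁻`. -/
def fdown (s : State n) (m : Vec n) (f : Finset (Fin n) → ℝ) (X : Finset (Fin n)) : ℝ :=
  s.val f (s.down X) - s.fT - (∑ u ∈ s.down X \ s.T, m u - ∑ v ∈ X, m v)

/-- The ideals of the preorder that contain the contracted set. -/
structure IsIdeal (s : State n) (A : Finset (Fin n)) : Prop where
  subset : s.T ⊆ A
  closed : ∀ u v, s.le u v = true → v ∈ A → u ∈ A

theorem mem_ground {s : State n} {v : Fin n} : v ∈ s.ground ↔ s.isRep v = true := by
  simp [ground]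

theorem toFinset_reps (s : State n) : s.reps.toFinset = s.ground := by
  ext v; simp [reps, mem_ground]

theorem mem_reps {s : State n} {v : Fin n} : v ∈ s.reps ↔ v ∈ s.ground := by
  simp [reps, mem_ground]

theorem nodup_reps (s : State n) : s.reps.Nodup := (List.nodup_finRange n).filter _

theorem length_reps_le (s : State n) : s.reps.length ≤ n := by
  have := List.length_filter_le (fun v => s.isRep v) (List.finRange n)
  simpa [reps] using this

theorem notMem_T_of_mem_ground {s : State n} {v : Fin n} (hv : v ∈ s.ground) : v ∉ s.T := by
  simp only [mem_ground, isRep, decide_eq_true_eq] at hv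
  exact hv.1

theorem mem_down {s : State n} {X : Finset (Fin n)} {u : Fin n} :
    u ∈ s.down X ↔ u ∈ s.T ∨ ∃ v ∈ X, s.le u v = true := by
  simp [down]

theorem mem_outside {s : State n} {u v : Fin n} :
    u ∈ s.outside v ↔ u ∈ s.T ∨ s.le v u = false := by
  simp [outside]

theorem mem_outsideWith {s : State n} {u v : Fin n} :
    u ∈ s.outsideWith v ↔ u ∈ s.T ∨ s.le v u = false ∨ s.le u v = true := by
  simp [outsideWith]

theorem down_mono (s : State n) {X Y : Finset (Fin n)} (h : X ⊆ Y) : s.down X ⊆ s.down Y := by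
  intro u hu
  rw [mem_down] at hu ⊢
  exact hu.imp id (fun ⟨v, hv, h'⟩ => ⟨v, h hv, h'⟩)

theorem down_empty (s : State n) : s.down ∅ = s.T := by
  ext u; simp [mem_down]

theorem down_union (s : State n) (X Y : Finset (Fin n)) :
    s.down (X ∪ Y) = s.down X ∪ s.down Y := by
  ext u
  simp only [mem_down, Finset.mem_union]
  grind

theorem T_subset_down (s : State n) (X : Finset (Fin n)) : s.T ⊆ s.down X :=
  fun _ hu => mem_down.2 (Or.inl hu)

theorem result_valT (s : State n) (f : Finset (Fin n) → ℝ) (U : Finset (Fin n)) :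
    (s.valT U).result f = s.val f U := by
  simp [valT, val, result_ite]

theorem time_valT_le (s : State n) (f : Finset (Fin n) → ℝ) (EO : ℕ) (U : Finset (Fin n)) :
    (s.valT U).time f EO ≤ n + EO := by
  simp only [valT, time_bind, time_tick, time_ite, time_pure, time_ask]
  split_ifs <;> omega

theorem prefixValues_append_singleton (g : Finset (Fin n) → ℝ) (l : List (Fin n)) (b : Fin n) :
    prefixValues g (l ++ [b]) = prefixValues g l ++ [g (l ++ [b]).toFinset] := by
  simp only [prefixValues, List.length_append, List.length_singleton, List.range_succ,
    List.map_append, List.map_singleton]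
  congr 1
  · refine List.map_congr_left (fun i hi => ?_)
    rw [List.mem_range] at hi
    rw [List.take_append_of_le_length (by omega)]
  · rw [List.take_of_length_le (by simp)]

theorem downAccess_runs (s : State n) (m : Vec n) (f : Finset (Fin n) → ℝ) (EO : ℕ)
    (l : List (Fin n)) (hl : l.Nodup) :
    (s.downAccess m l).Runs f EO (fun r t => r = prefixValues (s.fdown m f) l ∧
      t ≤ l.length * (3 * n + EO + 1)) := by
  unfold downAccess
  refine Runs.bind (Runs.loop (fun pre r t => r.1 = s.down pre.toFinset ∧
    r.2.1 = ∑ u ∈ s.down pre.toFinset \ s.T, m u - ∑ v ∈ pre.toFinset, m v ∧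
    r.2.2 = prefixValues (s.fdown m f) pre ∧ t ≤ pre.length * (3 * n + EO + 1)) ?_ ?_) ?_
  · simp [down_empty]
  · rintro pre b post hpre ⟨D, t, out⟩ τ ⟨h1, h2, h3, h4⟩
    simp only at h1 h2 h3
    subst h1 h2 h3
    have hb : b ∉ pre := by
      intro hb
      rw [hpre, List.nodup_append] at hl
      exact hl.2.2 b hb b (by simp) rfl
    have hD : s.down pre.toFinset ∪ Finset.univ.filter (fun u => s.le u b = true) =
        s.down (pre ++ [b]).toFinset := by
      ext u
      simp only [Finset.mem_union, mem_down, Finset.mem_filter, Finset.mem_univ, true_and,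
        List.mem_toFinset, List.mem_append, List.mem_singleton]
      grind
    have hsub : s.down pre.toFinset ⊆ s.down (pre ++ [b]).toFinset :=
      s.down_mono (by intro u; simp +contextual)
    have hc : ((List.finRange n).map (fun u => if u ∈ s.down (pre ++ [b]).toFinset ∧
        u ∉ s.down pre.toFinset then m u else 0)).sum =
        ∑ u ∈ s.down (pre ++ [b]).toFinset \ s.T, m u - ∑ u ∈ s.down pre.toFinset \ s.T, m u := by
      rw [← List.sum_toFinset _ (List.nodup_finRange n), ← Finset.sum_filter]
      rw [eq_sub_iff_add_eq, ← Finset.sum_union]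
      · refine Finset.sum_congr ?_ (fun _ _ => rfl)
        ext u
        have := @hsub u
        have h' := @T_subset_down n s pre.toFinset u
        simp only [Finset.mem_union, Finset.mem_filter, List.mem_toFinset, List.mem_finRange,
          true_and, Finset.mem_sdiff]
        tauto
      · rw [Finset.disjoint_left]
        intro u hu hu'
        simp only [Finset.mem_filter, Finset.mem_sdiff] at hu hu'
        exact hu.2.2 hu'.1
    have hsum : ∑ v ∈ (pre ++ [b]).toFinset, m v = m b + ∑ v ∈ pre.toFinset, m v := by
      rw [← Finset.sum_insert (by simpa using hb)]
      refine Finset.sum_congr ?_ (fun _ _ => rfl)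
      ext u; simp
    have htime := s.time_valT_le f EO (s.down (pre ++ [b]).toFinset)
    unfold Runs
    simp only [result_bind, time_bind, time_tick, time_sumOver, result_sumOver, result_pure,
      time_pure, hD, hc, result_valT, List.length_finRange, List.length_append,
      List.length_singleton]
    refine ⟨trivial, ?_, ?_, ?_⟩
    · rw [hsum]; ring
    · rw [prefixValues_append_singleton, fdown, hsum]
      congr 2
      ring
    · rw [Nat.succ_mul]; omega
  · rintro ⟨D, t, out⟩ τ ⟨-, -, h3, h4⟩
    exact Runs.pure ⟨h3, by simpa using h4⟩

end State

/-! ### Ideals of the preorder, monotonicity of `f - ℓ⁻`, and properties of `f↓`. -/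

section Reduction

open State

variable {n : ℕ} {f : Finset (Fin n) → ℝ} {s : State n}

theorem State.negEll_nonpos (s : State n) (f : Finset (Fin n) → ℝ) (v : Fin n) :
    s.negEll f v ≤ 0 := by
  unfold negEll
  split_ifs
  · exact min_le_left _ _
  · exact le_rfl

theorem State.negEll_of_notMem {v : Fin n} (hv : v ∉ s.ground) : s.negEll f v = 0 := by
  rw [mem_ground] at hv
  simp [negEll, hv]

theorem State.negEll_of_mem {v : Fin n} (hv : v ∈ s.ground) :
    s.negEll f v = min 0 (s.ell f v) := by
  rw [mem_ground] at hv
  simp [negEll, hv]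

/-- Lowering the value of the full set is harmless. That set occurs on the larger side of the
submodular inequality only when `S` or `T` is the full set, and then both sides agree; otherwise it
can occur only as the union, where a smaller value helps. -/
theorem State.val_submodular (hf : IsSubmodular f) (htop : s.top ≤ f Finset.univ) :
    IsSubmodular (s.val f) := by
  intro S T
  have h := hf S T
  unfold State.val
  by_cases hS : S = Finset.univ
  · subst hS; simp [add_comm]
  by_cases hT : T = Finset.univ
  · subst hT; simp
  have hST : S ∩ T ≠ Finset.univ := by
    intro h
    exact hS (Finset.eq_univ_of_forall (fun v =>
      (Finset.mem_inter.1 (h ▸ Finset.mem_univ v)).1))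
  simp only [hS, hT, hST, if_false]
  split_ifs with hU
  · rw [hU] at h; linarith
  · exact h

namespace IsReduction

theorem exists_rep (hs : IsReduction f s) {v : Fin n} (hv : v ∉ s.T) :
    ∃ r ∈ s.ground, s.le r v = true ∧ s.le v r = true := by
  set C := Finset.univ.filter (fun u => s.le u v = true ∧ s.le v u = true) with hC
  have hne : C.Nonempty := ⟨v, by simp [hC, hs.refl v]⟩
  have hr : C.min' hne ∈ C := C.min'_mem hne
  set r := C.min' hne with hrdef
  have hr' : s.le r v = true ∧ s.le v r = true := by simpa [hC] using hr
  refine ⟨r, ?_, hr'⟩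
  rw [mem_ground, isRep, decide_eq_true_eq]
  refine ⟨fun h => hv (hs.closed v r hr'.2 h), fun u hu ⟨h1, h2⟩ => ?_⟩
  have : u ∈ C := by
    simp only [hC, Finset.mem_filter, Finset.mem_univ, true_and]
    exact ⟨hs.trans _ _ _ h1 hr'.1, hs.trans _ _ _ hr'.2 h2⟩
  exact absurd (C.min'_le u this) (not_le.2 hu)

theorem eq_of_mem_ground {u v : Fin n} (hu : u ∈ s.ground) (hv : v ∈ s.ground)
    (h1 : s.le u v = true) (h2 : s.le v u = true) : u = v := by
  rw [mem_ground, isRep, decide_eq_true_eq] at hu hv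
  rcases lt_trichotomy u v with h | h | h
  · exact absurd ⟨h1, h2⟩ (hv.2 u h)
  · exact h
  · exact absurd ⟨h2, h1⟩ (hu.2 v h)

theorem isIdeal_down (hs : IsReduction f s) (X : Finset (Fin n)) : s.IsIdeal (s.down X) := by
  refine ⟨s.T_subset_down X, fun u v huv hv => ?_⟩
  rw [mem_down] at hv ⊢
  rcases hv with hv | ⟨w, hw, hvw⟩
  · exact Or.inl (hs.closed u v huv hv)
  · exact Or.inr ⟨w, hw, hs.trans _ _ _ huv hvw⟩

theorem isIdeal_outside (hs : IsReduction f s) (z : Fin n) : s.IsIdeal (s.outside z) := by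
  refine ⟨fun u hu => mem_outside.2 (Or.inl hu), fun u v huv hv => ?_⟩
  rw [mem_outside] at hv ⊢
  rcases hv with hv | hv
  · exact Or.inl (hs.closed u v huv hv)
  · right
    by_contra h
    rw [Bool.not_eq_false] at h
    rw [hs.trans _ _ _ h huv] at hv
    exact absurd hv (by simp)

theorem isIdeal_outsideWith (hs : IsReduction f s) (z : Fin n) : s.IsIdeal (s.outsideWith z) := by
  refine ⟨fun u hu => mem_outsideWith.2 (Or.inl hu), fun u v huv hv => ?_⟩
  rw [mem_outsideWith] at hv ⊢
  rcases hv with hv | hv | hv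
  · exact Or.inl (hs.closed u v huv hv)
  · right; left
    by_contra h
    rw [Bool.not_eq_false] at h
    rw [hs.trans _ _ _ h huv] at hv
    exact absurd hv (by simp)
  · exact Or.inr (Or.inr (hs.trans _ _ _ huv hv))

theorem isIdeal_T (hs : IsReduction f s) : s.IsIdeal s.T := ⟨subset_rfl, hs.closed⟩

theorem isIdeal_univ : s.IsIdeal Finset.univ := ⟨Finset.subset_univ _, fun _ _ _ _ => by simp⟩

theorem isIdeal_inter {A B : Finset (Fin n)} (hA : s.IsIdeal A) (hB : s.IsIdeal B) :
    s.IsIdeal (A ∩ B) :=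
  ⟨Finset.subset_inter hA.subset hB.subset, fun u v huv hv => by
    rw [Finset.mem_inter] at hv ⊢
    exact ⟨hA.closed u v huv hv.1, hB.closed u v huv hv.2⟩⟩

theorem isIdeal_minimizer (hs : IsReduction f s) {M : Finset (Fin n)} (hM : IsMinimizer f M) :
    s.IsIdeal M := ⟨hs.subset_minimizer M hM, hs.minimizer_closed M hM⟩

theorem subset_down (hs : IsReduction f s) (X : Finset (Fin n)) : X ⊆ s.down X :=
  fun v hv => mem_down.2 (Or.inr ⟨v, hv, hs.refl v⟩)

theorem down_ground_inter (hs : IsReduction f s) {S : Finset (Fin n)} (hS : s.IsIdeal S) :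
    s.down (s.ground ∩ S) = S := by
  ext u
  rw [mem_down]
  constructor
  · rintro (h | ⟨v, hv, huv⟩)
    · exact hS.subset h
    · exact hS.closed u v huv (Finset.mem_inter.1 hv).2
  · intro hu
    by_cases hT : u ∈ s.T
    · exact Or.inl hT
    · obtain ⟨r, hr, h1, h2⟩ := hs.exists_rep hT
      exact Or.inr ⟨r, Finset.mem_inter.2 ⟨hr, hS.closed r u h1 hu⟩, h2⟩

theorem sum_negEll_sdiff {S : Finset (Fin n)} :
    ∑ u ∈ S \ s.T, s.negEll f u = ∑ u ∈ s.ground ∩ S, s.negEll f u := by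
  symm
  refine Finset.sum_subset (fun u hu => ?_) (fun u hu hu' => ?_)
  · rw [Finset.mem_inter] at hu
    exact Finset.mem_sdiff.2 ⟨hu.2, notMem_T_of_mem_ground hu.1⟩
  · refine negEll_of_notMem (fun h => hu' (Finset.mem_inter.2 ⟨h, (Finset.mem_sdiff.1 hu).1⟩))

/-- The vector `ℓ⁻` bounds the differences of the function on ideals. -/
theorem sum_negEll_le (hs : IsReduction f s) (hf : IsSubmodular f) {A B : Finset (Fin n)}
    (hA : s.IsIdeal A) (hB : s.IsIdeal B) (hAB : A ⊆ B) :
    ∑ u ∈ B \ A, s.negEll f u ≤ s.val f B - s.val f A := by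
  have hsub := State.val_submodular hf hs.top_le_univ
  induction hk : (B \ A).card using Nat.strong_induction_on generalizing A with
  | _ k ih =>
  by_cases hne : (B \ A).Nonempty
  swap
  · rw [Finset.not_nonempty_iff_eq_empty] at hne
    have : B = A := Finset.Subset.antisymm (Finset.sdiff_eq_empty_iff_subset.1 hne) hAB
    simp [this]
  -- An element of `B \ A` with the fewest predecessors is minimal in the preorder on `B \ A`:
  -- everything in `B \ A` below it is equivalent to it. Hence adding its down-set to `A` adds
  -- exactly one equivalence class.
  obtain ⟨v, hv, hmin⟩ := Finset.exists_min_image (B \ A)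
    (fun v => (Finset.univ.filter (fun u => s.le u v = true)).card) hne
  have hmin' : ∀ u ∈ B \ A, s.le u v = true → s.le v u = true := by
    intro u hu huv
    have hss : Finset.univ.filter (fun w => s.le w u = true) ⊆
        Finset.univ.filter (fun w => s.le w v = true) := by
      intro w
      simp only [Finset.mem_filter, Finset.mem_univ, true_and]
      exact fun h => hs.trans _ _ _ h huv
    have heq := Finset.eq_of_subset_of_card_le hss (hmin u hu)
    have : v ∈ Finset.univ.filter (fun w => s.le w v = true) := by simp [hs.refl v]
    rw [← heq] at this
    simpa using this
  rw [Finset.mem_sdiff] at hv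
  obtain ⟨r, hr, hrv, hvr⟩ := hs.exists_rep (fun h => hv.2 (hA.subset h))
  have hrB : r ∈ B := hB.closed r v hrv hv.1
  have hrA : r ∉ A := fun h => hv.2 (hA.closed v r hvr h)
  have hclass : ∀ u ∈ B \ A, s.le u r = true → s.le r u = true := fun u hu hur =>
    hs.trans _ _ _ hrv (hmin' u hu (hs.trans _ _ _ hur hrv))
  set A' := A ∪ Finset.univ.filter (fun u => s.le u r = true) with hA'
  have hmemA' : ∀ u, u ∈ A' ↔ u ∈ A ∨ s.le u r = true := by intro u; simp [hA']
  have hA'i : s.IsIdeal A' := by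
    refine ⟨hA.subset.trans Finset.subset_union_left, fun u w huw hw => ?_⟩
    rw [hmemA'] at hw ⊢
    exact hw.imp (hA.closed u w huw) (fun h => hs.trans _ _ _ huw h)
  have hA'B : A' ⊆ B := by
    intro u hu
    rcases (hmemA' u).1 hu with h | h
    · exact hAB h
    · exact hB.closed u r h hrB
  have hAA' : A ⊆ A' := Finset.subset_union_left
  have hcard : (B \ A').card < k := by
    rw [← hk]
    refine Finset.card_lt_card ⟨Finset.sdiff_subset_sdiff subset_rfl hAA', fun h => ?_⟩
    have := h (Finset.mem_sdiff.2 ⟨hrB, hrA⟩)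
    exact (Finset.mem_sdiff.1 this).2 ((hmemA' r).2 (Or.inr (hs.refl r)))
  have h1 := ih _ hcard hA'i hA'B rfl
  have hsplit : ∑ u ∈ B \ A, s.negEll f u =
      ∑ u ∈ B \ A', s.negEll f u + ∑ u ∈ A' \ A, s.negEll f u := by
    rw [← Finset.sum_union]
    · refine Finset.sum_congr ?_ (fun _ _ => rfl)
      ext u
      have a := @hA'B u
      have b := @hAA' u
      simp only [Finset.mem_union, Finset.mem_sdiff]
      tauto
    · rw [Finset.disjoint_left]
      intro u hu hu'
      exact (Finset.mem_sdiff.1 hu).2 (Finset.mem_sdiff.1 hu').1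
  -- The added class contains a single vertex of the contracted digraph, and `ℓ⁻` is zero off the
  -- vertices.
  have hone : ∑ u ∈ A' \ A, s.negEll f u = s.negEll f r := by
    refine Finset.sum_eq_single_of_mem r ?_ (fun u hu hur => ?_)
    · exact Finset.mem_sdiff.2 ⟨(hmemA' r).2 (Or.inr (hs.refl r)), hrA⟩
    · refine negEll_of_notMem (fun hg => hur ?_)
      rw [Finset.mem_sdiff, hmemA'] at hu
      have hle := hu.1.resolve_left hu.2
      exact eq_of_mem_ground hg hr hle (hclass u (Finset.mem_sdiff.2
        ⟨hB.closed u r hle hrB, hu.2⟩) hle)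
  -- The pair `A'`, `s.outside r` has intersection `A` and union `s.outsideWith r`. Submodularity
  -- therefore bounds `f(A') - f(A)` below by `ℓ(r)`.
  have hinter : A' ∩ s.outside r = A := by
    ext u
    rw [Finset.mem_inter, hmemA', mem_outside]
    constructor
    · rintro ⟨h | h, h'⟩
      · exact h
      · by_contra hu
        rcases h' with h' | h'
        · exact hu (hA.subset h')
        · rw [hclass u (Finset.mem_sdiff.2 ⟨hB.closed u r h hrB, hu⟩) h] at h'
          exact absurd h' (by simp)
    · intro hu
      refine ⟨Or.inl hu, Or.inr ?_⟩
      by_contra h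
      rw [Bool.not_eq_false] at h
      exact hrA (hA.closed r u h hu)
  have hunion : A' ∪ s.outside r = s.outsideWith r := by
    ext u
    rw [Finset.mem_union, hmemA', mem_outside, mem_outsideWith]
    constructor
    · rintro ((h | h) | (h | h))
      · right; left
        by_contra h'
        rw [Bool.not_eq_false] at h'
        exact hrA (hA.closed r u h' h)
      · exact Or.inr (Or.inr h)
      · exact Or.inl h
      · exact Or.inr (Or.inl h)
    · rintro (h | h | h)
      · exact Or.inr (Or.inl h)
      · exact Or.inr (Or.inr h)
      · exact Or.inl (Or.inr h)
  have h2 := hsub A' (s.outside r)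
  rw [hinter, hunion] at h2
  have h3 : s.negEll f r ≤ s.ell f r := by
    rw [negEll_of_mem hr]; exact min_le_right _ _
  rw [State.ell] at h3
  rw [hsplit, hone]
  linarith

/-- Since `down` commutes with unions, the only defect is that `(X ∩ Y)↓` may be smaller than `X↓ ∩
Y↓`. The monotonicity of `f - ℓ⁻` on ideals shows that passing to the smaller set does not increase
the value; the remaining terms are modular. -/
theorem fdown_submodular (hs : IsReduction f s) (hf : IsSubmodular f) :
    IsSubmodular (s.fdown (s.negEll f) f) := by
  intro X Y
  have hsub := State.val_submodular hf hs.top_le_univ (s.down X) (s.down Y)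
  have hle : s.down (X ∩ Y) ⊆ s.down X ∩ s.down Y :=
    Finset.subset_inter (s.down_mono Finset.inter_subset_left)
      (s.down_mono Finset.inter_subset_right)
  have h1 := hs.sum_negEll_le hf (hs.isIdeal_down (X ∩ Y))
    (isIdeal_inter (hs.isIdeal_down X) (hs.isIdeal_down Y)) hle
  have h2 : ∑ u ∈ s.down X \ s.T, s.negEll f u + ∑ u ∈ s.down Y \ s.T, s.negEll f u =
      ∑ u ∈ (s.down X ∪ s.down Y) \ s.T, s.negEll f u +
        ∑ u ∈ (s.down X ∩ s.down Y) \ s.T, s.negEll f u := by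
    rw [Finset.union_sdiff_distrib, Finset.inter_sdiff_assoc,
      ← Finset.sum_union_inter]
    congr 2
    ext u; simp only [Finset.mem_inter, Finset.mem_sdiff]; tauto
  have h3 : ∑ u ∈ (s.down X ∩ s.down Y) \ s.T, s.negEll f u =
      ∑ u ∈ (s.down X ∩ s.down Y) \ s.down (X ∩ Y), s.negEll f u +
        ∑ u ∈ s.down (X ∩ Y) \ s.T, s.negEll f u := by
    rw [← Finset.sum_union]
    · refine Finset.sum_congr ?_ (fun _ _ => rfl)
      ext u
      have a := @hle u
      have b := @T_subset_down n s (X ∩ Y) u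
      simp only [Finset.mem_union, Finset.mem_sdiff]
      tauto
    · rw [Finset.disjoint_left]
      intro u hu hu'
      exact (Finset.mem_sdiff.1 hu).2 (Finset.mem_sdiff.1 hu').1
  have h4 := Finset.sum_union_inter (s₁ := X) (s₂ := Y) (f := s.negEll f)
  simp only [fdown, s.down_union]
  linarith

theorem fdown_ideal (hs : IsReduction f s) {S : Finset (Fin n)} (hS : s.IsIdeal S) :
    s.fdown (s.negEll f) f (s.ground ∩ S) = s.val f S - s.fT := by
  rw [fdown, hs.down_ground_inter hS, sum_negEll_sdiff]
  ring

theorem val_down_le_fdown (hs : IsReduction f s) {X : Finset (Fin n)} (hX : X ⊆ s.ground) :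
    s.val f (s.down X) - s.fT ≤ s.fdown (s.negEll f) f X := by
  have : ∑ u ∈ s.down X \ s.T, s.negEll f u ≤ ∑ u ∈ X, s.negEll f u := by
    rw [← Finset.sum_sdiff (s₁ := X) (s₂ := s.down X \ s.T)]
    · have : ∑ u ∈ (s.down X \ s.T) \ X, s.negEll f u ≤ 0 :=
        Finset.sum_nonpos (fun u _ => s.negEll_nonpos f u)
      linarith
    · exact fun u hu => Finset.mem_sdiff.2 ⟨hs.subset_down X hu, notMem_T_of_mem_ground (hX hu)⟩
  unfold fdown
  linarith

/-- Up to the modular term `ℓ⁻(X)`, the value `f↓(X)` is `f - ℓ⁻` at the ideal `X↓`, hence monotone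
in `X`. Through `basePolytope_lower` this makes `ℓ⁻` a lower bound for all bases of `f↓` and of its
restrictions. -/
theorem negEll_le_fdown_sub (hs : IsReduction f s) (hf : IsSubmodular f) {X : Finset (Fin n)}
    {v : Fin n} (hv : v ∈ X) :
    s.negEll f v ≤ s.fdown (s.negEll f) f X - s.fdown (s.negEll f) f (X.erase v) := by
  have hle := s.down_mono (Finset.erase_subset v X)
  have h1 := hs.sum_negEll_le hf (hs.isIdeal_down (X.erase v)) (hs.isIdeal_down X) hle
  have h2 : ∑ u ∈ s.down X \ s.T, s.negEll f u =
      ∑ u ∈ s.down X \ s.down (X.erase v), s.negEll f u +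
        ∑ u ∈ s.down (X.erase v) \ s.T, s.negEll f u := by
    rw [← Finset.sum_union]
    · refine Finset.sum_congr ?_ (fun _ _ => rfl)
      ext u
      have a := @hle u
      have b := @T_subset_down n s (X.erase v) u
      simp only [Finset.mem_union, Finset.mem_sdiff]
      tauto
    · rw [Finset.disjoint_left]
      intro u hu hu'
      exact (Finset.mem_sdiff.1 hu).2 (Finset.mem_sdiff.1 hu').1
  have h3 := Finset.add_sum_erase X (s.negEll f) hv
  unfold fdown
  linarith

/-- Monotonicity between `X↓` and the full set. The truncation `top ≤ fT` enters here: it makes the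
value of the current function at the full set nonpositive. -/
theorem fdown_le (hs : IsReduction f s) (hf : IsSubmodular f) {X : Finset (Fin n)} :
    s.fdown (s.negEll f) f X ≤ ∑ v ∈ X, s.negEll f v - ∑ v ∈ s.ground, s.negEll f v := by
  have h1 := hs.sum_negEll_le hf (hs.isIdeal_down X) isIdeal_univ (Finset.subset_univ _)
  have h2 : s.val f Finset.univ = s.top := by simp [val]
  have h3 := hs.top_le
  have h4 : ∑ u ∈ s.ground, s.negEll f u =
      ∑ u ∈ Finset.univ \ s.down X, s.negEll f u + ∑ u ∈ s.down X \ s.T, s.negEll f u := by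
    rw [← Finset.inter_univ s.ground, ← sum_negEll_sdiff, ← Finset.sum_union]
    · refine Finset.sum_congr ?_ (fun _ _ => rfl)
      ext u
      have b := @T_subset_down n s X u
      simp only [Finset.mem_union, Finset.mem_sdiff, Finset.mem_univ]
      tauto
    · rw [Finset.disjoint_left]
      intro u hu hu'
      exact (Finset.mem_sdiff.1 hu).2 (Finset.mem_sdiff.1 hu').1
  unfold fdown
  linarith

/-- An entry `z v ≥ ℓ⁻(v)`, where `ℓ⁻(v) ≤ 0`, satisfies `|z v| ≤ z v - 2 ℓ⁻(v)`. Summation turns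
the first term into `f↓(X)`, for which `fdown_le` gives an upper bound. -/
theorem complexityL_le (hs : IsReduction f s) (hf : IsSubmodular f) {X : Finset (Fin n)}
    (hX : X ⊆ s.ground) :
    complexityL X (s.fdown (s.negEll f) f) ≤ -2 * ∑ v ∈ s.ground, s.negEll f v := by
  have hX' := Finset.sum_sdiff (f := s.negEll f) hX
  have hneg : ∑ u ∈ s.ground \ X, s.negEll f u ≤ 0 :=
    Finset.sum_nonpos (fun u _ => s.negEll_nonpos f u)
  have hneg' : ∑ u ∈ X, s.negEll f u ≤ 0 := Finset.sum_nonpos (fun u _ => s.negEll_nonpos f u)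
  refine Real.sSup_le ?_ (by linarith)
  rintro _ ⟨z, hz, rfl⟩
  have h1 : ∑ v ∈ X, |z v| ≤ ∑ v ∈ X, (z v - 2 * s.negEll f v) := by
    refine Finset.sum_le_sum (fun v hv => ?_)
    have h2 := basePolytope_lower hz hv
    have h3 := hs.negEll_le_fdown_sub hf hv
    have h4 := s.negEll_nonpos f v
    rw [abs_le]
    constructor <;> linarith
  have h2 := hs.fdown_le hf (X := X)
  refine h1.trans ?_
  rw [Finset.sum_sub_distrib, ← Finset.mul_sum, hz.2]
  linarith

/-- The truncated value is itself a value of `f`, by `top_eq`, so truncation never goes below the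
minimum. -/
theorem minimizer_le_val (hs : IsReduction f s) {M : Finset (Fin n)} (hM : IsMinimizer f M)
    (U : Finset (Fin n)) : f M ≤ s.val f U := by
  unfold val
  split_ifs
  · rcases hs.top_eq with h | ⟨T', -, h⟩ <;> rw [h] <;> exact hM _
  · exact hM U

theorem val_le (hs : IsReduction f s) (U : Finset (Fin n)) : s.val f U ≤ f U := by
  unfold val
  split_ifs with h
  · rw [h]; exact hs.top_le_univ
  · exact le_rfl

/-- A nonempty ground set is needed: if `T` is everything, `val` returns the truncated value `top`
instead of `f T`. -/
theorem val_T (hs : IsReduction f s) (hV : s.ground.Nonempty) : s.val f s.T = s.fT := by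
  obtain ⟨v, hv⟩ := hV
  have : s.T ≠ Finset.univ := fun h => notMem_T_of_mem_ground hv (h ▸ Finset.mem_univ v)
  simp [val, this, hs.fT_eq]

theorem fdown_empty (hs : IsReduction f s) (hV : s.ground.Nonempty) :
    s.fdown (s.negEll f) f ∅ = 0 := by
  simp [fdown, s.down_empty, hs.val_T hV]

/-- If `ℓ` is nonnegative then the contracted set is a minimizer. -/
theorem isMinimizer_T (hs : IsReduction f s) (hf : IsSubmodular f)
    (h0 : 0 ≤ ∑ v ∈ s.ground, s.negEll f v) : IsMinimizer f s.T := by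
  obtain ⟨M, -, hM⟩ := Finset.exists_min_image (Finset.univ : Finset (Finset (Fin n))) f
    Finset.univ_nonempty
  have hM' : IsMinimizer f M := fun U => hM U (Finset.mem_univ U)
  have hid := hs.isIdeal_minimizer hM'
  have h1 := hs.sum_negEll_le hf hs.isIdeal_T hid hid.subset
  have h2 : ∑ u ∈ M \ s.T, s.negEll f u = 0 := by
    refine Finset.sum_eq_zero (fun u _ => ?_)
    by_cases hu : u ∈ s.ground
    · have h0' := le_antisymm (Finset.sum_nonpos (fun u _ => s.negEll_nonpos f u)) h0
      exact (Finset.sum_eq_zero_iff_of_nonpos (fun u _ => s.negEll_nonpos f u)).1 h0' u hu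
    · exact negEll_of_notMem hu
  intro U
  refine le_trans ?_ (hM' U)
  have h3 := hs.val_le M
  by_cases hT : s.T = Finset.univ
  · have : M = Finset.univ := Finset.eq_univ_of_forall (fun v => hid.subset (hT ▸ Finset.mem_univ v))
    rw [hT, this]
  · have : s.val f s.T = f s.T := by simp [val, hT]
    linarith

end IsReduction

end Reduction

/-! ### Convex combinations of extreme bases -/

/-- `gs` is a convex combination of extreme bases of `g` on the ground set `X`. -/
structure IsCombination {n : ℕ} (X : List (Fin n)) (g : Finset (Fin n) → ℝ)
    (gs : List (Term n)) : Prop where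
  coef_nonneg : ∀ e ∈ gs, 0 ≤ e.coef
  coef_sum : (gs.map Term.coef).sum = 1
  order_perm : ∀ e ∈ gs, e.order.Perm X
  base_eq : ∀ e ∈ gs, ∀ v ∈ X, e.base v = extremeBase g e.order v

theorem sum_combPoint {n : ℕ} (S : Finset (Fin n)) (gs : List (Term n)) :
    ∑ v ∈ S, combPoint gs v = (gs.map (fun e => e.coef * ∑ v ∈ S, e.base v)).sum := by
  induction gs with
  | nil => simp [combPoint]
  | cons e gs ih =>
    simp only [combPoint, List.map_cons, List.sum_cons, Finset.sum_add_distrib] at ih ⊢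
    rw [ih, Finset.mul_sum]

namespace IsCombination

variable {n : ℕ} {X : List (Fin n)} {g : Finset (Fin n) → ℝ} {gs : List (Term n)}

theorem ne_nil (h : IsCombination X g gs) : gs ≠ [] := by
  rintro rfl
  have := h.coef_sum
  simp at this

theorem order_toFinset (h : IsCombination X g gs) {e : Term n} (he : e ∈ gs) :
    e.order.toFinset = X.toFinset :=
  List.toFinset_eq_of_perm _ _ (h.order_perm e he)

theorem sum_base (h : IsCombination X g gs) {e : Term n} (he : e ∈ gs) {S : Finset (Fin n)}
    (hS : S ⊆ X.toFinset) :
    ∑ v ∈ S, e.base v = ∑ v ∈ S, extremeBase g e.order v :=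
  Finset.sum_congr rfl (fun v hv => h.base_eq e he v (List.mem_toFinset.1 (hS hv)))

theorem extremeBase_mem (h : IsCombination X g gs) (hX : X.Nodup)
    (hg : IsSubmodularOn X.toFinset g) (h0 : g ∅ = 0) {e : Term n} (he : e ∈ gs) :
    extremeBase g e.order ∈ basePolytope X.toFinset g :=
  extremeBase_mem_basePolytope hg h0 ((h.order_perm e he).nodup_iff.2 hX) (h.order_toFinset he)

theorem sum_mul_const (h : IsCombination X g gs) (c : ℝ) :
    (gs.map (fun e => e.coef * c)).sum = c := by
  rw [List.sum_map_mul_right]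
  rw [h.coef_sum, one_mul]

theorem combPoint_mem (h : IsCombination X g gs) (hX : X.Nodup)
    (hg : IsSubmodularOn X.toFinset g) (h0 : g ∅ = 0) :
    combPoint gs ∈ basePolytope X.toFinset g := by
  refine ⟨fun S hS => ?_, ?_⟩
  · rw [sum_combPoint, ← h.sum_mul_const (g S)]
    refine List.sum_le_sum (fun e he => ?_)
    refine mul_le_mul_of_nonneg_left ?_ (h.coef_nonneg e he)
    rw [h.sum_base he hS]
    exact (h.extremeBase_mem hX hg h0 he).1 S hS
  · rw [sum_combPoint, ← h.sum_mul_const (g X.toFinset)]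
    congr 1
    refine List.map_congr_left (fun e he => ?_)
    rw [h.sum_base he subset_rfl, (h.extremeBase_mem hX hg h0 he).2]

/-- Exchanging one extreme base in a convex combination. -/
theorem exchange_mem (h : IsCombination X g gs) (hX : X.Nodup)
    (hg : IsSubmodularOn X.toFinset g) (h0 : g ∅ = 0) {e : Term n} (he : e ∈ gs) {g' : Vec n}
    (hg' : g' ∈ basePolytope X.toFinset g) :
    (fun v => combPoint gs v + e.coef * (g' v - e.base v)) ∈ basePolytope X.toFinset g := by
  have hsum : ∀ S : Finset (Fin n), ∑ v ∈ S, (combPoint gs v + e.coef * (g' v - e.base v)) =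
      ∑ v ∈ S, combPoint gs v + e.coef * (∑ v ∈ S, g' v - ∑ v ∈ S, e.base v) := by
    intro S
    rw [Finset.sum_add_distrib, ← Finset.mul_sum, Finset.sum_sub_distrib]
  have hpt := h.combPoint_mem hX hg h0
  refine ⟨fun S hS => ?_, ?_⟩
  · rw [hsum]
    -- Every base in the combination has a nonnegative slack at `S`, so the weighted slack of one
    -- base is at most the total slack of the combined point. The exchange uses up no more than
    -- this.
    have h1 : e.coef * (g S - ∑ v ∈ S, e.base v) ≤
        (gs.map (fun e => e.coef * (g S - ∑ v ∈ S, e.base v))).sum := by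
      refine List.single_le_sum ?_ _ (List.mem_map.2 ⟨e, he, rfl⟩)
      intro x hx
      obtain ⟨e', he', rfl⟩ := List.mem_map.1 hx
      refine mul_nonneg (h.coef_nonneg e' he') ?_
      rw [h.sum_base he' hS]
      linarith [(h.extremeBase_mem hX hg h0 he').1 S hS]
    have h2 : (gs.map (fun e => e.coef * (g S - ∑ v ∈ S, e.base v))).sum =
        g S - ∑ v ∈ S, combPoint gs v := by
      rw [sum_combPoint, eq_sub_iff_add_eq, ← List.sum_map_add]
      simp only [← mul_add, sub_add_cancel]
      exact h.sum_mul_const _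
    have h3 := mul_le_mul_of_nonneg_left (hg'.1 S hS) (h.coef_nonneg e he)
    nlinarith
  · rw [hsum, hpt.2, hg'.2, h.sum_base he subset_rfl, (h.extremeBase_mem hX hg h0 he).2]
    ring

end IsCombination

/-- The averaging argument behind the new arcs. -/
theorem exists_lt_of_sum_lt {ι : Type*} (O : Finset ι) (y y' : ι → ℝ) (c : ℝ) {k N : ℕ}
    (hk : 1 ≤ k) (hN : O.card + 1 ≤ N) (hle : ∀ v ∈ O, y v ≤ y' v)
    (hc : -(2 * (k : ℝ) * (N : ℝ)) * ∑ v ∈ O, min 0 (y v) < c)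
    (hsum : ∑ v ∈ O, y v + (c - ∑ v ∈ O, y v) / k ≤ ∑ v ∈ O, y' v) :
    ∃ v ∈ O, -∑ u ∈ O, min 0 (y' u) < y' v := by
  by_contra! hcon
  set a := -∑ v ∈ O, min 0 (y v) with ha
  set b := -∑ v ∈ O, min 0 (y' v) with hb
  have hba : b ≤ a := by
    rw [ha, hb, neg_le_neg_iff]
    exact Finset.sum_le_sum (fun v hv => min_le_min_left 0 (hle v hv))
  have hb0 : 0 ≤ b := by
    rw [hb, neg_nonneg]
    exact Finset.sum_nonpos (fun v _ => min_le_left _ _)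
  have hya : -a ≤ ∑ v ∈ O, y v := by
    rw [ha, neg_neg]
    exact Finset.sum_le_sum (fun v _ => min_le_right _ _)
  -- If no entry exceeded `b`, then `y'(O) ≤ |O| b ≤ (N - 1) a`. On the other hand `y'(O) ≥ c/k + (1
  -- - 1/k) y(O)`, which exceeds `2Na - a` because `c > 2kNa` and `y(O) ≥ -a`.
  have h1 : ∑ v ∈ O, y' v ≤ O.card * b := by
    have := Finset.sum_le_card_nsmul O y' b hcon
    simpa using this
  have hk' : (1 : ℝ) ≤ k := by exact_mod_cast hk
  have hN' : (O.card : ℝ) + 1 ≤ N := by exact_mod_cast hN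
  have hk0 : (0 : ℝ) < k := by linarith
  have hc' : 2 * N * a < c / k := by
    rw [lt_div_iff₀ hk0]
    calc 2 * N * a * k = -(2 * (k : ℝ) * (N : ℝ)) * ∑ v ∈ O, min 0 (y v) := by rw [ha]; ring
      _ < c := hc
  have h2 : (c - ∑ v ∈ O, y v) / k = c / k - (∑ v ∈ O, y v) / k := sub_div _ _ _
  have h3 : (∑ v ∈ O, y v) - (∑ v ∈ O, y v) / k = (1 - 1 / k) * ∑ v ∈ O, y v := by ring
  have hk1 : 0 ≤ 1 - 1 / (k : ℝ) := by
    rw [sub_nonneg, div_le_one hk0]; exact hk'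
  have hk2 : 0 ≤ 1 / (k : ℝ) := by positivity
  have h4 : (1 - 1 / k) * (-a) ≤ (1 - 1 / (k : ℝ)) * ∑ v ∈ O, y v :=
    mul_le_mul_of_nonneg_left hya hk1
  have h5 : (O.card : ℝ) * b ≤ O.card * a := mul_le_mul_of_nonneg_left hba (by positivity)
  have ha0 : 0 ≤ a := hb0.trans hba
  have h6 : ((O.card : ℝ) + 1) * a ≤ N * a := mul_le_mul_of_nonneg_right hN' ha0
  have h7 : 0 ≤ 1 / (k : ℝ) * a := mul_nonneg hk2 ha0
  have h8 : 0 ≤ (N : ℝ) * a := by positivity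
  nlinarith

/-! ### New arcs and contractions -/

section Steps

variable {n : ℕ} {f : Finset (Fin n) → ℝ} {s : State n}

theorem State.sum_map_reps (s : State n) (F : Fin n → ℝ) :
    (s.reps.map F).sum = ∑ v ∈ s.ground, F v := by
  rw [← List.sum_toFinset _ s.nodup_reps, s.toFinset_reps]

theorem State.mem_ground_inter_outside {u z : Fin n} :
    u ∈ s.ground ∩ s.outside z ↔ u ∈ s.ground ∧ s.le z u = false := by
  rw [Finset.mem_inter, mem_outside]
  have := @notMem_T_of_mem_ground n s u
  tauto

theorem State.sum_map_reps_outside (s : State n) (z : Fin n) (F : Fin n → ℝ) :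
    (s.reps.map (fun u => if s.le z u = true then 0 else F u)).sum =
      ∑ u ∈ s.ground ∩ s.outside z, F u := by
  rw [s.sum_map_reps, ← Finset.sum_filter_add_sum_filter_not s.ground (fun u => s.le z u = true)]
  rw [Finset.sum_eq_zero (s := s.ground.filter (fun u => s.le z u = true)), zero_add]
  · refine Finset.sum_congr ?_ (fun u hu => ?_)
    · ext u
      rw [mem_ground_inter_outside]; simp
    · rw [mem_ground_inter_outside] at hu
      simp [hu.2]
  · intro u hu
    simp only [Finset.mem_filter] at hu
    simp [hu.2]

/-- The number of arcs of a digraph, loops included. -/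
def arcCount {n : ℕ} (le : Fin n → Fin n → Bool) : ℕ :=
  (Finset.univ.filter (fun p : Fin n × Fin n => le p.1 p.2 = true)).card

theorem arcCount_le (le : Fin n → Fin n → Bool) : arcCount le ≤ n ^ 2 := by
  refine (Finset.card_le_univ _).trans ?_
  simp [sq]

theorem arcCount_mono {le le' : Fin n → Fin n → Bool}
    (h : ∀ u v, le u v = true → le' u v = true) : arcCount le ≤ arcCount le' := by
  refine Finset.card_le_card (fun p hp => ?_)
  simp only [Finset.mem_filter, Finset.mem_univ, true_and] at hp ⊢
  exact h _ _ hp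

/-- Distinct sources of new arcs give distinct new arcs. -/
theorem arcCount_add_card_le {le le' : Fin n → Fin n → Bool}
    (h : ∀ u v, le u v = true → le' u v = true) (Z : Finset (Fin n))
    (hZ : ∀ z ∈ Z, ∃ v, le z v = false ∧ le' z v = true) :
    arcCount le + Z.card ≤ arcCount le' := by
  choose! w hw using hZ
  have hinj : Set.InjOn (fun z => (z, w z)) Z := fun a _ b _ hab => (Prod.ext_iff.1 hab).1
  rw [← Finset.card_image_of_injOn hinj, arcCount, arcCount, ← Finset.card_union_of_disjoint]
  · refine Finset.card_le_card (fun p hp => ?_)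
    simp only [Finset.mem_union, Finset.mem_filter, Finset.mem_univ, true_and,
      Finset.mem_image] at hp ⊢
    rcases hp with hp | ⟨z, hz, rfl⟩
    · exact h _ _ hp
    · exact (hw z hz).2
  · rw [Finset.disjoint_left]
    intro p hp hp'
    simp only [Finset.mem_filter, Finset.mem_univ, true_and, Finset.mem_image] at hp hp'
    obtain ⟨z, hz, rfl⟩ := hp'
    rw [(hw z hz).1] at hp
    exact absurd hp (by simp)

/-- Adding the pairs `(a, b)` with `a ≼ z` and `v ≼ b` is the transitive closure after adding `z ≼
v`. As `v ∉ T` and `T` is closed downwards, no such `b` lies in `T`, so `T` stays closed. -/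
theorem IsReduction.addArc_isReduction {le : Fin n → Fin n → Bool}
    (hs : IsReduction f { s with le := le }) {v z : Fin n} (hv : v ∉ s.T)
    (hvz : ∀ M, IsMinimizer f M → v ∈ M → z ∈ M) :
    IsReduction f { s with le := fun a b => le a b || (le a z && le v b) } := by
  have htr := hs.trans
  have hcl := hs.closed
  have hmc := hs.minimizer_closed
  simp only at htr hcl hmc
  refine ⟨fun u => ?_, fun a b c hab hbc => ?_, hs.subset_minimizer, fun M hM a b hab hb => ?_,
    fun a b hab hb => ?_, hs.fT_eq, hs.top_eq, hs.top_le_univ, hs.top_le⟩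
  · simp [show le u u = true from hs.refl u]
  · simp only [Bool.or_eq_true, Bool.and_eq_true] at hab hbc ⊢
    rcases hab with hab | hab <;> rcases hbc with hbc | hbc
    · exact Or.inl (htr _ _ _ hab hbc)
    · exact Or.inr ⟨htr _ _ _ hab hbc.1, hbc.2⟩
    · exact Or.inr ⟨hab.1, htr _ _ _ hab.2 hbc⟩
    · exact Or.inr ⟨hab.1, hbc.2⟩
  · simp only [Bool.or_eq_true, Bool.and_eq_true] at hab
    rcases hab with hab | hab
    · exact hmc M hM a b hab hb
    · exact hmc M hM a z hab.1 (hvz M hM (hmc M hM v b hab.2 hb))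
  · simp only [Bool.or_eq_true, Bool.and_eq_true] at hab
    rcases hab with hab | hab
    · exact hcl a b hab hb
    · exact absurd (hcl v b hab.2 hb) hv

/-- Amortized cost: restoring transitivity takes `n²` steps but happens only if at least one pair is
new. Weighting the arc count by `n²` leaves one step per call. -/
theorem addArc_runs (EO : ℕ) {le : Fin n → Fin n → Bool}
    (hs : IsReduction f { s with le := le }) {v z : Fin n} (hv : v ∉ s.T)
    (hvz : ∀ M, IsMinimizer f M → v ∈ M → z ∈ M) :
    (addArc le v z).Runs f EO (fun le' t => IsReduction f { s with le := le' } ∧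
      (∀ a b, le a b = true → le' a b = true) ∧ le' z v = true ∧
      t + n ^ 2 * arcCount le ≤ 1 + n ^ 2 * arcCount le') := by
  unfold addArc
  refine Runs.bind (Runs.exact _) ?_
  rintro _ _ ⟨rfl, rfl⟩
  split_ifs with h
  · exact Runs.pure ⟨hs, fun _ _ h => h, h, by simp⟩
  · have hr := hs.refl
    simp only at hr
    have hnew : (le z v || (le z z && le v v)) = true := by simp [hr]
    have hmono : ∀ a b, le a b = true → (le a b || (le a z && le v b)) = true := by
      intro a b hab; simp [hab]
    have hcount := arcCount_add_card_le hmono {z} (by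
      intro w hw
      rw [Finset.mem_singleton] at hw
      subst hw
      exact ⟨v, by simpa using h, hnew⟩)
    rw [Finset.card_singleton] at hcount
    refine ⟨by simpa using hs.addArc_isReduction hv hvz, ?_, ?_, ?_⟩
    · simpa using hmono
    · simpa using hnew
    · simp only [time_bind, time_tick, time_pure, result_bind, result_pure]
      have := Nat.mul_le_mul_left (n ^ 2) hcount
      rw [← pow_two]
      linarith

namespace IsReduction

/-- An arc found by the scheme is valid. -/
theorem mem_minimizer_of_arc (hs : IsReduction f s) {y : Vec n}
    (hy : y ∈ basePolytope s.ground (s.fdown (s.negEll f) f)) {z v : Fin n} (hv : v ∈ s.ground)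
    (hvz : -∑ u ∈ s.ground ∩ s.outside z, min 0 (y u) < y v) {M : Finset (Fin n)}
    (hM : IsMinimizer f M) (hvM : v ∈ M) : z ∈ M := by
  by_contra hz
  have hid := hs.isIdeal_minimizer hM
  have hval : s.val f M = f M := by
    -- A minimizer that misses `z` is a proper subset, so its value is not affected by the
    -- truncation.
    have : M ≠ Finset.univ := fun h => hz (h ▸ Finset.mem_univ z)
    simp [val, this]
  have h1 := hy.1 (s.ground ∩ M) Finset.inter_subset_left
  rw [hs.fdown_ideal hid, hval, hs.fT_eq] at h1
  -- Such a minimizer lies in the complement of `z↑`. There the negative entries of `y` cannot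
  -- compensate for `y v`, so `0 < y(M) ≤ f(M) - f(T)`, which contradicts minimality.
  have hsub : s.ground ∩ M ⊆ s.ground ∩ s.outside z := by
    intro u hu
    rw [Finset.mem_inter] at hu
    rw [mem_ground_inter_outside]
    refine ⟨hu.1, ?_⟩
    by_contra h
    rw [Bool.not_eq_false] at h
    exact hz (hid.closed z u h hu.2)
  have h2 : ∑ u ∈ s.ground ∩ s.outside z, min 0 (y u) ≤ ∑ u ∈ s.ground ∩ M, min 0 (y u) :=
    Finset.sum_le_sum_of_subset_of_nonpos' hsub (fun _ _ _ => min_le_left _ _)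
  have hvm : v ∈ s.ground ∩ M := Finset.mem_inter.2 ⟨hv, hvM⟩
  have h4 : min 0 (y v) + ∑ u ∈ (s.ground ∩ M).erase v, min 0 (y u) =
      ∑ u ∈ s.ground ∩ M, min 0 (y u) := Finset.add_sum_erase _ (fun u => min 0 (y u)) hvm
  have h5 := Finset.add_sum_erase _ y hvm
  have h6 : ∑ u ∈ (s.ground ∩ M).erase v, min 0 (y u) ≤ ∑ u ∈ (s.ground ∩ M).erase v, y u :=
    Finset.sum_le_sum (fun u _ => min_le_right _ _)
  have h7 := min_le_left 0 (y v)
  have h8 := hM s.T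
  linarith

/-- A contracted element belongs to all minimizers. -/
theorem mem_minimizer_of_lt (hs : IsReduction f s) (hf : IsSubmodular f) {y : Vec n}
    (hy : y ∈ basePolytope s.ground (s.fdown (s.negEll f) f)) {X W : Finset (Fin n)}
    (hX : X ⊆ s.ground) (hW : W ⊆ X) {δ : ℝ} (hδ : 0 ≤ δ)
    (hlm : ∑ v ∈ s.ground, s.negEll f v ≤ 0)
    (happ : s.fdown (s.negEll f) f W ≤ ∑ v ∈ X, min 0 (y v) +
      δ * complexityL X (s.fdown (s.negEll f) f))
    (hrest : ∀ v ∈ s.ground \ X, 2 * (∑ v ∈ s.ground, s.negEll f v) * δ ≤ y v) {v : Fin n}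
    (hv : v ∈ s.ground)
    (hyv : y v < 2 * (∑ v ∈ s.ground, s.negEll f v) * ((2 * (n : ℝ) ^ 2 + 1) * δ))
    {M : Finset (Fin n)} (hM : IsMinimizer f M) : v ∈ M := by
  by_contra hvM
  set lm := ∑ v ∈ s.ground, s.negEll f v with hlmdef
  have hid := hs.isIdeal_minimizer hM
  have hval : s.val f M = f M := by
    have : M ≠ Finset.univ := fun h => hvM (h ▸ Finset.mem_univ v)
    simp [val, this]
  have h1 := hy.1 (s.ground ∩ M) Finset.inter_subset_left
  rw [hs.fdown_ideal hid, hval] at h1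
  have h2 := hs.val_down_le_fdown (f := f) (hW.trans hX)
  have h3 := hs.minimizer_le_val hM (s.down W)
  have h4 := mul_le_mul_of_nonneg_left (hs.complexityL_le hf hX) hδ
  rw [← hlmdef] at h4
  have hcard : ((s.ground \ X).card : ℝ) ≤ n := by
    have := Finset.card_le_univ (s.ground \ X)
    rw [Fintype.card_fin] at this
    exact_mod_cast this
  have hlmδ : 2 * lm * δ ≤ 0 := by nlinarith
  -- The negative part of `y` splits over `X` and its complement. On `X` it is at least `f↓(W) + 2
  -- lm δ`, since `L ≤ -2 lm`; off `X` it is at least `n · 2 lm δ`. A minimizer without `v` avoids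
  -- paying `y v`, so its value would exceed that of `W↓` as soon as `y v < (n + 1) · 2 lm δ`. The
  -- factor `2n² + 1` is larger than this requires.
  have h5 : (n : ℝ) * (2 * lm * δ) ≤ ∑ u ∈ s.ground \ X, min 0 (y u) := by
    have := Finset.card_nsmul_le_sum (s.ground \ X) (fun u => min 0 (y u)) (2 * lm * δ)
      (fun u hu => le_min hlmδ (hrest u hu))
    rw [nsmul_eq_mul] at this
    nlinarith
  have h6 := Finset.sum_sdiff (f := fun u => min 0 (y u)) hX
  have h7 : ∑ u ∈ s.ground.erase v, min 0 (y u) ≤ ∑ u ∈ s.ground ∩ M, y u := by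
    refine le_trans ?_ (Finset.sum_le_sum (fun u _ => min_le_right 0 (y u)))
    refine Finset.sum_le_sum_of_subset_of_nonpos' (fun u hu => ?_) (fun _ _ _ => min_le_left _ _)
    rw [Finset.mem_inter] at hu
    exact Finset.mem_erase.2 ⟨fun h => hvM (h ▸ hu.2), hu.1⟩
  have h8 := Finset.add_sum_erase s.ground (fun u => min 0 (y u)) hv
  have h9 := min_le_right 0 (y v)
  have hn : (0 : ℝ) < n := by
    have := v.pos
    exact_mod_cast this
  have h10 : (n : ℝ) ≤ (n : ℝ) ^ 2 := by
    have : n ≤ n ^ 2 := Nat.le_self_pow (by norm_num) n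
    exact_mod_cast this
  nlinarith

theorem exists_minimizer (f : Finset (Fin n) → ℝ) : ∃ M, IsMinimizer f M := by
  obtain ⟨M, -, hM⟩ := Finset.exists_min_image (Finset.univ : Finset (Finset (Fin n))) f
    Finset.univ_nonempty
  exact ⟨M, fun U => hM U (Finset.mem_univ U)⟩

/-- If `v` lies in every minimizer, then so does `v↓`, because minimizers are ideals. The new
truncated value is either the old one or the value at the new contracted set, as `top_eq` requires.
-/
theorem contract (hs : IsReduction f s) {v : Fin n} (hv : ∀ M, IsMinimizer f M → v ∈ M) :
    IsReduction f { s with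
      T := s.down {v}
      fT := s.val f (s.down {v})
      top := min s.top (s.val f (s.down {v})) } := by
  have hsub : ∀ M, IsMinimizer f M → s.down {v} ⊆ M := by
    intro M hM u hu
    have hid := hs.isIdeal_minimizer hM
    rw [mem_down] at hu
    rcases hu with hu | ⟨w, hw, huw⟩
    · exact hid.subset hu
    · rw [Finset.mem_singleton] at hw
      exact hid.closed u w huw (hw ▸ hv M hM)
  -- The stored value could be the truncated one only if `v↓` is the full set. Then the full set is
  -- a minimizer, and no truncation below its value is possible.
  have hfT : s.val f (s.down {v}) = f (s.down {v}) := by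
    by_cases h : s.down {v} = Finset.univ
    · obtain ⟨M, hM⟩ := exists_minimizer f
      have hMu : M = Finset.univ := Finset.eq_univ_of_forall (fun u => hsub M hM (by simp [h]))
      refine le_antisymm (hs.val_le _) ?_
      have := hs.minimizer_le_val hM (s.down {v})
      rwa [hMu, ← h] at this
    · simp [val, h]
  refine ⟨hs.refl, hs.trans, hsub, hs.minimizer_closed, (hs.isIdeal_down {v}).closed, hfT, ?_,
    (min_le_left _ _).trans hs.top_le_univ, min_le_right _ _⟩
  rcases min_choice s.top (s.val f (s.down {v})) with h | h
  · simp only [h]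
    rcases hs.top_eq with h' | ⟨T', hT', h'⟩
    · exact Or.inl h'
    · exact Or.inr ⟨T', hT'.trans (s.T_subset_down _), h'⟩
  · simp only [h]
    exact Or.inr ⟨_, subset_rfl, hfT⟩

end IsReduction

theorem contractElement_runs (EO : ℕ) (hs : IsReduction f s) {v : Fin n}
    (hv : ∀ M, IsMinimizer f M → v ∈ M) :
    (contractElement s v).Runs f EO (fun s' t => IsReduction f s' ∧ s'.le = s.le ∧ s.T ⊆ s'.T ∧
      v ∈ s'.T ∧ t ≤ 2 * n + EO) := by
  unfold contractElement Runs
  simp only [result_bind, time_bind, time_tick, result_pure, time_pure, result_valT]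
  refine ⟨hs.contract hv, trivial, s.T_subset_down _, hs.subset_down _ (by simp), ?_⟩
  have := s.time_valT_le f EO (s.down {v})
  omega

end Steps

/-! ### The exchange of one base and the new arcs with a given source. -/

section Treat

variable {n : ℕ} {f : Finset (Fin n) → ℝ} {s : State n}

theorem argmaxTerm_runs (EO : ℕ) (V : List (Fin n)) (gs : List (Term n)) (a : Term n → Prog n ℝ)
    (val : Term n → ℝ) (c : ℝ) (ha : ∀ e, (a e).Runs f EO (fun r t => r = val e ∧ t ≤ V.length)) :
    (loop gs (none : Option (Term n × ℝ)) (fun r e => do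
      let a ← a e
      let score := e.coef * (c - a)
      match r with
      | none => pure (some (e, score))
      | some (e', score') =>
        pure (if score' < score then some (e, score) else some (e', score')))).Runs f EO
    (fun r t => t ≤ gs.length * (V.length + 1) ∧ ((r = none ∧ gs = []) ∨
      ∃ e sc, r = some (e, sc) ∧ e ∈ gs ∧ sc = e.coef * (c - val e) ∧
        ∀ e' ∈ gs, e'.coef * (c - val e') ≤ sc)) := by
  refine Runs.loop (fun pre r t => t ≤ pre.length * (V.length + 1) ∧ ((r = none ∧ pre = []) ∨
      ∃ e sc, r = some (e, sc) ∧ e ∈ pre ∧ sc = e.coef * (c - val e) ∧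
        ∀ e' ∈ pre, e'.coef * (c - val e') ≤ sc)) (by simp) ?_
  rintro pre b post - r t ⟨ht, h⟩
  refine Runs.bind (ha b) ?_
  rintro _ t' ⟨rfl, ht'⟩
  have htime : t + (1 + (t' + 0)) ≤ (pre ++ [b]).length * (V.length + 1) := by
    rw [List.length_append, List.length_singleton, Nat.succ_mul]
    omega
  rcases h with ⟨rfl, rfl⟩ | ⟨e, sc, rfl, he, hsc, hmax⟩
  · exact Runs.pure ⟨htime, Or.inr ⟨b, _, rfl, by simp, rfl, by simp⟩⟩
  · simp only
    refine Runs.pure ⟨htime, Or.inr ?_⟩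
    split_ifs with hlt
    · refine ⟨b, _, rfl, by simp, rfl, fun e' he' => ?_⟩
      rcases List.mem_append.1 he' with he' | he'
      · exact (hmax e' he').trans hlt.le
      · rw [List.mem_singleton.1 he']
    · refine ⟨e, sc, rfl, by simp [he], hsc, fun e' he' => ?_⟩
      rcases List.mem_append.1 he' with he' | he'
      · exact hmax e' he'
      · rw [List.mem_singleton.1 he']; exact not_lt.1 hlt

theorem State.mem_ground_of_perm {l : List (Fin n)} (hl : l.Perm s.reps) {v : Fin n} :
    v ∈ l ↔ v ∈ s.ground := by
  rw [hl.mem_iff, mem_reps]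

/-- The exchange of one base that produces the new arcs with source `z`. -/
theorem IsReduction.exchange_spec (hs : IsReduction f s) (hf : IsSubmodular f)
    {gs : List (Term n)} (hgs : IsCombination s.reps (s.fdown (s.negEll f) f) gs)
    {y : Vec n} (hy : ∀ v ∈ s.ground, y v = combPoint gs v) {z : Fin n} (hz : z ∈ s.ground)
    {e : Term n} (he : e ∈ gs)
    (hmax : ∀ e' ∈ gs, e'.coef * (s.val f (s.outside z) - s.fT -
        ∑ u ∈ s.ground ∩ s.outside z, e'.base u) ≤
      e.coef * (s.val f (s.outside z) - s.fT - ∑ u ∈ s.ground ∩ s.outside z, e.base u))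
    (hfire : -(2 * (gs.length : ℝ) * (s.reps.length : ℝ)) *
      ∑ u ∈ s.ground ∩ s.outside z, min 0 (y u) < s.val f (s.outside z) - s.fT)
    {y' : Vec n} (hy' : ∀ v ∈ s.ground, y' v = y v + e.coef *
      (extremeBase (s.fdown (s.negEll f) f) (e.order.filter (fun u => !s.le z u) ++
        e.order.filter (fun u => s.le z u)) v - e.base v)) :
    y' ∈ basePolytope s.ground (s.fdown (s.negEll f) f) ∧
    ∃ v ∈ s.ground ∩ s.outside z, -∑ u ∈ s.ground ∩ s.outside z, min 0 (y' u) < y' v := by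
  set g := s.fdown (s.negEll f) f with hg
  set O := s.ground ∩ s.outside z with hO
  set τ := e.order.filter (fun u => !s.le z u) ++ e.order.filter (fun u => s.le z u) with hτ
  have hsub : IsSubmodular g := hs.fdown_submodular hf
  have hsubX : ∀ X, IsSubmodularOn X g := fun X S _ T _ => hsub S T
  have hg0 : g ∅ = 0 := hs.fdown_empty ⟨z, hz⟩
  have hperm := hgs.order_perm e he
  have hnd : e.order.Nodup := hperm.nodup_iff.2 s.nodup_reps
  have hτperm : τ.Perm s.reps := by
    refine List.Perm.trans ?_ hperm
    have := List.filter_append_perm (fun u => !s.le z u) e.order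
    simpa [hτ] using this
  have hτnd : τ.Nodup := hτperm.nodup_iff.2 s.nodup_reps
  have hτset : τ.toFinset = s.ground := by
    rw [List.toFinset_eq_of_perm _ _ hτperm, s.toFinset_reps]
  have hτbase := extremeBase_mem_basePolytope (hsubX _) hg0 hτnd hτset
  have hgroundO : O ⊆ s.ground := Finset.inter_subset_left
  -- With `z↑` moved to the end, `V \ z↑` is a prefix of the ordering, so the new base is tight
  -- there: its sum over `O` equals `f↓(O) = f(V \ z↑)`.
  have hO1 : (e.order.filter (fun u => !s.le z u)).toFinset = O := by
    ext u
    rw [hO, mem_ground_inter_outside]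
    simp [mem_ground_of_perm hperm]
  have hgO : g O = s.val f (s.outside z) - s.fT := hs.fdown_ideal (hs.isIdeal_outside z)
  have hsumτ : ∑ u ∈ O, extremeBase g τ u = g O := by
    rw [← sub_zero (g O), ← hg0, ← hO1, ← sum_extremeBase g (hnd.filter _)]
    refine Finset.sum_congr rfl (fun u hu => ?_)
    rw [hτ, extremeBase_append_left _ _ (List.mem_toFinset.1 hu)]
  have hleτ : ∀ u ∈ O, e.base u ≤ extremeBase g τ u := by
    intro u hu
    have hu' := hu
    rw [← hO1, List.mem_toFinset] at hu'
    rw [hgs.base_eq e he u (mem_reps.2 (hgroundO hu)), hτ, extremeBase_append_left _ _ hu']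
    rw [List.mem_filter] at hu'
    exact extremeBase_le_filter hnd (hsubX _) _ hu'.1 hu'.2
  have hpt := hgs.exchange_mem s.nodup_reps (hsubX _) hg0 he (g' := extremeBase g τ)
    (by rwa [s.toFinset_reps])
  rw [s.toFinset_reps] at hpt
  have hy'eq : ∀ v ∈ s.ground, y' v = combPoint gs v + e.coef * (extremeBase g τ v - e.base v) :=
    fun v hv => by rw [hy' v hv, hy v hv]
  constructor
  · refine ⟨fun S hS => ?_, ?_⟩
    · rw [Finset.sum_congr rfl (fun v hv => hy'eq v (hS hv))]
      exact hpt.1 S hS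
    · rw [Finset.sum_congr rfl hy'eq]
      exact hpt.2
  · rw [← hgO] at hfire hmax
    have hk : 1 ≤ gs.length := List.length_pos_iff.2 hgs.ne_nil
    have hcard : O.card + 1 ≤ s.reps.length := by
      rw [← List.toFinset_card_of_nodup s.nodup_reps, s.toFinset_reps]
      refine Nat.succ_le_of_lt (Finset.card_lt_card ⟨hgroundO, fun h => ?_⟩)
      have := h hz
      rw [hO, mem_ground_inter_outside, hs.refl z] at this
      exact absurd this.2 (by simp)
    refine exists_lt_of_sum_lt O y y' (g O) hk hcard (fun v hv => ?_) hfire ?_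
    · rw [hy' v (hgroundO hv)]
      have := mul_nonneg (hgs.coef_nonneg e he) (sub_nonneg.2 (hleτ v hv))
      linarith
    · have hysum : ∑ v ∈ O, y v = ∑ v ∈ O, combPoint gs v :=
        Finset.sum_congr rfl (fun v hv => hy v (hgroundO hv))
      have h1 : ∑ v ∈ O, y' v = ∑ v ∈ O, y v + e.coef * (g O - ∑ v ∈ O, e.base v) := by
        rw [Finset.sum_congr rfl (fun v hv => hy' v (hgroundO hv)), Finset.sum_add_distrib,
          ← Finset.mul_sum, Finset.sum_sub_distrib, hsumτ]
      have h2 : g O - ∑ v ∈ O, y v =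
          (gs.map (fun e => e.coef * (g O - ∑ v ∈ O, e.base v))).sum := by
        rw [hysum, sum_combPoint, sub_eq_iff_eq_add, ← List.sum_map_add]
        simp only [← mul_add, sub_add_cancel]
        exact (hgs.sum_mul_const _).symm
      -- Averaging: the slacks of the `k` bases add up to the slack of `y`, so the largest of them
      -- is at least a `1/k` share.
      have h3 : (gs.map (fun e => e.coef * (g O - ∑ v ∈ O, e.base v))).sum ≤
          gs.length • (e.coef * (g O - ∑ v ∈ O, e.base v)) := by
        have := List.sum_le_card_nsmul (gs.map (fun e => e.coef * (g O - ∑ v ∈ O, e.base v)))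
          (e.coef * (g O - ∑ v ∈ O, e.base v)) (by
            intro x hx
            obtain ⟨e', he', rfl⟩ := List.mem_map.1 hx
            exact hmax e' he')
        simpa using this
      rw [nsmul_eq_mul] at h3
      rw [h1]
      have hk0 : (0 : ℝ) < gs.length := by exact_mod_cast hk
      have : (g O - ∑ v ∈ O, y v) / gs.length ≤ e.coef * (g O - ∑ v ∈ O, e.base v) := by
        rw [div_le_iff₀ hk0, h2]
        linarith
      linarith

open Classical in
-- New arcs are measured against the digraph `s.le` at the start of the iteration, although `le₁`
-- may already contain arcs from elements treated before. The function `f↓` and the set `V \ z↑` are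
-- still those of `s`, and an existing arc in `le₁` does no harm. The expensive part is charged only
-- if the test for `z` succeeds, and then it is paid by an arc with source `z`.
theorem treatElement_runs (EO : ℕ) (hs : IsReduction f s) (hf : IsSubmodular f) {acc : Access n}
    {ca : ℕ} (hacc : ∀ l : List (Fin n), l.Perm s.reps → (acc l).Runs f EO
      (fun r t => r = prefixValues (s.fdown (s.negEll f) f) l ∧ t ≤ ca))
    {gs : List (Term n)} (hgs : IsCombination s.reps (s.fdown (s.negEll f) f) gs)
    {y : Vec n} (hy : ∀ v ∈ s.ground, y v = combPoint gs v) {z : Fin n} (hz : z ∈ s.ground)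
    {c : ℝ} (hc : c = s.val f (s.outside z) - s.fT)
    {le₁ : Fin n → Fin n → Bool} (hle : IsReduction f { s with le := le₁ }) :
    (treatElement s s.reps acc gs y c z le₁).Runs f EO (fun le' t =>
      IsReduction f { s with le := le' } ∧ (∀ a b, le₁ a b = true → le' a b = true) ∧
      (-(2 * (gs.length : ℝ) * (s.reps.length : ℝ)) *
        ∑ u ∈ s.ground ∩ s.outside z, min 0 (y u) < c →
          ∃ v, s.le z v = false ∧ le' z v = true) ∧
      t + n ^ 2 * arcCount le₁ ≤ n + n ^ 2 * arcCount le' +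
        (if -(2 * (gs.length : ℝ) * (s.reps.length : ℝ)) *
          ∑ u ∈ s.ground ∩ s.outside z, min 0 (y u) < c then
            gs.length * (n + 1) + 7 * n + ca else 0)) := by
  have hVn := s.length_reps_le
  unfold treatElement
  refine Runs.bind (Runs.exact _) ?_
  rintro _ _ ⟨rfl, rfl⟩
  rw [result_sumOver, time_sumOver, s.sum_map_reps_outside z (fun u => min 0 (y u))]
  by_cases hfire : -(2 * (gs.length : ℝ) * (s.reps.length : ℝ)) *
      ∑ u ∈ s.ground ∩ s.outside z, min 0 (y u) < c
  swap
  · rw [if_neg hfire]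
    refine Runs.pure ⟨hle, fun _ _ h => h, fun h => absurd h hfire, ?_⟩
    rw [if_neg hfire]
    omega
  rw [if_pos hfire]
  refine Runs.bind (argmaxTerm_runs EO s.reps gs
    (fun e => sumOver s.reps (fun u => if s.le z u = true then 0 else e.base u))
    (fun e => ∑ u ∈ s.ground ∩ s.outside z, e.base u) c (fun e => by
      refine ⟨?_, ?_⟩
      · rw [result_sumOver, s.sum_map_reps_outside]
      · rw [time_sumOver])) ?_
  rintro r t ⟨ht, h⟩
  rcases h with ⟨-, h⟩ | ⟨e, sc, rfl, he, rfl, hmax⟩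
  · exact absurd h hgs.ne_nil
  simp only
  set g := s.fdown (s.negEll f) f with hg
  have hg0 : g ∅ = 0 := hs.fdown_empty ⟨z, hz⟩
  have hperm := hgs.order_perm e he
  refine Runs.bind (Runs.exact _) ?_
  rintro _ _ ⟨-, rfl⟩
  have hτperm : (e.order.filter (fun u => !s.le z u) ++
      e.order.filter (fun u => s.le z u)).Perm s.reps := by
    refine List.Perm.trans ?_ hperm
    simpa using List.filter_append_perm (fun u => !s.le z u) e.order
  refine Runs.bind (hacc _ hτperm) ?_
  rintro _ t2 ⟨rfl, ht2⟩
  refine Runs.bind (Runs.exact _) ?_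
  rintro _ _ ⟨rfl, rfl⟩
  have ht3 := time_marginals_le f EO (e.order.filter (fun u => !s.le z u) ++
      e.order.filter (fun u => s.le z u)) (prefixValues g (e.order.filter (fun u => !s.le z u) ++
      e.order.filter (fun u => s.le z u))) 0
  set t3 := time f EO (marginals (e.order.filter (fun u => !s.le z u) ++
      e.order.filter (fun u => s.le z u)) (prefixValues g (e.order.filter (fun u => !s.le z u) ++
      e.order.filter (fun u => s.le z u))) 0)
  refine Runs.bind (Runs.exact _) ?_
  rintro _ _ ⟨rfl, rfl⟩
  rw [result_tab, time_tab]
  set y' : Vec n := fun v => if v ∈ s.reps then y v + e.coef * ((marginals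
    (e.order.filter (fun u => !s.le z u) ++ e.order.filter (fun u => s.le z u))
    (prefixValues g (e.order.filter (fun u => !s.le z u) ++
      e.order.filter (fun u => s.le z u))) 0).result f v - e.base v) else 0 with hy'
  have hy'' : ∀ v ∈ s.ground, y' v = y v + e.coef * (extremeBase g
      (e.order.filter (fun u => !s.le z u) ++ e.order.filter (fun u => s.le z u)) v -
        e.base v) := by
    intro v hv
    have := result_marginals g f (hτperm.nodup_iff.2 s.nodup_reps) v
    rw [hg0, if_pos ((mem_ground_of_perm hτperm).2 hv)] at this
    simp only [hy']
    rw [if_pos (mem_reps.2 hv), this]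
  rw [hc] at hfire hmax
  obtain ⟨hy'mem, v₀, hv₀, hv₀'⟩ := hs.exchange_spec hf hgs hy hz he hmax hfire hy''
  rw [← hc] at hfire
  refine Runs.bind (Runs.exact _) ?_
  rintro _ _ ⟨rfl, rfl⟩
  rw [result_sumOver, time_sumOver, s.sum_map_reps_outside z (fun u => min 0 (y' u))]
  refine (Runs.loop (l := s.reps) (fun pre le' t => IsReduction f { s with le := le' } ∧
      (∀ a b, le₁ a b = true → le' a b = true) ∧
      (∀ v ∈ pre, s.le z v = false ∧ y' v > -∑ u ∈ s.ground ∩ s.outside z, min 0 (y' u) →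
        le' z v = true) ∧
      t + n ^ 2 * arcCount le₁ ≤ 2 * pre.length + n ^ 2 * arcCount le')
    ⟨hle, fun _ _ h => h, by simp, by simp⟩ ?_).mono ?_
  · rintro pre b post hpre le₂ t4 ⟨h1, h2, h3, h4⟩
    have hb : b ∈ s.ground := by rw [← mem_reps, hpre]; simp
    split_ifs with hcond
    · refine (addArc_runs EO h1 (notMem_T_of_mem_ground hb) (fun M hM hbM =>
        hs.mem_minimizer_of_arc hy'mem hb hcond.2 hM hbM)).mono ?_
      rintro le₃ t5 ⟨k1, k2, k3, k4⟩
      refine ⟨k1, fun a b h => k2 a b (h2 a b h), fun v hv hv' => ?_, ?_⟩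
      · rcases List.mem_append.1 hv with hv | hv
        · exact k2 _ _ (h3 v hv hv')
        · rw [List.mem_singleton.1 hv]; exact k3
      · rw [List.length_append, List.length_singleton]
        omega
    · refine Runs.pure ⟨h1, h2, fun v hv hv' => ?_, ?_⟩
      · rcases List.mem_append.1 hv with hv | hv
        · exact h3 v hv hv'
        · rw [List.mem_singleton.1 hv] at hv'
          exact absurd hv' hcond
      · rw [List.length_append, List.length_singleton]
        omega
  · rintro le' t4 ⟨h1, h2, h3, h4⟩
    refine ⟨h1, h2, fun _ => ?_, ?_⟩
    · rw [mem_ground_inter_outside] at hv₀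
      exact ⟨v₀, hv₀.2, h3 v₀ (mem_reps.2 hv₀.1) ⟨hv₀.2, hv₀'⟩⟩
    · rw [if_pos hfire]
      have l1 := hτperm.length_eq
      have l2 := hperm.length_eq
      rw [l1] at ht3
      rw [time_tick, l2]
      have h5 : gs.length * (s.reps.length + 1) ≤ gs.length * (n + 1) :=
        Nat.mul_le_mul_left _ (by omega)
      omega

end Treat

/-! ### Bucketing -/

section Bucket

variable {n : ℕ} (f : Finset (Fin n) → ℝ) (EO : ℕ)

/-- Every rejected index witnesses more than a doubling. An index below the limit is returned only
because it passed the test. -/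
theorem bucketIndex_runs (V : List (Fin n)) (l : Vec n) (lm q : ℝ) (k t : ℕ) :
    (bucketIndex V l lm q k t).Runs f EO (fun b τ =>
      t ≤ b ∧ b ≤ t + k ∧
      (∀ i, t ≤ i → i < b → 2 * V.countP (fun z => decide (l z ≤ 2 * lm / q ^ (i - 1))) <
        V.countP (fun z => decide (l z ≤ 2 * lm / q ^ i))) ∧
      (b < t + k → V.countP (fun z => decide (l z ≤ 2 * lm / q ^ b)) ≤
        2 * V.countP (fun z => decide (l z ≤ 2 * lm / q ^ (b - 1)))) ∧
      τ ≤ k * (2 * V.length + t + k)) := by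
  induction k generalizing t with
  | zero => 
    refine Runs.pure ⟨le_rfl, le_rfl, fun i h1 h2 => by omega, fun h => by omega, by simp⟩
  | succ k ih =>
    unfold bucketIndex
    refine Runs.bind (Runs.exact _) ?_
    rintro _ _ ⟨-, rfl⟩
    rw [time_tick]
    split_ifs with h
    · refine Runs.pure ⟨le_rfl, by omega, fun i h1 h2 => by omega, fun _ => h, ?_⟩
      have : 1 * (2 * V.length + t) ≤ (k + 1) * (2 * V.length + t + (k + 1)) :=
        Nat.mul_le_mul (by omega) (by omega)
      omega
    · refine (ih (t + 1)).mono ?_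
      rintro b τ ⟨h1, h2, h3, h4, h5⟩
      refine ⟨by omega, by omega, fun i hi hib => ?_, fun hb => h4 (by omega), ?_⟩
      · rcases Nat.eq_or_lt_of_le hi with rfl | hi
        · exact not_le.1 h
        · exact h3 i hi hib
      · have : k * (2 * V.length + (t + 1) + k) = k * (2 * V.length + t + (k + 1)) := by ring
        rw [this] at h5
        have := Nat.add_one_mul k (2 * V.length + t + (k + 1))
        omega

/-- What bucketing achieves when the first bucket is empty and the second is not. -/
theorem bucketIndex_spec (V : List (Fin n)) (l : Vec n) (lm q : ℝ) (hV : V.length ≤ n)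
    (h0 : V.countP (fun z => decide (l z ≤ 2 * lm / q ^ 0)) = 0)
    (h1 : 0 < V.countP (fun z => decide (l z ≤ 2 * lm / q ^ 1))) :
    (bucketIndex V l lm q (n + 2) 1).Runs f EO (fun b τ =>
      2 ≤ b ∧ b ≤ Nat.log 2 n + 2 ∧
      V.countP (fun z => decide (l z ≤ 2 * lm / q ^ b)) ≤
        2 * V.countP (fun z => decide (l z ≤ 2 * lm / q ^ (b - 1))) ∧
      τ ≤ (n + 2) * (3 * n + 3)) := by
  refine (bucketIndex_runs f EO V l lm q (n + 2) 1).mono ?_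
  rintro b τ ⟨hb1, hb2, hb3, hb4, hb5⟩
  -- Starting from a nonempty `V^1`, each rejected index at least doubles the set. Hence `2^(b-2) ≤
  -- |V^(b-1)| ≤ n`, so the logarithmic bound holds and the limit `n + 2` on the number of trials is
  -- never reached.
  have hgrow : ∀ i, 1 ≤ i → i < b →
      2 ^ (i - 1) ≤ V.countP (fun z => decide (l z ≤ 2 * lm / q ^ i)) := by
    intro i hi
    induction i, hi using Nat.le_induction with
    | base => intro _; simpa using h1
    | succ i hi ih =>
      intro hib
      have h2 := ih (by omega)
      have h3 := hb3 (i + 1) (by omega) hib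
      rw [Nat.add_sub_cancel] at h3 ⊢
      have : 2 ^ i = 2 * 2 ^ (i - 1) := by
        rw [← pow_succ']; congr 1; omega
      omega
  have hlog : b ≤ Nat.log 2 n + 2 := by
    by_contra! hcon
    have h2 := hgrow (b - 1) (by omega) (by omega)
    have h3 := List.countP_le_length (p := fun z => decide (l z ≤ 2 * lm / q ^ (b - 1))) (l := V)
    have h4 : 2 ^ (b - 1 - 1) ≤ n := by omega
    have hn : n ≠ 0 := by
      have := Nat.pos_of_ne_zero (show 2 ^ (b - 1 - 1) ≠ 0 by positivity)
      omega
    have := (Nat.le_log_iff_pow_le (by norm_num) hn).2 h4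
    omega
  have hb : 2 ≤ b := by
    by_contra! hcon
    have : b = 1 := by omega
    subst this
    have := hb4 (by omega)
    rw [Nat.sub_self, h0] at this
    omega
  refine ⟨hb, hlog, hb4 ?_, ?_⟩
  · have := Nat.log_le_self 2 n
    by_contra! hcon
    have h5 : b = n + 3 := by omega
    have h6 : n + 1 ≤ Nat.log 2 n := by omega
    omega
  · refine hb5.trans (Nat.mul_le_mul_left _ (by omega))

end Bucket

/-! ### One iteration of the scheme -/

section Iteration

variable {n : ℕ} {f : Finset (Fin n) → ℝ} {s : State n}

theorem State.lowerBounds_runs (s : State n) (f : Finset (Fin n) → ℝ) (EO : ℕ) :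
    (s.lowerBounds s.reps).Runs f EO (fun r t =>
      (∀ v ∈ s.ground, r.1 v = s.val f (s.outside v) - s.fT) ∧
      (∀ v ∈ s.ground, r.2 v = s.ell f v) ∧ (fun v => min 0 (r.2 v)) = s.negEll f ∧
      t ≤ n * (4 * n + 2 * EO + 1)) := by
  unfold lowerBounds
  refine (Runs.loop (fun pre r t =>
    (∀ v, r.1 v = if v ∈ pre then s.val f (s.outside v) - s.fT else 0) ∧
    (∀ v, r.2 v = if v ∈ pre then s.ell f v else 0) ∧
    t ≤ pre.length * (4 * n + 2 * EO + 1)) (by simp) ?_).mono ?_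
  · rintro pre b post - r t ⟨h1, h2, h3⟩
    unfold Runs
    simp only [result_bind, time_bind, time_tick, result_pure, time_pure, result_valT]
    have t1 := s.time_valT_le f EO (s.outside b)
    have t2 := s.time_valT_le f EO (s.outsideWith b)
    refine ⟨fun v => ?_, fun v => ?_, ?_⟩
    · by_cases hv : v = b
      · subst hv; simp
      · simp [hv, h1]
    · by_cases hv : v = b
      · subst hv; simp [ell]
      · simp [hv, h2]
    · have : (pre ++ [b]).length * (4 * n + 2 * EO + 1) =
          pre.length * (4 * n + 2 * EO + 1) + (4 * n + 2 * EO + 1) := by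
        rw [List.length_append, List.length_singleton, Nat.add_one_mul]
      omega
  · rintro r t ⟨h1, h2, h3⟩
    refine ⟨fun v hv => by rw [h1, if_pos (mem_reps.2 hv)],
      fun v hv => by rw [h2, if_pos (mem_reps.2 hv)], ?_, ?_⟩
    · ext v
      by_cases hv : v ∈ s.ground
      · rw [h2, if_pos (mem_reps.2 hv), negEll_of_mem hv]
      · rw [h2, if_neg (fun h => hv (mem_reps.1 h)), negEll_of_notMem hv, min_self]
    · exact h3.trans (Nat.mul_le_mul_right _ s.length_reps_le)

/-- If nothing is contracted, every element with a very small lower bound is treated. -/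
theorem IsReduction.fires (hs : IsReduction f s) {y : Vec n}
    (hy : y ∈ basePolytope s.ground (s.fdown (s.negEll f) f)) {K k b : ℕ} {q lm : ℝ}
    (hK : 1 ≤ K) (hq : q = (4 * ((K : ℝ) * (n : ℝ)) * (n : ℝ)) ^ 4) (hlm : lm < 0)
    (hk : k ≤ K * n) (hb : 1 ≤ b)
    (hyv : ∀ v ∈ s.ground, 2 * lm * ((2 * (n : ℝ) ^ 2 + 1) / q ^ b) ≤ y v) {z : Fin n}
    (hz : s.ell f z ≤ 2 * lm / q ^ (b - 1)) :
    -(2 * (k : ℝ) * (s.reps.length : ℝ)) * ∑ u ∈ s.ground ∩ s.outside z, min 0 (y u) <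
      s.val f (s.outside z) - s.fT := by
  have hn : (1 : ℝ) ≤ n := by exact_mod_cast z.pos
  have hK' : (1 : ℝ) ≤ K := by exact_mod_cast hK
  have hq0 : 0 < q := by rw [hq]; positivity
  set u := -2 * lm / q ^ b with hu
  have hu0 : 0 < u := by rw [hu]; apply div_pos <;> [linarith; positivity]
  set a := -∑ v ∈ s.ground, min 0 (y v) with ha
  have ha0 : 0 ≤ a := by
    rw [ha, neg_nonneg]
    exact Finset.sum_nonpos (fun v _ => min_le_left _ _)
  have ha1 : a ≤ n * ((2 * (n : ℝ) ^ 2 + 1) * u) := by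
    have h1 := Finset.card_nsmul_le_sum s.ground (fun v => min 0 (y v)) (-((2 * (n : ℝ) ^ 2 + 1) * u))
      (fun v hv => by
        refine le_min ?_ ?_
        · rw [neg_nonpos]; positivity
        · refine le_trans (le_of_eq ?_) (hyv v hv)
          rw [hu]; ring)
    have h2 : (s.ground.card : ℝ) ≤ n := by
      have := Finset.card_le_univ s.ground
      rw [Fintype.card_fin] at this
      exact_mod_cast this
    rw [nsmul_eq_mul] at h1
    have h3 : (s.ground.card : ℝ) * ((2 * (n : ℝ) ^ 2 + 1) * u) ≤
        n * ((2 * (n : ℝ) ^ 2 + 1) * u) := mul_le_mul_of_nonneg_right h2 (by positivity)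
    rw [ha]
    linarith
  -- One bucket is a factor `q` wide: lying in the bucket before `b` means `ℓ(z) ≤ -q u`, whereas
  -- the entries of `y` are only bounded below by a polynomial in `n` times `-u`.
  have hell : q * u ≤ -s.ell f z := by
    have : 2 * lm / q ^ (b - 1) = -(q * u) := by
      rw [hu]
      obtain ⟨c, rfl⟩ : ∃ c, b = c + 1 := ⟨b - 1, by omega⟩
      rw [Nat.add_sub_cancel, pow_succ]
      field_simp
    linarith
  -- The value at `V \ z↑` is the value at `(V \ z↑) ∪ {z}` minus `ℓ(z)`, and the former is at least
  -- `-a` because `y` is a base.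
  have h1 := hy.1 (s.ground ∩ s.outsideWith z) Finset.inter_subset_left
  rw [hs.fdown_ideal (hs.isIdeal_outsideWith z)] at h1
  have h2 : -a ≤ ∑ v ∈ s.ground ∩ s.outsideWith z, y v := by
    rw [ha, neg_neg]
    refine le_trans (Finset.sum_le_sum_of_subset_of_nonpos' Finset.inter_subset_left
      (fun _ _ _ => min_le_left _ _)) (Finset.sum_le_sum (fun v _ => min_le_right 0 (y v)))
  have h3 : -∑ v ∈ s.ground ∩ s.outside z, min 0 (y v) ≤ a := by
    rw [ha, neg_le_neg_iff]
    exact Finset.sum_le_sum_of_subset_of_nonpos' Finset.inter_subset_left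
      (fun _ _ _ => min_le_left _ _)
  have h4 : 2 * (k : ℝ) * (s.reps.length : ℝ) ≤ 2 * (K * n) * n := by
    have h5 : (k : ℝ) ≤ K * n := by exact_mod_cast hk
    have h6 : (s.reps.length : ℝ) ≤ n := by exact_mod_cast s.length_reps_le
    have := mul_le_mul h5 h6 (by positivity) (by positivity)
    linarith
  have h5 : -(2 * (k : ℝ) * (s.reps.length : ℝ)) * ∑ u ∈ s.ground ∩ s.outside z, min 0 (y u) ≤
      2 * (K * n) * n * a := by
    calc _ = (2 * (k : ℝ) * (s.reps.length : ℝ)) *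
          (-∑ u ∈ s.ground ∩ s.outside z, min 0 (y u)) := by ring
      _ ≤ (2 * (k : ℝ) * (s.reps.length : ℝ)) * a :=
          mul_le_mul_of_nonneg_left h3 (by positivity)
      _ ≤ _ := mul_le_mul_of_nonneg_right h4 ha0
  -- The threshold is at most `2(Kn)n · a`, and another `a` is lost in the previous estimate. With
  -- `a ≤ n(2n² + 1)u` the requirement is this inequality; the fourth power in `q` makes it hold
  -- with room to spare.
  have h6 : (2 * (K * n) * n + 1 : ℝ) * (n * (2 * (n : ℝ) ^ 2 + 1)) < q := by
    have e1 : (1 : ℝ) ≤ (n : ℝ) ^ 2 := one_le_pow₀ hn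
    have e2 : (2 * (K * n) * n + 1 : ℝ) ≤ 3 * (K * (n : ℝ) ^ 2) := by nlinarith
    have e3 : (n * (2 * (n : ℝ) ^ 2 + 1)) ≤ 3 * (n : ℝ) ^ 3 := by nlinarith
    calc _ ≤ 3 * (K * (n : ℝ) ^ 2) * (3 * (n : ℝ) ^ 3) :=
          mul_le_mul e2 e3 (by positivity) (by positivity)
      _ = 9 * ((K : ℝ) ^ 1 * (n : ℝ) ^ 5) := by ring
      _ ≤ 9 * ((K : ℝ) ^ 4 * (n : ℝ) ^ 8) := by
          refine mul_le_mul_of_nonneg_left ?_ (by norm_num)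
          exact mul_le_mul (pow_le_pow_right₀ hK' (by norm_num))
            (pow_le_pow_right₀ hn (by norm_num)) (by positivity) (by positivity)
      _ < 256 * ((K : ℝ) ^ 4 * (n : ℝ) ^ 8) := by
          have : (0 : ℝ) < (K : ℝ) ^ 4 * (n : ℝ) ^ 8 := by positivity
          linarith
      _ = q := by rw [hq]; ring
  have h7 : (2 * (K * n) * n + 1 : ℝ) * a < q * u := by
    calc _ ≤ (2 * (K * n) * n + 1 : ℝ) * (n * ((2 * (n : ℝ) ^ 2 + 1) * u)) :=
          mul_le_mul_of_nonneg_left ha1 (by positivity)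
      _ = (2 * (K * n) * n + 1 : ℝ) * (n * (2 * (n : ℝ) ^ 2 + 1)) * u := by ring
      _ < q * u := mul_lt_mul_of_pos_right h6 hu0
  have h8 : s.ell f z = s.val f (s.outsideWith z) - s.val f (s.outside z) := rfl
  linarith

theorem combPoint_append (a b : List (Term n)) (v : Fin n) :
    combPoint (a ++ b) v = combPoint a v + combPoint b v := by
  simp [combPoint]

theorem combPoint_runs (EO : ℕ) (V : List (Fin n)) (gs : List (Term n)) :
    (loop gs (fun _ => 0) (fun y e => tab V (fun v => y v + e.coef * e.base v))).Runs f EO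
      (fun y t => (∀ v ∈ V, y v = combPoint gs v) ∧ t = gs.length * (V.length + 1)) := by
  refine Runs.loop (fun pre (y : Vec n) t => (∀ v ∈ V, y v = combPoint pre v) ∧
    t = pre.length * (V.length + 1)) (by simp [combPoint]) ?_
  rintro pre b post - y t ⟨h1, h2⟩
  unfold Runs
  rw [result_tab, time_tab]
  refine ⟨fun v hv => ?_, ?_⟩
  · simp only [combPoint_append, if_pos hv, h1 v hv]
    simp [combPoint]
  · rw [List.length_append, List.length_singleton, Nat.add_one_mul, h2]
    omega

/-- The extension of a combination from `X` to `X ++ rest`. -/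
theorem IsApproxOutput.extend {K : ℕ} {X rest V : List (Fin n)} {g : Finset (Fin n) → ℝ} {δ : ℝ}
    {out : ApproxOutput n} (h : IsApproxOutput K X g δ out)
    (hperm : (X ++ rest).Perm V) {p : Fin n → Prop} [DecidablePred p]
    (hp : ∀ v ∈ V, (p v ↔ v ∈ X)) {ext : Vec n}
    (hext : ∀ v ∈ V, ext v = extremeBase g (X ++ rest) v) :
    let gs := (out.comb.map (fun e : Term n => (⟨e.coef, e.order ++ rest,
      fun v => if v ∈ V then if p v then e.base v else ext v else 0⟩ : Term n))).reverse
    IsCombination V g gs ∧ (∀ v ∈ X, combPoint gs v = combPoint out.comb v) ∧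
      ∀ v ∈ V, v ∉ X → combPoint gs v = ext v := by
  intro gs
  have hXV : ∀ v ∈ X, v ∈ V := fun v hv => hperm.mem_iff.1 (List.mem_append_left _ hv)
  have hcomb : ∀ v, combPoint gs v = (out.comb.map (fun e => e.coef *
      (if v ∈ V then if p v then e.base v else ext v else 0))).sum := by
    intro v
    simp only [gs, combPoint, List.map_reverse, List.sum_reverse, List.map_map]
    rfl
  refine ⟨⟨?_, ?_, ?_, ?_⟩, ?_, ?_⟩
  · intro e he
    simp only [gs, List.mem_reverse, List.mem_map] at he
    obtain ⟨e', he', rfl⟩ := he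
    exact h.coef_nonneg e' he'
  · simp only [gs, List.map_reverse, List.sum_reverse, List.map_map]
    exact h.coef_sum
  · intro e he
    simp only [gs, List.mem_reverse, List.mem_map] at he
    obtain ⟨e', he', rfl⟩ := he
    exact ((h.order_perm e' he').append_right rest).trans hperm
  · intro e he v hv
    simp only [gs, List.mem_reverse, List.mem_map] at he
    obtain ⟨e', he', rfl⟩ := he
    have hpe := h.order_perm e' he'
    simp only [hv, if_true]
    split_ifs with hpv
    · have hvX := (hp v hv).1 hpv
      rw [extremeBase_append_left _ _ (hpe.mem_iff.2 hvX), h.base_eq e' he' v hvX]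
    · have hvX : v ∉ X := fun h => hpv ((hp v hv).2 h)
      -- For an element after `X`, the marginal value depends on `X` as a set and not on the
      -- ordering within `X`. This is why one vector `ext` serves for all bases returned by the
      -- oracle.
      rw [hext v hv, extremeBase_append_right _ _ hvX,
        extremeBase_append_right _ _ (fun h => hvX (hpe.mem_iff.1 h)),
        List.toFinset_eq_of_perm _ _ hpe]
  · intro v hv
    rw [hcomb, combPoint]
    simp [hXV v hv, (hp v (hXV v hv)).2 hv]
  · intro v hv hvX
    have hpv : ¬ p v := fun h => hvX ((hp v hv).1 h)
    rw [hcomb]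
    simp only [hv, hpv, if_true, if_false]
    rw [List.sum_map_mul_right, h.coef_sum, one_mul]

/-- The cost of an iteration apart from the call of the oracle and from new arcs. -/
def iterationCost (K n EO : ℕ) : ℕ :=
  n * n + n * (4 * n + 2 * EO + 1) + n + 1 + (n + 2) * (3 * n + 3) + (3 * n + 2) +
    n * (3 * n + EO + 1) + n + K * n * (2 * n + 1) + K * n * (n + 1) + n * (n + 1) +
    n * (2 * n + EO + 1)

/-- The cost of a new arc. -/
def arcCost (K n EO : ℕ) : ℕ := n ^ 2 + (K * n * (n + 1) + 7 * n + n * (3 * n + EO + 1))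

/-- The test `p` refers to the vector `y` computed once per iteration. That a tested element lies in
every minimizer is a statement about `f`, not about the state, so it survives the other
contractions. -/
theorem contractions_runs (EO : ℕ) (hs : IsReduction f s) (V : List (Fin n)) (p : Fin n → Prop)
    [DecidablePred p] (hV : V.length ≤ n)
    (hp : ∀ v ∈ V, p v → ∀ M, IsMinimizer f M → v ∈ M) :
    (loop V s (fun s' v => if p v ∧ v ∉ s'.T then contractElement s' v else pure s')).Runs f EO
      (fun s' t => IsReduction f s' ∧ s'.le = s.le ∧ s.T ⊆ s'.T ∧
        (∀ v ∈ V, p v → v ∈ s'.T) ∧ t ≤ n * (2 * n + EO + 1)) := by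
  refine (Runs.loop (fun pre s' t => IsReduction f s' ∧ s'.le = s.le ∧ s.T ⊆ s'.T ∧
        (∀ v ∈ pre, p v → v ∈ s'.T) ∧ t ≤ pre.length * (2 * n + EO + 1))
        ⟨hs, rfl, subset_rfl, by simp, by simp⟩ ?_).mono ?_
  · rintro pre b post hpre s₁ t ⟨h1, h2, h3, h4, h5⟩
    have hbV : b ∈ V := by rw [hpre]; simp
    have hlen : (pre ++ [b]).length * (2 * n + EO + 1) =
        pre.length * (2 * n + EO + 1) + (2 * n + EO + 1) := by
      rw [List.length_append, List.length_singleton, Nat.add_one_mul]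
    rw [hlen]
    split_ifs with hcond
    · refine (contractElement_runs EO h1 (hp b hbV hcond.1)).mono ?_
      rintro s₂ t' ⟨k1, k2, k3, k4, k5⟩
      refine ⟨k1, k2.trans h2, h3.trans k3, fun v hv hpv => ?_, by omega⟩
      rcases List.mem_append.1 hv with hv | hv
      · exact k3 (h4 v hv hpv)
      · rw [List.mem_singleton.1 hv]; exact k4
    · refine Runs.pure ⟨h1, h2, h3, fun v hv hpv => ?_, by omega⟩
      rcases List.mem_append.1 hv with hv | hv
      · exact h4 v hv hpv
      · rw [List.mem_singleton.1 hv] at hpv ⊢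
        by_contra hb
        exact hcond ⟨hpv, hb⟩
  · rintro s' t ⟨h1, h2, h3, h4, h5⟩
    exact ⟨h1, h2, h3, h4, h5.trans (Nat.mul_le_mul_right _ hV)⟩

open Classical in
-- Elements that pass the test are distinct sources of new arcs, so there are at most as many of
-- them as new arcs. The cost of an exchange and the cost of closing the digraph are therefore both
-- charged to the increase of the arc count.
theorem treatments_runs (EO : ℕ) (hs : IsReduction f s) (hf : IsSubmodular f) {acc : Access n}
    {ca K : ℕ} (hacc : ∀ l : List (Fin n), l.Perm s.reps → (acc l).Runs f EO
      (fun r t => r = prefixValues (s.fdown (s.negEll f) f) l ∧ t ≤ ca))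
    {gs : List (Term n)} (hgs : IsCombination s.reps (s.fdown (s.negEll f) f) gs)
    (hK : gs.length ≤ K * n)
    {y : Vec n} (hy : ∀ v ∈ s.ground, y v = combPoint gs v) {c : Vec n}
    (hc : ∀ z ∈ s.ground, c z = s.val f (s.outside z) - s.fT) :
    (loop s.reps s.le (fun le₁ z => treatElement s s.reps acc gs y (c z) z le₁)).Runs f EO
      (fun le' t => IsReduction f { s with le := le' } ∧
        (∀ a b, s.le a b = true → le' a b = true) ∧
        (∀ z ∈ s.ground, -(2 * (gs.length : ℝ) * (s.reps.length : ℝ)) *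
          ∑ u ∈ s.ground ∩ s.outside z, min 0 (y u) < s.val f (s.outside z) - s.fT →
            ∃ v, s.le z v = false ∧ le' z v = true) ∧
        t + (n ^ 2 + (K * n * (n + 1) + 7 * n + ca)) * arcCount s.le ≤ n * (n + 1) +
          (n ^ 2 + (K * n * (n + 1) + 7 * n + ca)) * arcCount le') := by
  set fired : Fin n → Prop := fun z => -(2 * (gs.length : ℝ) * (s.reps.length : ℝ)) *
          ∑ u ∈ s.ground ∩ s.outside z, min 0 (y u) < s.val f (s.outside z) - s.fT with hfired
  set C := K * n * (n + 1) + 7 * n + ca with hC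
  refine (Runs.loop (fun pre le' t => IsReduction f { s with le := le' } ∧
      (∀ a b, s.le a b = true → le' a b = true) ∧
      (∀ z ∈ pre, fired z → ∃ v, s.le z v = false ∧ le' z v = true) ∧
      t + n ^ 2 * arcCount s.le ≤ pre.length * (n + 1) + n ^ 2 * arcCount le' +
        (pre.filter (fun z => decide (fired z))).length * C) ⟨hs, by simp, by simp, by simp⟩ ?_).mono ?_
  · rintro pre b post hpre le₁ t ⟨h1, h2, h3, h4⟩
    have hb : b ∈ s.ground := by rw [← mem_reps, hpre]; simp
    have hcb := hc b hb
    refine (treatElement_runs EO hs hf hacc hgs hy hb hcb h1).mono ?_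
    rintro le₂ t' ⟨k1, k2, k3, k4⟩
    rw [hcb] at k3 k4
    refine ⟨k1, fun u v h => k2 u v (h2 u v h), fun z hz hfz => ?_, ?_⟩
    · rcases List.mem_append.1 hz with hz | hz
      · obtain ⟨v, hv, hv'⟩ := h3 z hz hfz
        exact ⟨v, hv, k2 _ _ hv'⟩
      · rw [List.mem_singleton.1 hz] at hfz ⊢
        exact k3 hfz
    · rw [List.length_append, List.length_singleton, List.filter_append, List.length_append,
        Nat.add_one_mul]
      by_cases hfb : fired b
      · rw [if_pos hfb] at k4
        have : gs.length * (n + 1) ≤ K * n * (n + 1) := Nat.mul_le_mul_right _ hK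
        have h5 : ([b].filter (fun z => decide (fired z))).length = 1 := by simp [hfb]
        rw [h5, Nat.add_mul, one_mul]
        omega
      · rw [if_neg hfb] at k4
        have h5 : ([b].filter (fun z => decide (fired z))).length = 0 := by simp [hfb]
        rw [h5]
        simp only [Nat.add_zero]
        omega
  · rintro le' t ⟨h1, h2, h3, h4⟩
    refine ⟨h1, h2, fun z hz => h3 z (mem_reps.2 hz), ?_⟩
    -- The elements that passed are listed without repetition, so their number is a lower bound for
    -- the number of new arcs.
    have hcard := arcCount_add_card_le h2 (s.reps.filter (fun z => decide (fired z))).toFinset (by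
      intro z hz
      rw [List.mem_toFinset, List.mem_filter, decide_eq_true_eq] at hz
      exact h3 z hz.1 hz.2)
    rw [List.toFinset_card_of_nodup (s.nodup_reps.filter _)] at hcard
    have h5 := Nat.mul_le_mul_right C hcard
    have h6 : s.reps.length * (n + 1) ≤ n * (n + 1) := Nat.mul_le_mul_right _ s.length_reps_le
    rw [Nat.add_mul] at h5
    have e1 : (n ^ 2 + C) * arcCount s.le = n ^ 2 * arcCount s.le + arcCount s.le * C := by ring
    have e2 : (n ^ 2 + C) * arcCount le' = n ^ 2 * arcCount le' + arcCount le' * C := by ring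
    omega

end Iteration

/-! ### Correctness and amortized cost of a whole iteration. -/

section Iteration

variable {n : ℕ} {f : Finset (Fin n) → ℝ} {s : State n}

/-- What one iteration of the scheme achieves. -/
def IterationPost (K : ℕ) (A : ApproxAlg) (f : Finset (Fin n) → ℝ) (EO : ℕ) (s : State n)
    (r : Option (State n)) (t : ℕ) : Prop :=
  (r = none ∧ IsMinimizer f s.T ∧ t ≤ iterationCost K n EO) ∨
  ∃ (s' : State n) (X : List (Fin n)) (b : ℕ), r = some s' ∧ IsReduction f s' ∧
    s.T ⊆ s'.T ∧ X ≠ [] ∧ X.Nodup ∧ (∀ v ∈ X, s.isRep v = true) ∧ b ≤ Nat.log 2 n + 2 ∧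
    arcCount s.le ≤ arcCount s'.le ∧
    X.length + 2 * arcCount s.le + n * s.T.card ≤ 2 * arcCount s'.le + n * s'.T.card ∧
    t + arcCost K n EO * arcCount s.le ≤
      (A n X (s.downAccess (s.negEll f))
        (1 / ((4 * ((K : ℝ) * (n : ℝ)) * (n : ℝ)) ^ 4) ^ b)).time f EO +
        iterationCost K n EO + arcCost K n EO * arcCount s'.le

/-- If an element is contracted, `n · |T|` grows by at least `n ≥ |X|`. If none is, every element of
`V^(b-1)` passes the test and contributes an arc, and `|X| ≤ 2|V^(b-1)|`. Either way the potential
`2 · arcs + n · |T|` pays for `|X|`. -/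
theorem iteration_runs {K : ℕ} (hK : 1 ≤ K) {A : ApproxAlg} (hA : A.IsApproxSFM K) (EO : ℕ)
    (hs : IsReduction f s) (hf : IsSubmodular f) :
    (iteration K A s).Runs f EO (IterationPost K A f EO s) := by
  have hVn := s.length_reps_le
  unfold iteration
  refine Runs.bind (P := fun V t => V = s.reps ∧ t = n * n) ⟨by simp [repsT], by simp [repsT]⟩ ?_
  rintro _ _ ⟨rfl, rfl⟩
  refine Runs.bind (s.lowerBounds_runs f EO) ?_
  rintro ⟨c, l⟩ t₁ ⟨hcv, hlv, hm, ht₁⟩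
  simp only at hcv hlv hm
  refine Runs.bind (P := fun r t => r = ∑ v ∈ s.ground, s.negEll f v ∧ t ≤ n) ⟨?_, ?_⟩ ?_
  · rw [result_sumOver, s.sum_map_reps]
    refine Finset.sum_congr rfl (fun v hv => ?_)
    rw [← hm]
  · rwa [time_sumOver]
  rintro _ t₂ ⟨rfl, ht₂⟩
  set lm := ∑ v ∈ s.ground, s.negEll f v with hlm
  refine Runs.bind (Runs.exact _) ?_
  rintro _ _ ⟨-, rfl⟩
  rw [time_tick]
  by_cases hlm0 : lm ≥ 0
  · rw [if_pos hlm0]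
    refine Runs.pure (Or.inl ⟨rfl, hs.isMinimizer_T hf hlm0, ?_⟩)
    unfold iterationCost
    omega
  rw [if_neg hlm0]
  rw [ge_iff_le, not_le] at hlm0
  have hVne : s.ground.Nonempty := by
    rw [Finset.nonempty_iff_ne_empty]
    intro h
    rw [hlm, h] at hlm0
    simp at hlm0
  have hn : 1 ≤ n := hVne.choose.pos
  have hnR : (1 : ℝ) ≤ n := by exact_mod_cast hn
  have hKR : (1 : ℝ) ≤ K := by exact_mod_cast hK
  set q : ℝ := (4 * ((K : ℝ) * (n : ℝ)) * (n : ℝ)) ^ 4 with hq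
  have hKn : (1 : ℝ) ≤ K * n := by nlinarith
  have hq2 : 4 * (n : ℝ) ≤ q := by
    have h1 : (n : ℝ) ≤ K * n * n := by nlinarith
    have h2 : 4 * (n : ℝ) ≤ 4 * (K * n) * n := by linarith
    refine h2.trans ?_
    rw [hq]
    exact le_self_pow₀ (by nlinarith) (by norm_num)
  have hq0 : 0 < q := by linarith
  -- Some element carries at least the average share `lm / |V|` of `ℓ⁻(V)`, and `q ≥ 4n` puts it
  -- into `V^1`.
  have hsmall : ∃ z ∈ s.ground, l z ≤ 2 * lm / q := by
    obtain ⟨z, hz, hz'⟩ := Finset.exists_le_of_sum_le hVne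
      (show ∑ v ∈ s.ground, s.negEll f v ≤ ∑ v ∈ s.ground, lm / s.ground.card by
        rw [Finset.sum_const, nsmul_eq_mul, mul_div_cancel₀]
        exact_mod_cast hVne.card_ne_zero)
    refine ⟨z, hz, ?_⟩
    have hc0 : (0 : ℝ) < s.ground.card := by exact_mod_cast hVne.card_pos
    have hc1 : (s.ground.card : ℝ) ≤ n := by
      have := Finset.card_le_univ s.ground
      rw [Fintype.card_fin] at this
      exact_mod_cast this
    have h3 : lm / s.ground.card ≤ 2 * lm / q := by
      rw [div_le_div_iff₀ hc0 hq0]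
      nlinarith
    have h4 : 2 * lm / q < 0 := div_neg_of_neg_of_pos (by linarith) hq0
    rw [← hm] at hz'
    rcases min_le_iff.1 (hz'.trans h3) with h | h
    · linarith
    · exact h
  -- `V^0` is empty because `ℓ(z) ≥ ℓ⁻(V) > 2 ℓ⁻(V)`, and `V^1` is nonempty by `hsmall`.
  refine Runs.bind (bucketIndex_spec f EO s.reps l lm q hVn ?_ ?_) ?_
  · rw [List.countP_eq_zero]
    intro z hz
    rw [decide_eq_true_eq, pow_zero, div_one, not_le]
    have hz' := mem_reps.1 hz
    have h1 : lm ≤ s.negEll f z :=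
      Finset.sum_le_sum_of_subset_of_nonpos' (s := {z}) (by simpa using hz')
        (fun _ _ _ => s.negEll_nonpos f _) |>.trans (by simp)
    have h2 : s.negEll f z ≤ l z := by
      rw [← hm]; exact min_le_right _ _
    linarith
  · rw [List.countP_pos_iff]
    obtain ⟨z, hz, hz'⟩ := hsmall
    exact ⟨z, mem_reps.2 hz, by simpa using hz'⟩
  rintro b t₃ ⟨hb2, hblog, hbcount, ht₃⟩
  refine Runs.bind (Runs.exact _) ?_
  rintro _ _ ⟨-, rfl⟩
  rw [time_tick]
  set X := s.reps.filter (fun z => decide (l z ≤ 2 * lm / q ^ b)) with hX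
  set rest := s.reps.filter (fun z => !decide (l z ≤ 2 * lm / q ^ b)) with hrest
  rw [hm]
  set g := s.fdown (s.negEll f) f with hg
  set ca := n * (3 * n + EO + 1) with hca
  have hqb : 0 < q ^ b := pow_pos hq0 b
  have hsubm : ∀ Y, IsSubmodularOn Y g := fun Y S _ T _ => hs.fdown_submodular hf S T
  have hg0 : g ∅ = 0 := hs.fdown_empty hVne
  have hacc : ∀ l : List (Fin n), l.Perm s.reps → (s.downAccess (s.negEll f) l).Runs f EO
      (fun r t => r = prefixValues g l ∧ t ≤ ca) := by
    intro l hl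
    refine (s.downAccess_runs _ f EO l (hl.nodup_iff.2 s.nodup_reps)).mono ?_
    rintro r t ⟨h1, h2⟩
    refine ⟨h1, h2.trans (Nat.mul_le_mul_right _ ?_)⟩
    rw [hl.length_eq]; exact hVn
  have hXperm : (X ++ rest).Perm s.reps := by
    simpa [hX, hrest] using
      List.filter_append_perm (fun z => decide (l z ≤ 2 * lm / q ^ b)) s.reps
  have hXmem : ∀ v ∈ s.reps, (l v ≤ 2 * lm / q ^ b ↔ v ∈ X) := by
    intro v hv
    simp [hX, hv]
  have hXnd : X.Nodup := s.nodup_reps.filter _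
  have hXg : X.toFinset ⊆ s.ground := by
    intro v hv
    rw [List.mem_toFinset] at hv
    exact mem_reps.1 (List.mem_of_mem_filter hv)
  have hXlen : X.length ≤ 2 * (s.reps.filter
      (fun z => decide (l z ≤ 2 * lm / q ^ (b - 1)))).length := by
    rw [hX, ← List.countP_eq_length_filter, ← List.countP_eq_length_filter]
    exact hbcount
  have hXne : X ≠ [] := by
    obtain ⟨z, hz, hz'⟩ := hsmall
    refine List.ne_nil_of_mem ((hXmem z (mem_reps.2 hz)).1 (hz'.trans ?_))
    rw [div_le_div_iff₀ hq0 hqb]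
    have : q ≤ q ^ b := le_self_pow₀ (by linarith) (by omega)
    nlinarith
  refine Runs.bind (Runs.exact _) ?_
  rintro out t₄ ⟨hout, ht₄⟩
  -- Only the results of the access procedure matter to the guarantee, so its correctness is taken
  -- with query cost `0`.
  have happ := hA n X (s.downAccess (s.negEll f)) f g (1 / q ^ b) hXnd hXne (hsubm _) hg0
    (fun l hl _ => (s.downAccess_runs _ f 0 l hl).1) (by positivity)
  rw [← hout] at happ
  refine Runs.bind (hacc _ hXperm) ?_
  rintro _ t₅ ⟨rfl, ht₅⟩
  refine Runs.bind (P := fun ext t => (∀ v ∈ s.reps, ext v = extremeBase g (X ++ rest) v) ∧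
    t ≤ n) ⟨fun v hv => ?_, ?_⟩ ?_
  · have := result_marginals g f (hXperm.nodup_iff.2 s.nodup_reps) v
    rwa [hg0, if_pos (hXperm.mem_iff.2 hv)] at this
  · refine (time_marginals_le f EO _ _ _).trans ?_
    rw [hXperm.length_eq]; exact hVn
  rintro ext t₆ ⟨hext, ht₆⟩
  refine Runs.bind (P := fun gs t => gs = (out.comb.map (fun e : Term n => (⟨e.coef,
      e.order ++ rest, fun v => if v ∈ s.reps then if l v ≤ 2 * lm / q ^ b then e.base v
        else ext v else 0⟩ : Term n))).reverse ∧ t ≤ K * n * (2 * n + 1)) ?_ ?_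
  · refine (Runs.loop (fun pre gs t => gs = (pre.map (fun e : Term n => (⟨e.coef,
      e.order ++ rest, fun v => if v ∈ s.reps then if l v ≤ 2 * lm / q ^ b then e.base v
        else ext v else 0⟩ : Term n))).reverse ∧ t ≤ pre.length * (2 * n + 1))
        (by simp) ?_).mono ?_
    · rintro pre e post - r t ⟨rfl, h2⟩
      unfold Runs
      simp only [result_bind, time_bind, result_pure, time_pure, result_tab, time_tab, time_tick]
      refine ⟨by simp, ?_⟩
      rw [List.length_append, List.length_singleton, Nat.add_one_mul]
      omega
    · rintro r t ⟨h1, h2⟩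
      refine ⟨h1, h2.trans (Nat.mul_le_mul_right _ (happ.length_le.trans ?_))⟩
      refine Nat.mul_le_mul_left _ (le_trans ?_ hVn)
      exact List.length_filter_le _ _
  rintro gs t₇ ⟨hgs, ht₇⟩
  have hgslen : gs.length ≤ K * n := by
    rw [hgs, List.length_reverse, List.length_map]
    refine happ.length_le.trans (Nat.mul_le_mul_left _ (le_trans ?_ hVn))
    exact List.length_filter_le _ _
  obtain ⟨hcombn, hyX, hyrest⟩ := happ.extend hXperm hXmem hext
  rw [← hgs] at hcombn hyX hyrest
  refine Runs.bind (combPoint_runs EO s.reps gs) ?_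
  rintro y t₈ ⟨hy, ht₈⟩
  have hy' : ∀ v ∈ s.ground, y v = combPoint gs v := fun v hv => hy v (mem_reps.2 hv)
  have hymem : y ∈ basePolytope s.ground g := by
    have hpt := hcombn.combPoint_mem s.nodup_reps (hsubm _) hg0
    rw [s.toFinset_reps] at hpt
    refine ⟨fun S hS => ?_, ?_⟩
    · rw [Finset.sum_congr rfl (fun v hv => hy' v (hS hv))]
      exact hpt.1 S hS
    · rw [Finset.sum_congr rfl hy']
      exact hpt.2
  refine Runs.bind (treatments_runs EO hs hf hacc hcombn hgslen hy' hcv) ?_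
  rintro le' t₉ ⟨hle', hmono, hfired, ht₉⟩
  have hval : ∀ v ∈ s.reps, y v < 2 * lm * ((2 * (n : ℝ) ^ 2 + 1) / q ^ b) →
      ∀ M, IsMinimizer f M → v ∈ M := by
    intro v hv hyv M hM
    refine hs.mem_minimizer_of_lt hf hymem hXg happ.subset (δ := 1 / q ^ b) (by positivity)
      hlm0.le ?_ ?_ (mem_reps.1 hv) ?_ hM
    · refine happ.approx.trans (le_of_eq ?_)
      congr 1
      refine Finset.sum_congr rfl (fun u hu => ?_)
      rw [hy' u (hXg hu), hyX u (List.mem_toFinset.1 hu)]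
    · intro u hu
      rw [Finset.mem_sdiff, List.mem_toFinset] at hu
      have huV := mem_reps.2 hu.1
      rw [hy' u hu.1, hyrest u huV hu.2, hext u huV]
      have hbase := extremeBase_mem_basePolytope (hsubm s.ground) hg0
        (hXperm.nodup_iff.2 s.nodup_reps)
        (by rw [List.toFinset_eq_of_perm _ _ hXperm, s.toFinset_reps])
      have h1 := basePolytope_lower hbase hu.1
      have h2 := hs.negEll_le_fdown_sub hf hu.1
      have h3 : ¬ l u ≤ 2 * lm / q ^ b := fun h => hu.2 ((hXmem u huV).1 h)
      have h4 : 2 * lm / q ^ b ≤ s.negEll f u := by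
        rw [← hm]
        refine le_min ?_ (not_le.1 h3).le
        exact div_nonpos_of_nonpos_of_nonneg (by linarith) hqb.le
      have h5 : 2 * lm * (1 / q ^ b) = 2 * lm / q ^ b := by ring
      rw [h5]
      linarith
    · refine hyv.trans_le (le_of_eq ?_)
      ring
  refine Runs.bind (contractions_runs EO hle' s.reps
    (fun v => y v < 2 * lm * ((2 * (n : ℝ) ^ 2 + 1) / q ^ b)) hVn hval) ?_
  rintro s' t₁₀ ⟨hs', hs'le, hsT, hcontr, ht₁₀⟩
  simp only at hs'le hsT
  have harc := arcCount_mono hmono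
  refine Runs.pure (Or.inr ⟨s', X, b, rfl, hs', hsT, hXne, hXnd,
    fun v hv => mem_ground.1 (hXg (List.mem_toFinset.2 hv)), hblog, by rwa [hs'le], ?_, ?_⟩)
  · rw [hs'le]
    have hTle := Finset.card_le_card hsT
    -- The two ways of making progress: the contracted set grows, or nothing was contracted and arcs
    -- are new.
    rcases Nat.lt_or_ge s.T.card s'.T.card with hT | hT
    · have h1 : n * (s.T.card + 1) ≤ n * s'.T.card := Nat.mul_le_mul_left _ hT
      have h2 : X.length ≤ n := (List.length_filter_le _ _).trans hVn
      rw [Nat.mul_add_one] at h1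
      omega
    · have hTeq : s'.T = s.T := (Finset.eq_of_subset_of_card_le hsT hT).symm
      have hyv : ∀ v ∈ s.ground, 2 * lm * ((2 * (n : ℝ) ^ 2 + 1) / q ^ b) ≤ y v := by
        intro v hv
        by_contra! hcon
        have := hcontr v (mem_reps.2 hv) hcon
        rw [hTeq] at this
        exact notMem_T_of_mem_ground hv this
      have hcard := arcCount_add_card_le hmono (s.reps.filter
        (fun z => decide (l z ≤ 2 * lm / q ^ (b - 1)))).toFinset (by
          intro z hz
          rw [List.mem_toFinset, List.mem_filter, decide_eq_true_eq] at hz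
          have hzg := mem_reps.1 hz.1
          refine hfired z hzg ?_
          rw [hlv z hzg] at hz
          exact hs.fires hymem hK hq hlm0 hgslen (by omega) hyv hz.2)
      rw [List.toFinset_card_of_nodup (s.nodup_reps.filter _)] at hcard
      rw [hTeq]
      omega
  · rw [hs'le, ← ht₄]
    have h1 : gs.length * (s.reps.length + 1) ≤ K * n * (n + 1) :=
      Nat.mul_le_mul hgslen (by omega)
    have h2 : b ≤ n + 2 := by
      have := Nat.log_le_self 2 n
      omega
    unfold iterationCost arcCost
    rw [hca] at ht₅ ht₉
    omega

end Iteration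

/-! ### The running time of the scheme -/

section Main

variable {n : ℕ} {f : Finset (Fin n) → ℝ}

/-- The oracle takes time at most `a |X| / n` in all calls that the scheme can make. -/
def OracleBound (K : ℕ) (A : ApproxAlg) (f : Finset (Fin n) → ℝ) (EO : ℕ) (a : ℝ) : Prop :=
  ∀ (s : State n) (X : List (Fin n)) (b : ℕ), IsReduction f s → X ≠ [] → X.Nodup →
    (∀ v ∈ X, s.isRep v = true) → b ≤ Nat.log 2 n + 2 →
    (n : ℝ) * ((A n X (s.downAccess (s.negEll f))
      (1 / ((4 * ((K : ℝ) * (n : ℝ)) * (n : ℝ)) ^ 4) ^ b)).time f EO : ℕ) ≤ a * X.length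

/-- The sum of the arc count and `|T|` grows in every nonfinal iteration and is at most `n² + n`, so
the iteration limit is not reached. In the time bound the potentials stand on the left: `a` times `2
· arcs + n · |T|` pays for the oracle, the count of iterations pays for `iterationCost`, and the arc
count for `arcCost`. Everything is multiplied by `n` because `OracleBound` bounds `n` times the time
of a call by `a |X|`. -/
theorem mainLoop_runs {K : ℕ} (hK : 1 ≤ K) {A : ApproxAlg} (hA : A.IsApproxSFM K) (EO : ℕ)
    (hf : IsSubmodular f) (k : ℕ) (s : State n) (hs : IsReduction f s)
    (hk : n ^ 2 + n + 1 ≤ k + (arcCount s.le + s.T.card)) :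
    (mainLoop K A k s).Runs f EO (fun r t => (∃ S, r = some S ∧ IsMinimizer f S) ∧
      ∀ a : ℝ, 0 ≤ a → OracleBound K A f EO a →
        (n : ℝ) * t + a * (2 * arcCount s.le + n * s.T.card) +
          n * iterationCost K n EO * (arcCount s.le + s.T.card) +
          n * arcCost K n EO * arcCount s.le ≤
        a * (3 * n ^ 2) + n * iterationCost K n EO * (n ^ 2 + n + 1) +
          n * arcCost K n EO * n ^ 2) := by
  induction k generalizing s with
  | zero =>
    have h1 := arcCount_le s.le
    have h2 := Finset.card_le_univ s.T
    rw [Fintype.card_fin] at h2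
    omega
  | succ k ih =>
    have h1 := arcCount_le s.le
    have h2 := Finset.card_le_univ s.T
    rw [Fintype.card_fin] at h2
    unfold mainLoop
    refine Runs.bind (iteration_runs hK hA EO hs hf) ?_
    rintro r t (⟨rfl, hmin, ht⟩ | ⟨s', X, b, rfl, hs', hT, hX1, hX2, hX3, hb, harc, hpot, ht⟩)
    · refine Runs.pure ⟨⟨_, rfl, hmin⟩, fun a ha _ => ?_⟩
      have h1' : (arcCount s.le : ℝ) ≤ (n : ℝ) ^ 2 := by exact_mod_cast h1
      have h2' : (s.T.card : ℝ) ≤ n := by exact_mod_cast h2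
      have ht' : (t : ℝ) ≤ iterationCost K n EO := by exact_mod_cast ht
      have hn0 : (0 : ℝ) ≤ n := by positivity
      have e1 : a * (2 * arcCount s.le + n * s.T.card) ≤ a * (3 * (n : ℝ) ^ 2) :=
        mul_le_mul_of_nonneg_left (by nlinarith) ha
      have e2 : (n : ℝ) * iterationCost K n EO * (arcCount s.le + s.T.card) ≤
          n * iterationCost K n EO * (n ^ 2 + n) :=
        mul_le_mul_of_nonneg_left (by linarith) (by positivity)
      have e3 : (n : ℝ) * arcCost K n EO * arcCount s.le ≤ n * arcCost K n EO * n ^ 2 :=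
        mul_le_mul_of_nonneg_left h1' (by positivity)
      have e4 : (n : ℝ) * t ≤ n * iterationCost K n EO := mul_le_mul_of_nonneg_left ht' hn0
      rw [Nat.add_zero]
      linarith
    · have hTc := Finset.card_le_card hT
      have hXl : 1 ≤ X.length := List.length_pos_iff.2 hX1
      -- Both counters are nondecreasing. If neither grew, the potential could not have paid for the
      -- nonempty set `X`.
      have hprog : arcCount s.le + s.T.card + 1 ≤ arcCount s'.le + s'.T.card := by
        by_contra! hcon
        have e1 : arcCount s.le = arcCount s'.le := by omega
        have e2 : s.T.card = s'.T.card := by omega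
        rw [e1, e2] at hpot
        omega
      refine (ih s' hs' (by omega)).mono ?_
      rintro r' t' ⟨hres, htime⟩
      refine ⟨hres, fun a ha hbound => ?_⟩
      have h3 := htime a ha hbound
      have h4 := hbound s X b hs hX1 hX2 hX3 hb
      set τ := (A n X (s.downAccess (s.negEll f))
        (1 / ((4 * ((K : ℝ) * (n : ℝ)) * (n : ℝ)) ^ 4) ^ b)).time f EO
      have h5 : (X.length : ℝ) + 2 * arcCount s.le + n * s.T.card ≤
          2 * arcCount s'.le + n * s'.T.card := by exact_mod_cast hpot
      have h6 : (t : ℝ) + arcCost K n EO * arcCount s.le ≤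
          τ + iterationCost K n EO + arcCost K n EO * arcCount s'.le := by exact_mod_cast ht
      have h7 : (arcCount s.le : ℝ) + s.T.card + 1 ≤ arcCount s'.le + s'.T.card := by
        exact_mod_cast hprog
      have hn0 : (0 : ℝ) ≤ n := by positivity
      have e1 := mul_le_mul_of_nonneg_left h5 ha
      have e2 := mul_le_mul_of_nonneg_left h6 hn0
      have e3 := mul_le_mul_of_nonneg_left h7
        (show (0 : ℝ) ≤ n * iterationCost K n EO by positivity)
      push_cast
      nlinarith

theorem isReduction_init (h0 : f ∅ = 0) :
    IsReduction f (⟨∅, 0, min 0 (f Finset.univ), fun u v => decide (u = v)⟩ : State n) where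
  refl u := by simp
  trans u v w := by simp only [decide_eq_true_eq]; exact Eq.trans
  subset_minimizer M _ := Finset.empty_subset M
  minimizer_closed M _ u v := by simp only [decide_eq_true_eq]; rintro rfl h; exact h
  closed u v := by simp
  fT_eq := h0.symm
  top_eq := by
    rcases min_choice 0 (f Finset.univ) with h | h
    · exact Or.inr ⟨∅, subset_rfl, by rw [h, h0]⟩
    · exact Or.inl h
  top_le_univ := min_le_right _ _
  top_le := min_le_left _ _

theorem iterationCost_le {K n EO : ℕ} (hn : 1 ≤ n) :
    iterationCost K n EO ≤ (41 + 5 * K) * (n ^ 2 + n * EO) := by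
  unfold iterationCost
  obtain ⟨m, rfl⟩ : ∃ m, n = m + 1 := ⟨n - 1, by omega⟩
  ring_nf
  nlinarith [Nat.zero_le (m * EO), Nat.zero_le (m * K), Nat.zero_le (m ^ 2 * K),
    Nat.zero_le (m * EO * K), Nat.zero_le (EO * K), Nat.zero_le (m ^ 2)]

theorem arcCost_le {K n EO : ℕ} (hn : 1 ≤ n) :
    arcCost K n EO ≤ (13 + 2 * K) * (n ^ 2 + n * EO) := by
  unfold arcCost
  obtain ⟨m, rfl⟩ : ∃ m, n = m + 1 := ⟨n - 1, by omega⟩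
  ring_nf
  nlinarith [Nat.zero_le (m * EO), Nat.zero_le (m * K), Nat.zero_le (m ^ 2 * K),
    Nat.zero_le (m * EO * K), Nat.zero_le (EO * K), Nat.zero_le (m ^ 2)]

/-- The scheme returns a minimizer; its running time in terms of that of the oracle. -/
theorem bucketedSFM_runs {K : ℕ} (hK : 1 ≤ K) {A : ApproxAlg} (hA : A.IsApproxSFM K) (EO : ℕ)
    (hf : IsSubmodular f) (h0 : f ∅ = 0) :
    (bucketedSFM K A n).Runs f EO (fun r t => (∃ S, r = some S ∧ IsMinimizer f S) ∧
      (1 ≤ n → ∀ a : ℝ, 0 ≤ a → OracleBound K A f EO a →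
        (t : ℝ) ≤ 3 * n * a + (140 + 17 * K) * ((n : ℝ) ^ 3 * EO + (n : ℝ) ^ 4))) := by
  unfold bucketedSFM
  refine Runs.bind (P := fun r t => r = f Finset.univ ∧ t = EO) ⟨by simp, by simp⟩ ?_
  rintro _ t₀ ⟨rfl, ht₀⟩
  rw [ht₀]
  refine Runs.bind (P := fun _ t => t = n * n + 1) (by simp [Runs]) ?_
  rintro _ _ rfl
  refine (mainLoop_runs hK hA _ hf _ _ (isReduction_init h0) (by omega)).mono ?_
  rintro r t ⟨hres, htime⟩
  refine ⟨hres, fun hn a ha hbound => ?_⟩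
  have h1 := htime a ha hbound
  have hnR : (1 : ℝ) ≤ n := by exact_mod_cast hn
  have hn0 : (0 : ℝ) < n := by linarith
  have hI : (iterationCost K n EO : ℝ) ≤ (41 + 5 * K) * ((n : ℝ) ^ 2 + n * EO) := by
    exact_mod_cast iterationCost_le hn
  have hR : (arcCost K n EO : ℝ) ≤ (13 + 2 * K) * ((n : ℝ) ^ 2 + n * EO) := by
    exact_mod_cast arcCost_le hn
  have h2 : (n : ℝ) * t ≤ n * (3 * n * a + iterationCost K n EO * (n ^ 2 + n + 1) +
      arcCost K n EO * n ^ 2) := by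
    refine le_trans ?_ (h1.trans (le_of_eq (by ring)))
    have e1 : 0 ≤ a * (2 * (arcCount (fun u v : Fin n => decide (u = v)) : ℝ) +
        n * (Finset.card (∅ : Finset (Fin n)) : ℝ)) := by positivity
    have e2 : 0 ≤ (n : ℝ) * iterationCost K n EO *
        ((arcCount (fun u v : Fin n => decide (u = v)) : ℝ) +
          (Finset.card (∅ : Finset (Fin n)) : ℝ)) := by positivity
    have e3 : 0 ≤ (n : ℝ) * arcCost K n EO *
        (arcCount (fun u v : Fin n => decide (u = v)) : ℝ) := by positivity
    linarith
  have h3 := le_of_mul_le_mul_left h2 hn0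
  have hn2 : (1 : ℝ) ≤ (n : ℝ) ^ 2 := one_le_pow₀ hnR
  have hn3 : (1 : ℝ) ≤ (n : ℝ) ^ 3 := one_le_pow₀ hnR
  have hnn : (n : ℝ) ≤ (n : ℝ) ^ 2 := le_self_pow₀ hnR (by norm_num)
  have hn24 : (n : ℝ) ^ 2 ≤ (n : ℝ) ^ 4 := pow_le_pow_right₀ hnR (by norm_num)
  have hEO : (0 : ℝ) ≤ EO := by positivity
  have e1 : (iterationCost K n EO : ℝ) * (n ^ 2 + n + 1) ≤
      (41 + 5 * K) * ((n : ℝ) ^ 2 + n * EO) * (3 * (n : ℝ) ^ 2) :=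
    mul_le_mul hI (by linarith) (by positivity) (by positivity)
  have e2 : (arcCost K n EO : ℝ) * n ^ 2 ≤
      (13 + 2 * K) * ((n : ℝ) ^ 2 + n * EO) * (n : ℝ) ^ 2 :=
    mul_le_mul_of_nonneg_right hR (by positivity)
  have e3 : (EO : ℝ) ≤ (n : ℝ) ^ 3 * EO := le_mul_of_one_le_left hEO hn3
  have e4 : ((n : ℝ) ^ 2 + n * EO) * (n : ℝ) ^ 2 = (n : ℝ) ^ 3 * EO + (n : ℝ) ^ 4 := by ring
  have e5 : (0 : ℝ) ≤ (n : ℝ) ^ 3 * EO := by positivity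
  have e6 : (1 : ℝ) ≤ (n : ℝ) ^ 4 := one_le_pow₀ hnR
  have e7 : ((EO + (n * n + 1 + t) : ℕ) : ℝ) = EO + (n : ℝ) ^ 2 + 1 + t := by push_cast; ring
  rw [e7]
  calc (EO : ℝ) + (n : ℝ) ^ 2 + 1 + t
      ≤ (n : ℝ) ^ 3 * EO + 2 * (n : ℝ) ^ 4 + (3 * n * a +
        (41 + 5 * K) * ((n : ℝ) ^ 2 + n * EO) * (3 * (n : ℝ) ^ 2) +
        (13 + 2 * K) * ((n : ℝ) ^ 2 + n * EO) * (n : ℝ) ^ 2) := by linarith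
    _ = 3 * n * a + (n : ℝ) ^ 3 * EO + 2 * (n : ℝ) ^ 4 +
        (136 + 17 * K) * (((n : ℝ) ^ 2 + n * EO) * (n : ℝ) ^ 2) := by ring
    _ ≤ _ := by rw [e4]; nlinarith

end Main

/-- With `K = 0` the oracle could return no base at all, but the coefficients have to sum to `1`. -/
theorem one_le_of_isApproxSFM {A : ApproxAlg} {K : ℕ} (hA : A.IsApproxSFM K) : 1 ≤ K := by
  by_contra! hK
  have hK0 : K = 0 := by omega
  subst hK0
  have h := hA 1 [0] (fun l => pure (prefixValues (fun _ => 0) l)) (fun _ => 0) (fun _ => 0) 1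
    (by simp) (by simp) (fun S _ T _ => by simp) rfl (fun l _ _ => rfl) one_pos
  have h1 := h.length_le
  have h2 := h.coef_sum
  rw [zero_mul, Nat.le_zero, List.length_eq_zero_iff] at h1
  rw [h1] at h2
  simp at h2

theorem natLog_add_two_le {n : ℕ} (hn : 2 ≤ n) :
    ((Nat.log 2 n + 2 : ℕ) : ℝ) ≤ 5 * Real.log n := by
  have h2 : (0.69 : ℝ) < Real.log 2 := by linarith [Real.log_two_gt_d9]
  have h1 : (2 : ℝ) ^ Nat.log 2 n ≤ n := by exact_mod_cast Nat.pow_log_le_self 2 (by omega)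
  have h3 := Real.log_le_log (by positivity) h1
  rw [Real.log_pow] at h3
  have h4 : Real.log 2 ≤ Real.log n := Real.log_le_log (by norm_num) (by exact_mod_cast hn)
  push_cast
  have h5 : (0 : ℝ) ≤ Nat.log 2 n := by positivity
  nlinarith

/-- The accuracies used by the scheme are at least `n ^ (-C log n)`. -/
theorem bucket_pow_le {K n b : ℕ} (hn : 2 ≤ n) (hb : b ≤ Nat.log 2 n + 2) :
    ((4 * ((K : ℝ) * (n : ℝ)) * (n : ℝ)) ^ 4) ^ b ≤
      (n : ℝ) ^ (((20 * K + 140 : ℕ) : ℝ) * Real.log (n : ℝ)) := by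
  have hnR : (2 : ℝ) ≤ n := by exact_mod_cast hn
  have hn0 : (0 : ℝ) < n := by linarith
  have hK : (K : ℝ) ≤ (n : ℝ) ^ K := by
    have h1 : K ≤ n ^ K := (Nat.lt_pow_self (by omega)).le
    exact_mod_cast h1
  have h1 : 4 * ((K : ℝ) * (n : ℝ)) * (n : ℝ) ≤ (n : ℝ) ^ (K + 4) := by
    calc 4 * ((K : ℝ) * (n : ℝ)) * (n : ℝ) = 2 ^ 2 * (K * (n : ℝ) ^ 2) := by ring
      _ ≤ (n : ℝ) ^ 2 * ((n : ℝ) ^ K * (n : ℝ) ^ 2) := by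
          refine mul_le_mul (pow_le_pow_left₀ (by norm_num) hnR 2) ?_ (by positivity)
            (by positivity)
          exact mul_le_mul_of_nonneg_right hK (by positivity)
      _ = (n : ℝ) ^ (K + 4) := by ring
  have h2 : ((4 * ((K : ℝ) * (n : ℝ)) * (n : ℝ)) ^ 4) ^ b ≤ (n : ℝ) ^ ((K + 4) * 4 * b) := by
    rw [pow_mul, pow_mul]
    exact pow_le_pow_left₀ (by positivity) (pow_le_pow_left₀ (by positivity) h1 4) b
  refine h2.trans ?_
  rw [← Real.rpow_natCast]
  refine Real.rpow_le_rpow_of_exponent_le (by linarith) ?_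
  have h3 : (b : ℝ) ≤ 5 * Real.log n :=
    le_trans (by exact_mod_cast hb) (natLog_add_two_le hn)
  have h4 : 0 ≤ Real.log n := Real.log_nonneg (by linarith)
  push_cast
  have h5 : (0 : ℝ) ≤ K := by positivity
  calc ((K : ℝ) + 4) * 4 * b ≤ (K + 4) * 4 * (5 * Real.log n) :=
        mul_le_mul_of_nonneg_left h3 (by positivity)
    _ ≤ (20 * K + 140) * Real.log n := by nlinarith

/-- Each accuracy `1 / q^b` lies between `n^(-C log n)` and `1`, so each call takes part in the
supremum. Finiteness is required because `toReal` sends `∞` to `0`. -/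
theorem oracleBound_of_AOdown {K : ℕ} (hK : 1 ≤ K) {A : ApproxAlg} {n : ℕ}
    {f : Finset (Fin n) → ℝ} {EO : ℕ} (hn : 2 ≤ n)
    (hAO : AOdown A f EO ((n : ℝ) ^ (-(((20 * K + 140 : ℕ) : ℝ) * Real.log (n : ℝ)))) ≠ ∞) :
    OracleBound K A f EO
      (AOdown A f EO ((n : ℝ) ^ (-(((20 * K + 140 : ℕ) : ℝ) * Real.log (n : ℝ))))).toReal := by
  intro s X b hs hX1 hX2 hX3 hb
  set δ := (n : ℝ) ^ (-(((20 * K + 140 : ℕ) : ℝ) * Real.log (n : ℝ))) with hδ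
  set q : ℝ := (4 * ((K : ℝ) * (n : ℝ)) * (n : ℝ)) ^ 4 with hq
  have hnR : (2 : ℝ) ≤ n := by exact_mod_cast hn
  have hKR : (1 : ℝ) ≤ K := by exact_mod_cast hK
  have hq1 : 1 ≤ q := by
    rw [hq]
    refine one_le_pow₀ ?_
    have : (1 : ℝ) ≤ K * n := by nlinarith
    nlinarith
  have hqb : 1 ≤ q ^ b := one_le_pow₀ hq1
  have hδ1 : δ ≤ 1 / q ^ b := by
    rw [hδ, Real.rpow_neg (by positivity), ← one_div]
    exact one_div_le_one_div_of_le (by linarith) (bucket_pow_le hn hb)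
  have hδ2 : 1 / q ^ b ≤ 1 := by
    rw [div_le_one (by linarith)]; exact hqb
  have hle : (n : ℝ≥0∞) / (X.length : ℝ≥0∞) *
      (((A n X (s.downAccess (s.negEll f)) (1 / q ^ b)).time f EO : ℕ) : ℝ≥0∞) ≤
      AOdown A f EO δ := by
    unfold AOdown
    refine le_iSup_of_le s (le_iSup_of_le hs (le_iSup_of_le X (le_iSup_of_le ⟨hX1, hX2, hX3⟩
      (le_iSup_of_le (1 / q ^ b) (le_iSup_of_le ⟨hδ1, hδ2⟩ le_rfl)))))
  have h2 := ENNReal.toReal_mono hAO hle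
  rw [ENNReal.toReal_mul, ENNReal.toReal_div, ENNReal.toReal_natCast, ENNReal.toReal_natCast,
    ENNReal.toReal_natCast] at h2
  have hX0 : (0 : ℝ) < X.length := by exact_mod_cast List.length_pos_iff.2 hX1
  rw [div_mul_eq_mul_div, div_le_iff₀ hX0] at h2
  exact h2

theorem bucketedSFM_time {K : ℕ} {A : ApproxAlg} (hA : A.IsApproxSFM K) {n : ℕ}
    {f : Finset (Fin n) → ℝ} (hf : IsSubmodular f) (h0 : f ∅ = 0) (EO : ℕ) (hn : 2 ≤ n) :
    (((bucketedSFM K A n).time f EO : ℕ) : ℝ≥0∞) ≤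
      ((20 * K + 140 : ℕ) : ℝ≥0∞) * ((n : ℝ≥0∞) *
        AOdown A f EO ((n : ℝ) ^ (-(((20 * K + 140 : ℕ) : ℝ) * Real.log (n : ℝ)))) +
        (n : ℝ≥0∞) ^ 3 * (EO : ℝ≥0∞) + (n : ℝ≥0∞) ^ 4) := by
  have hK := one_le_of_isApproxSFM hA
  -- An infinite supremum makes the right side infinite, since `n ≥ 2` keeps its coefficient
  -- nonzero.
  by_cases hAO : AOdown A f EO ((n : ℝ) ^ (-(((20 * K + 140 : ℕ) : ℝ) * Real.log (n : ℝ)))) = ∞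
  · rw [hAO, ENNReal.mul_top (by simp; omega), top_add, top_add, ENNReal.mul_top (by simp)]
    exact le_top
  have hbound := oracleBound_of_AOdown hK hn hAO
  obtain ⟨-, h⟩ := bucketedSFM_runs hK hA EO hf h0
  have h1 := h (by omega) _ ENNReal.toReal_nonneg hbound
  set B := AOdown A f EO ((n : ℝ) ^ (-(((20 * K + 140 : ℕ) : ℝ) * Real.log (n : ℝ))))
  rw [← ENNReal.toReal_le_toReal (by simp)]
  · rw [ENNReal.toReal_natCast, ENNReal.toReal_mul, ENNReal.toReal_add, ENNReal.toReal_add,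
      ENNReal.toReal_mul, ENNReal.toReal_mul, ENNReal.toReal_pow, ENNReal.toReal_pow]
    · simp only [ENNReal.toReal_natCast]
      refine h1.trans ?_
      push_cast
      have e1 : (0 : ℝ) ≤ n * B.toReal := by positivity
      have e2 : (0 : ℝ) ≤ (n : ℝ) ^ 3 * EO + (n : ℝ) ^ 4 := by positivity
      have e3 : (0 : ℝ) ≤ K := by positivity
      have e4 := mul_nonneg e3 e1
      have e5 := mul_nonneg e3 e2
      nlinarith
    · exact ENNReal.mul_ne_top (by simp) hAO
    · exact ENNReal.mul_ne_top (by simp) (by simp)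
    · exact ENNReal.add_ne_top.2 ⟨ENNReal.mul_ne_top (by simp) hAO,
        ENNReal.mul_ne_top (by simp) (by simp)⟩
    · simp
  · refine ENNReal.mul_ne_top (ENNReal.natCast_ne_top _) ?_
    refine ENNReal.add_ne_top.2 ⟨ENNReal.add_ne_top.2 ⟨ENNReal.mul_ne_top (by simp) hAO,
        ENNReal.mul_ne_top (by simp) (by simp)⟩, by simp⟩

/-! ### Quadratic forms -/

section Quadratic

open Matrix

variable {ι : Type*}

theorem transpose_eq_of_posSemidef {Q : Matrix ι ι ℝ} (hQ : Q.PosSemidef) : Qᵀ = Q := by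
  simpa [IsHermitian, conjTranspose_eq_transpose_of_trivial] using hQ.isHermitian

theorem one_add_sum_sub_one_le_prod [DecidableEq ι] {s : Finset ι} {e : ι → ℝ} (he : ∀ i ∈ s, 1 ≤ e i) :
    1 + ∑ i ∈ s, (e i - 1) ≤ ∏ i ∈ s, e i := by
  induction s using Finset.induction_on with
  | empty => simp
  | insert a s ha ih =>
    rw [Finset.sum_insert ha, Finset.prod_insert ha]
    have h1 := ih (fun i hi => he i (Finset.mem_insert_of_mem hi))
    have h2 := he a (Finset.mem_insert_self a s)
    have h3 : 0 ≤ ∑ i ∈ s, (e i - 1) :=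
      Finset.sum_nonneg (fun i hi => sub_nonneg.2 (he i (Finset.mem_insert_of_mem hi)))
    nlinarith

variable [Fintype ι]

theorem posSemidef_vecMulVec_smul {c : ℝ} (hc : 0 ≤ c) (g : ι → ℝ) :
    (c • vecMulVec g g).PosSemidef := by
  have := posSemidef_vecMulVec_self_star g
  rw [star_trivial] at this
  exact this.smul hc

/-- The bilinear form of a matrix. -/
def bil (Q : Matrix ι ι ℝ) (x y : ι → ℝ) : ℝ := x ⬝ᵥ Q *ᵥ y

theorem bil_add_left (Q : Matrix ι ι ℝ) (x y z : ι → ℝ) : bil Q (x + y) z = bil Q x z + bil Q y z := by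
  simp [bil, add_dotProduct]

theorem bil_add_right (Q : Matrix ι ι ℝ) (x y z : ι → ℝ) :
    bil Q x (y + z) = bil Q x y + bil Q x z := by
  simp [bil, mulVec_add, dotProduct_add]

theorem bil_smul_left (Q : Matrix ι ι ℝ) (a : ℝ) (x y : ι → ℝ) : bil Q (a • x) y = a * bil Q x y := by
  simp [bil]

theorem bil_smul_right (Q : Matrix ι ι ℝ) (a : ℝ) (x y : ι → ℝ) :
    bil Q x (a • y) = a * bil Q x y := by
  simp [bil, mulVec_smul]

theorem bil_comm {Q : Matrix ι ι ℝ} (hQ : Qᵀ = Q) (x y : ι → ℝ) : bil Q x y = bil Q y x := by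
  rw [bil, bil, dotProduct_comm, dotProduct_mulVec, ← mulVec_transpose, hQ]

theorem bil_add_matrix (Q R : Matrix ι ι ℝ) (x y : ι → ℝ) :
    bil (Q + R) x y = bil Q x y + bil R x y := by
  simp [bil, add_mulVec]

theorem bil_smul_matrix (a : ℝ) (Q : Matrix ι ι ℝ) (x y : ι → ℝ) :
    bil (a • Q) x y = a * bil Q x y := by
  simp [bil, smul_mulVec]

theorem bil_self_nonneg {Q : Matrix ι ι ℝ} (hQ : Q.PosSemidef) (x : ι → ℝ) : 0 ≤ bil Q x x := by
  simpa [bil] using hQ.dotProduct_mulVec_nonneg x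

theorem bil_self_pos {Q : Matrix ι ι ℝ} (hQ : Q.PosDef) {x : ι → ℝ} (hx : x ≠ 0) :
    0 < bil Q x x := by
  simpa [bil] using hQ.dotProduct_mulVec_pos hx

theorem bil_self_eq_zero {Q : Matrix ι ι ℝ} (hQ : Q.PosDef) {x : ι → ℝ} :
    bil Q x x = 0 ↔ x = 0 := by
  refine ⟨fun h => ?_, fun h => by simp [h, bil]⟩
  by_contra hx
  exact (bil_self_pos hQ hx).ne' h

/-- The Cauchy-Schwarz inequality. -/
theorem bil_sq_le {Q : Matrix ι ι ℝ} (hQ : Q.PosSemidef) (x y : ι → ℝ) :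
    bil Q x y ^ 2 ≤ bil Q x x * bil Q y y := by
  have hsymm := transpose_eq_of_posSemidef hQ
  have h := discrim_le_zero (a := bil Q y y) (b := 2 * bil Q x y) (c := bil Q x x) (fun t => by
    have h1 := bil_self_nonneg hQ (x + t • y)
    rw [bil_add_left, bil_add_right, bil_add_right, bil_smul_left, bil_smul_left, bil_smul_right,
      bil_smul_right, bil_comm hsymm y x] at h1
    linarith)
  rw [discrim] at h
  linarith

variable [DecidableEq ι]

/-- `Q` is the inverse of the positive definite matrix `R`. -/
structure IsInvPair (Q R : Matrix ι ι ℝ) : Prop where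
  posDef : R.PosDef
  mul_eq : Q * R = 1

namespace IsInvPair

variable {Q R : Matrix ι ι ℝ}

theorem mul_eq' (h : IsInvPair Q R) : R * Q = 1 := mul_eq_one_comm.1 h.mul_eq

theorem eq_inv (h : IsInvPair Q R) : Q = R⁻¹ := (inv_eq_left_inv h.mul_eq).symm

theorem posDef_left (h : IsInvPair Q R) : Q.PosDef := by
  rw [h.eq_inv]; exact h.posDef.inv

theorem transpose_left (h : IsInvPair Q R) : Qᵀ = Q := transpose_eq_of_posSemidef h.posDef_left.posSemidef

theorem transpose_right (h : IsInvPair Q R) : Rᵀ = R := transpose_eq_of_posSemidef h.posDef.posSemidef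

theorem one : IsInvPair (1 : Matrix ι ι ℝ) 1 := ⟨PosDef.one, by simp⟩

theorem smul (h : IsInvPair Q R) {a b : ℝ} (hb : 0 < b) (hab : a * b = 1) :
    IsInvPair (a • Q) (b • R) := by
  refine ⟨h.posDef.smul hb, ?_⟩
  rw [smul_mul_smul_comm, h.mul_eq, hab, one_smul]

/-- The Sherman-Morrison formula. -/
theorem rankOne (h : IsInvPair Q R) {c : ℝ} (hc : 0 ≤ c) (g : ι → ℝ) :
    IsInvPair (Q - (c / (1 + c * bil Q g g)) • vecMulVec (Q *ᵥ g) (Q *ᵥ g))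
      (R + c • vecMulVec g g) := by
  refine ⟨h.posDef.add_posSemidef (posSemidef_vecMulVec_smul hc g), ?_⟩
  set k := c / (1 + c * bil Q g g) with hk
  have h1 : (Q *ᵥ g) ᵥ* R = g := by
    rw [← mulVec_transpose, h.transpose_right, mulVec_mulVec, h.mul_eq', one_mulVec]
  have h2 : (Q *ᵥ g) ⬝ᵥ g = bil Q g g := by rw [bil, dotProduct_comm]
  have h3 : k * (1 + c * bil Q g g) = c := by
    rw [hk]
    have := bil_self_nonneg h.posDef_left.posSemidef g
    exact div_mul_cancel₀ _ (by positivity)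
  rw [sub_mul, mul_add, mul_add, h.mul_eq, Matrix.mul_smul, mul_vecMulVec, smul_mul, vecMulVec_mul,
    h1, smul_mul, Matrix.mul_smul, vecMulVec_mul_vecMulVec, h2, vecMulVec_smul, smul_smul, smul_smul,
    ← add_smul, add_sub_assoc, ← sub_smul]
  have h4 : c - (k + k * (c * bil Q g g)) = 0 := by linarith
  rw [mul_assoc, h4, zero_smul, add_zero]

/-- Enlarging `R` up to a factor decreases the inverse form up to this factor. -/
theorem bil_le {Q' R' : Matrix ι ι ℝ} (h : IsInvPair Q R) (h' : IsInvPair Q' R') {c : ℝ}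
    (hc : 0 ≤ c) (hle : ∀ x, bil R x x ≤ c * bil R' x x) (g : ι → ℝ) :
    bil Q' g g ≤ c * bil Q g g := by
  set u := Q' *ᵥ g with hu
  have h1 : bil R' u u = bil Q' g g := by
    rw [bil, hu, mulVec_mulVec, h'.mul_eq', one_mulVec, bil, dotProduct_comm]
  have h2 : bil R u (Q *ᵥ g) = bil Q' g g := by
    rw [bil, mulVec_mulVec, h.mul_eq', one_mulVec, hu, bil, dotProduct_comm]
  have h3 : bil R (Q *ᵥ g) (Q *ᵥ g) = bil Q g g := by
    rw [bil, mulVec_mulVec, h.mul_eq', one_mulVec, bil, dotProduct_comm]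
  -- Cauchy-Schwarz for the form of `R`, applied to `Q'g` and `Qg`: the cross term is `‖g‖²` in
  -- `Q'`, and `‖Q'g‖²` in `R` is at most `c` times the same quantity, which is then cancelled.
  have h4 := bil_sq_le h.posDef.posSemidef u (Q *ᵥ g)
  rw [h2, h3] at h4
  have h5 := hle u
  rw [h1] at h5
  have h6 := bil_self_nonneg h.posDef_left.posSemidef g
  have h7 := bil_self_nonneg h'.posDef_left.posSemidef g
  rcases h7.eq_or_lt with h8 | h8
  · rw [← h8]; positivity
  · have h9 : bil Q' g g * bil Q' g g ≤ (c * bil Q g g) * bil Q' g g := by nlinarith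
    exact le_of_mul_le_mul_right h9 h8

end IsInvPair

/-- The eigenvalues of `1 + M` are all at least `1`, and the product of such numbers is at least `1`
plus the sum of their excesses over `1`. -/
theorem one_add_trace_le_det {M : Matrix ι ι ℝ} (hM : M.PosSemidef) :
    1 + M.trace ≤ (1 + M).det := by
  have hP : (1 + M).PosDef := PosDef.one.add_posSemidef hM
  have hH := hP.isHermitian
  rw [hH.det_eq_prod_eigenvalues]
  have htr := hH.trace_eq_sum_eigenvalues
  have he : ∀ i ∈ Finset.univ, 1 ≤ hH.eigenvalues i := by
    intro i _
    rw [hH.eigenvalues_eq]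
    have h1 := hM.dotProduct_mulVec_nonneg (hH.eigenvectorBasis i).ofLp
    have h2 : (star (hH.eigenvectorBasis i).ofLp) ⬝ᵥ (hH.eigenvectorBasis i).ofLp = 1 := by
      have := hH.eigenvectorBasis.orthonormal.1 i
      have h3 : inner ℝ (hH.eigenvectorBasis i) (hH.eigenvectorBasis i) = (1 : ℝ) := by
        rw [real_inner_self_eq_norm_sq, this]; norm_num
      rw [EuclideanSpace.inner_eq_star_dotProduct] at h3
      rwa [dotProduct_comm] at h3
    rw [add_mulVec, one_mulVec, dotProduct_add, h2]
    simpa using h1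
  have h := one_add_sum_sub_one_le_prod he
  rw [Finset.sum_sub_distrib] at h
  simp only [RCLike.ofReal_real_eq_id, id_eq] at htr ⊢
  rw [← htr, trace_add, trace_one] at h
  simp only [Finset.sum_const, Finset.card_univ, nsmul_eq_mul, mul_one] at h
  linarith

/-- Writing `R = BᵀB` reduces to the case of the identity: `R + S = Bᵀ(1 + M)B` with `M` congruent
to `S`, and the trace of `M` equals that of `QS`. -/
theorem IsInvPair.det_add_ge {Q R S : Matrix ι ι ℝ} (h : IsInvPair Q R) (hS : S.PosSemidef) :
    R.det * (1 + (Q * S).trace) ≤ (R + S).det := by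
  obtain ⟨B, hB⟩ : ∃ B : Matrix ι ι ℝ, R = Bᵀ * B := by
    open scoped MatrixOrder in
    obtain ⟨B, hB⟩ := (CStarAlgebra.nonneg_iff_eq_star_mul_self (a := R)).1 h.posDef.posSemidef.nonneg
    exact ⟨B, by rw [hB, star_eq_conjTranspose, conjTranspose_eq_transpose_of_trivial]⟩
  have hdet : R.det = B.det * B.det := by rw [hB, det_mul, det_transpose]
  have hdetB : IsUnit B.det := by
    rw [isUnit_iff_ne_zero]
    intro h0
    have := h.posDef.det_pos
    rw [hdet, h0] at this
    simp at this
  have hBB : B * B⁻¹ = 1 := mul_nonsing_inv B hdetB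
  have hBt : (B⁻¹)ᵀ * Bᵀ = 1 := by rw [← transpose_mul, hBB, transpose_one]
  have hBt' : Bᵀ * (B⁻¹)ᵀ = 1 := mul_eq_one_comm.1 hBt
  have hBB' : B⁻¹ * B = 1 := nonsing_inv_mul B hdetB
  set M := (B⁻¹)ᵀ * S * B⁻¹ with hM
  have hMpsd : M.PosSemidef := by
    have := hS.conjTranspose_mul_mul_same B⁻¹
    rwa [conjTranspose_eq_transpose_of_trivial] at this
  have hsum : R + S = Bᵀ * (1 + M) * B := by
    rw [mul_add, add_mul, mul_one, ← hB, hM]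
    have : Bᵀ * ((B⁻¹)ᵀ * S * B⁻¹) * B = (Bᵀ * (B⁻¹)ᵀ) * S * (B⁻¹ * B) := by
      simp only [Matrix.mul_assoc]
    rw [this, hBt', hBB', one_mul, mul_one]
  have hQ : Q = B⁻¹ * (B⁻¹)ᵀ := by
    rw [h.eq_inv]
    refine inv_eq_left_inv ?_
    rw [hB]
    have : B⁻¹ * (B⁻¹)ᵀ * (Bᵀ * B) = B⁻¹ * ((B⁻¹)ᵀ * Bᵀ) * B := by
      simp only [Matrix.mul_assoc]
    rw [this, hBt, mul_one, hBB']
  have htr : M.trace = (Q * S).trace := by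
    rw [hM, hQ, trace_mul_comm, ← Matrix.mul_assoc]
  rw [← htr, hsum, det_mul, det_mul, det_transpose, hdet]
  have := one_add_trace_le_det hMpsd
  have h2 := mul_self_nonneg B.det
  nlinarith

/-- The arithmetic-geometric mean inequality for the eigenvalues. -/
theorem det_le_trace_div_pow [Nonempty ι] {R : Matrix ι ι ℝ} (hR : R.PosDef) :
    R.det ≤ (R.trace / Fintype.card ι) ^ Fintype.card ι := by
  have hH := hR.isHermitian
  have hm : (0 : ℝ) < Fintype.card ι := by exact_mod_cast Fintype.card_pos
  have h := Real.geom_mean_le_arith_mean Finset.univ (fun _ => 1) hH.eigenvalues (by simp)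
    (by simpa using hm) (fun i _ => (hR.eigenvalues_pos i).le)
  have hdet := hH.det_eq_prod_eigenvalues
  have htr := hH.trace_eq_sum_eigenvalues
  simp only [RCLike.ofReal_real_eq_id, id_eq] at hdet htr
  simp only [Real.rpow_one, Finset.sum_const, Finset.card_univ, nsmul_eq_mul, mul_one,
    one_mul] at h
  rw [← hdet, ← htr] at h
  have hd := hR.det_pos
  have h2 := pow_le_pow_left₀ (by positivity) h (Fintype.card ι)
  rwa [← Real.rpow_natCast (R.det ^ _), ← Real.rpow_mul hd.le, inv_mul_cancel₀ hm.ne',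
    Real.rpow_one] at h2

end Quadratic

/-! ### Histories of rescalings -/

section Chain

open Matrix

variable {n : ℕ}

/-- The restriction of a vector to the coordinates in `X`. -/
def rv (X : List (Fin n)) (x : Vec n) : {v // v ∈ X} → ℝ := fun v => x v

/-- The restriction of a matrix to the coordinates in `X`. -/
def rm (X : List (Fin n)) (Q : Mat n) : Matrix {v // v ∈ X} {v // v ∈ X} ℝ :=
  Matrix.of (fun u v => Q u v)

/-- The matrix `∑ xᵢ / ‖gᵢ‖² gᵢ gᵢᵀ`. -/
def gram (X : List (Fin n)) (terms : List (VNTerm n)) : Matrix {v // v ∈ X} {v // v ∈ X} ℝ :=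
  (terms.map (fun e => (e.coef / e.nrm ^ 2) • vecMulVec (rv X e.gbase) (rv X e.gbase))).sum

/-- The point `∑ xᵢ gᵢ / ‖gᵢ‖`. -/
def vnPoint (X : List (Fin n)) (terms : List (VNTerm n)) : {v // v ∈ X} → ℝ :=
  (terms.map (fun e => (e.coef / e.nrm) • rv X e.gbase)).sum

/-- The outcome of a successful run of the von Neumann algorithm. -/
structure RoundOK (X : List (Fin n)) (ε : ℝ) (r : Round n) : Prop where
  coef_nonneg : ∀ e ∈ r.terms, 0 ≤ e.coef
  nrm_pos : ∀ e ∈ r.terms, 0 < e.nrm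
  nrm_sq : ∀ e ∈ r.terms, e.nrm ^ 2 = bil (rm X r.Q) (rv X e.gbase) (rv X e.gbase)
  coef_sum : (r.terms.map VNTerm.coef).sum = 1
  norm_le : bil (rm X r.Q) (vnPoint X r.terms) (vnPoint X r.terms) ≤ ε ^ 2

/-- `(Q, R)` are the matrices after the rescalings in the list, the last of which comes first. -/
def Chain (X : List (Fin n)) (ε : ℝ) : Mat n → Mat n → List (Round n) → Prop
  | Q, R, [] => rm X Q = 1 ∧ rm X R = 1
  | Q, R, r :: h => IsInvPair (rm X Q) (rm X R) ∧
      rm X R = ((1 + ε) ^ 2)⁻¹ • (rm X r.R + gram X r.terms) ∧ RoundOK X ε r ∧ Chain X ε r.Q r.R h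

variable {X : List (Fin n)} {ε : ℝ}

theorem Chain.isInvPair {Q R : Mat n} {hist : List (Round n)} (h : Chain X ε Q R hist) :
    IsInvPair (rm X Q) (rm X R) := by
  cases hist with
  | nil => rw [h.1, h.2]; exact IsInvPair.one
  | cons r hist => exact h.1

theorem gram_posSemidef {terms : List (VNTerm n)} (h : ∀ e ∈ terms, 0 ≤ e.coef) :
    (gram X terms).PosSemidef := by
  induction terms with
  | nil => exact PosSemidef.zero
  | cons e terms ih =>
    rw [gram, List.map_cons, List.sum_cons]
    refine PosSemidef.add ?_ (ih (fun e he => h e (by simp [he])))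
    exact posSemidef_vecMulVec_smul (div_nonneg (h e (by simp)) (by positivity)) _

theorem trace_mul_gram (Q : Matrix {v // v ∈ X} {v // v ∈ X} ℝ) (terms : List (VNTerm n)) :
    (Q * gram X terms).trace = (terms.map (fun e => e.coef / e.nrm ^ 2 *
      bil Q (rv X e.gbase) (rv X e.gbase))).sum := by
  induction terms with
  | nil => simp [gram]
  | cons e terms ih =>
    simp only [gram, List.map_cons, List.sum_cons] at ih ⊢
    rw [mul_add, trace_add, ih, Matrix.mul_smul, mul_vecMulVec, trace_smul, trace_vecMulVec, bil,
      dotProduct_comm, smul_eq_mul]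

theorem gram_mulVec (terms : List (VNTerm n)) (a : {v // v ∈ X} → ℝ) :
    gram X terms *ᵥ a = (terms.map (fun e => (e.coef / e.nrm ^ 2 * (rv X e.gbase ⬝ᵥ a)) •
      rv X e.gbase)).sum := by
  induction terms with
  | nil => simp [gram]
  | cons e terms ih =>
    simp only [gram, List.map_cons, List.sum_cons] at ih ⊢
    rw [add_mulVec, ih, smul_mulVec, vecMulVec_mulVec, op_smul_eq_smul, smul_smul]

theorem RoundOK.trace_eq_one {r : Round n} (h : RoundOK X ε r) :
    (rm X r.Q * gram X r.terms).trace = 1 := by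
  rw [trace_mul_gram, ← h.coef_sum]
  congr 1
  refine List.map_congr_left (fun e he => ?_)
  rw [← h.nrm_sq e he]
  exact div_mul_cancel₀ _ (pow_pos (h.nrm_pos e he) 2).ne'

theorem bil_le_rescaled {Q R : Mat n} {r : Round n} {h : List (Round n)} (hε : 0 ≤ ε)
    (hc : Chain X ε Q R (r :: h)) (x : {v // v ∈ X} → ℝ) :
    bil (rm X r.R) x x ≤ (1 + ε) ^ 2 * bil (rm X R) x x := by
  obtain ⟨-, hR, hr, -⟩ := hc
  have hg := bil_self_nonneg (gram_posSemidef (X := X) hr.coef_nonneg) x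
  rw [hR, bil_smul_matrix, bil_add_matrix, ← mul_assoc, mul_inv_cancel₀ (by positivity), one_mul]
  linarith

/-- Each rescaling increases the determinant. -/
theorem Chain.det_ge {Q R : Mat n} {hist : List (Round n)} (hε : 0 ≤ ε)
    (h : Chain X ε Q R hist) :
    (2 * (((1 + ε) ^ 2)⁻¹) ^ Fintype.card {v // v ∈ X}) ^ hist.length ≤ (rm X R).det := by
  induction hist generalizing Q R with
  | nil => rw [h.2]; simp
  | cons r hist ih =>
    obtain ⟨-, hR, hr, hc⟩ := h
    have h1 := ih hc
    have h2 := hc.isInvPair.det_add_ge (gram_posSemidef (X := X) hr.coef_nonneg)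
    -- The bases are normalized in the `Q`-norm with coefficients summing to `1`, so the added
    -- matrix has trace `1` relative to `R`. The determinant thus at least doubles before the
    -- scaling.
    rw [hr.trace_eq_one] at h2
    rw [hR, det_smul, List.length_cons, pow_succ]
    have h3 : 0 ≤ (((1 + ε) ^ 2)⁻¹) ^ Fintype.card {v // v ∈ X} := by positivity
    have h4 := mul_le_mul_of_nonneg_left h2 h3
    have h5 := mul_le_mul_of_nonneg_left h1 h3
    nlinarith

/-- The trace is bounded by the ratios of the squared Euclidean norms and the squared `Q`-norms of
the bases. -/
theorem Chain.trace_le {Q R : Mat n} {hist : List (Round n)} (hε : 0 ≤ ε)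
    (h : Chain X ε Q R hist) {D : ℝ} (hD : 0 ≤ D)
    (hb : ∀ r ∈ hist, ∀ e ∈ r.terms, rv X e.gbase ⬝ᵥ rv X e.gbase ≤
      D * bil (rm X Q) (rv X e.gbase) (rv X e.gbase)) :
    (rm X R).trace ≤ Fintype.card {v // v ∈ X} + hist.length * D := by
  induction hist generalizing Q R D with
  | nil => rw [h.2]; simp
  | cons r hist ih =>
    have hle := bil_le_rescaled hε h
    obtain ⟨hQR, hR, hr, hc⟩ := h
    have hε2 : 0 < (1 + ε) ^ 2 := by positivity
    have hQle := hc.isInvPair.bil_le hQR hε2.le hle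
    have hb' : ∀ r' ∈ r :: hist, ∀ e ∈ r'.terms, rv X e.gbase ⬝ᵥ rv X e.gbase ≤
        ((1 + ε) ^ 2 * D) * bil (rm X r.Q) (rv X e.gbase) (rv X e.gbase) := by
      intro r' hr' e he
      refine (hb r' hr' e he).trans ?_
      have := mul_le_mul_of_nonneg_left (hQle (rv X e.gbase)) hD
      linarith
    -- Going back one round can shrink squared `Q`-norms by at most `(1 + ε)²`, so the ratio bound
    -- grows by this factor. The scaling of `R` by `(1 + ε)⁻²` takes it back, and the constant stays
    -- `D` over the whole history.
    have h1 := ih hc (D := (1 + ε) ^ 2 * D) (by positivity)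
      (fun r' hr' => hb' r' (List.mem_cons_of_mem _ hr'))
    have h2 : (gram X r.terms).trace ≤ (1 + ε) ^ 2 * D := by
      have := trace_mul_gram (1 : Matrix {v // v ∈ X} {v // v ∈ X} ℝ) r.terms
      rw [one_mul] at this
      rw [this]
      have h3 : (r.terms.map (fun e => e.coef * ((1 + ε) ^ 2 * D))).sum = (1 + ε) ^ 2 * D := by
        rw [List.sum_map_mul_right, hr.coef_sum, one_mul]
      rw [← h3]
      refine List.sum_le_sum (fun e he => ?_)
      have h4 := hb' r (by simp) e he
      rw [← hr.nrm_sq e he] at h4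
      have h5 := pow_pos (hr.nrm_pos e he) 2
      rw [bil, one_mulVec, div_mul_eq_mul_div, div_le_iff₀ h5]
      have := mul_le_mul_of_nonneg_left h4 (hr.coef_nonneg e he)
      linarith
    rw [hR, trace_smul, trace_add, smul_eq_mul, inv_mul_le_iff₀ hε2, List.length_cons]
    have h6 : (1 : ℝ) ≤ (1 + ε) ^ 2 := one_le_pow₀ (by linarith)
    have h7 : (Fintype.card {v // v ∈ X} : ℝ) ≤ (1 + ε) ^ 2 * Fintype.card {v // v ∈ X} :=
      le_mul_of_one_le_left (by positivity) h6
    push_cast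
    linarith

/-- The power is at most `exp (1/2)`. The choice `ε = 1/(20m)` is made so that the scaling costs at
most a factor `2` in five rounds, out of the `2⁵ = 32` gained. -/
theorem one_add_pow_le_two {m : ℕ} (hm : 1 ≤ m) : (1 + 1 / (20 * (m : ℝ))) ^ (10 * m) ≤ 2 := by
  have hm' : (0 : ℝ) < m := by exact_mod_cast hm
  have h1 := Real.add_one_le_exp (1 / (20 * (m : ℝ)))
  have h2 : (1 + 1 / (20 * (m : ℝ))) ^ (10 * m) ≤ Real.exp (1 / (20 * (m : ℝ))) ^ (10 * m) :=
    pow_le_pow_left₀ (by positivity) (by linarith) _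
  refine h2.trans ?_
  rw [← Real.exp_nat_mul]
  have h3 : ((10 * m : ℕ) : ℝ) * (1 / (20 * (m : ℝ))) = 1 / 2 := by
    push_cast; field_simp; norm_num
  rw [h3]
  have h4 := Real.exp_one_lt_d9
  have h5 : Real.exp (1 / 2) * Real.exp (1 / 2) = Real.exp 1 := by
    rw [← Real.exp_add]; norm_num
  nlinarith [Real.exp_pos (1 / 2)]

/-- After `5 m p` rescalings one of the bases has a small norm. -/
theorem Chain.least_norm_le {Q R : Mat n} {hist : List (Round n)} {m p : ℕ}
    (hm : Fintype.card {v // v ∈ X} = m) (hm1 : 1 ≤ m) (hε : ε = 1 / (20 * (m : ℝ)))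
    (h : Chain X ε Q R hist) (hlen : hist.length = 5 * m * p) {M c : ℝ} (hM : 0 ≤ M) (hc : 0 < c)
    (hgM : ∀ r ∈ hist, ∀ e ∈ r.terms, rv X e.gbase ⬝ᵥ rv X e.gbase ≤ M)
    (hgc : ∀ r ∈ hist, ∀ e ∈ r.terms, c ≤ bil (rm X Q) (rv X e.gbase) (rv X e.gbase)) :
    c * (16 ^ p - 1) ≤ 5 * p * M := by
  have hm' : (0 : ℝ) < m := by exact_mod_cast hm1
  have hε0 : 0 ≤ ε := by rw [hε]; positivity
  have hne : Nonempty {v // v ∈ X} := Fintype.card_pos_iff.1 (by omega)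
  have h1 := h.det_ge hε0
  have h2 := det_le_trace_div_pow h.isInvPair.posDef
  have h3 := h.trace_le hε0 (D := M / c) (by positivity) (fun r hr e he => by
    refine (hgM r hr e he).trans ?_
    rw [div_mul_eq_mul_div, le_div_iff₀ hc]
    exact mul_le_mul_of_nonneg_left (hgc r hr e he) hM)
  rw [hm] at h1 h2 h3
  -- Five rounds multiply the determinant by at least `32 / (1 + ε)^(10m) ≥ 16`, and there are `mp`
  -- groups of five rounds.
  have h4 : (16 ^ p : ℝ) ^ m ≤ (2 * (((1 + ε) ^ 2)⁻¹) ^ m) ^ hist.length := by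
    have h5 : (16 : ℝ) ≤ (2 * (((1 + ε) ^ 2)⁻¹) ^ m) ^ 5 := by
      have h6 : (1 + ε) ^ (10 * m) ≤ 2 := by rw [hε]; exact one_add_pow_le_two hm1
      have h7 : (2 * (((1 + ε) ^ 2)⁻¹) ^ m) ^ 5 = 32 / (1 + ε) ^ (10 * m) := by
        rw [mul_pow, ← pow_mul, inv_pow, ← pow_mul, div_eq_mul_inv]
        congr 1
        · norm_num
        · congr 2; ring
      rw [h7, le_div_iff₀ (by positivity)]
      linarith
    rw [hlen, ← pow_mul, show 5 * m * p = 5 * (p * m) by ring, pow_mul _ 5]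
    exact pow_le_pow_left₀ (by norm_num) h5 _
  have htr : 0 ≤ (rm X R).trace := h.isInvPair.posDef.posSemidef.trace_nonneg
  have h5 := le_of_pow_le_pow_left₀ (by omega) (by positivity) (h4.trans (h1.trans h2))
  rw [le_div_iff₀ hm'] at h5
  rw [hlen] at h3
  push_cast at h3
  have h6 : (16 ^ p : ℝ) * m ≤ (1 + 5 * p * (M / c)) * m := by
    refine (h5.trans h3).trans (le_of_eq ?_)
    ring
  have h7 := le_of_mul_le_mul_right h6 hm'
  have h8 : c * (M / c) = M := mul_div_cancel₀ M hc.ne'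
  have h9 := mul_le_mul_of_nonneg_left h7 hc.le
  nlinarith

/-- Pulling back a vector through a rescaling does not increase its norm. -/
theorem pullBack_bil_le {Q R : Mat n} {r : Round n} {h : List (Round n)} (hε : 0 ≤ ε)
    (hc : Chain X ε Q R (r :: h)) (v u : {v // v ∈ X} → ℝ) {β : ℝ}
    (hu : u = ((1 + ε) ^ 2)⁻¹ • (rm X r.R *ᵥ (rm X Q *ᵥ v)))
    (hβ : ∃ e ∈ r.terms, β = (rv X e.gbase ⬝ᵥ (rm X r.Q *ᵥ u)) / e.nrm) :
    bil (rm X r.Q)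
      (v + (r.terms.map (fun e => (e.coef / e.nrm *
        (β - (rv X e.gbase ⬝ᵥ (rm X r.Q *ᵥ u)) / e.nrm)) • rv X e.gbase)).sum)
      (v + (r.terms.map (fun e => (e.coef / e.nrm *
        (β - (rv X e.gbase ⬝ᵥ (rm X r.Q *ᵥ u)) / e.nrm)) • rv X e.gbase)).sum) ≤
      bil (rm X Q) v v := by
  have hle := bil_le_rescaled hε hc
  obtain ⟨hQR, hR, hr, hch⟩ := hc
  have hin := hch.isInvPair
  set k := ((1 + ε) ^ 2)⁻¹ with hk
  have hk0 : (0 : ℝ) < (1 + ε) ^ 2 := by positivity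
  have hk1 : (1 + ε) ^ 2 * k = 1 := mul_inv_cancel₀ hk0.ne'
  set a := rm X Q *ᵥ v with ha
  have hQu : rm X r.Q *ᵥ u = k • a := by
    rw [hu, mulVec_smul, mulVec_mulVec, hin.mul_eq, one_mulVec]
  -- Since `R'` is the scaled sum of `R` and the Gram matrix, `v = R'(Q'v)` splits into `u` and a
  -- combination of the bases with coefficients proportional to `⟨gᵢ, u⟩`.
  have hv : v = u + (r.terms.map (fun e => (e.coef / e.nrm *
      ((rv X e.gbase ⬝ᵥ (rm X r.Q *ᵥ u)) / e.nrm)) • rv X e.gbase)).sum := by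
    have h1 : v = rm X R *ᵥ a := by rw [ha, mulVec_mulVec, hQR.mul_eq', one_mulVec]
    conv_lhs => rw [h1, hR, smul_mulVec, add_mulVec, smul_add, ← hu, gram_mulVec, List.smul_sum]
    congr 2
    rw [List.map_map]
    refine List.map_congr_left (fun e _ => ?_)
    simp only [Function.comp_apply]
    rw [hQu, dotProduct_smul, smul_smul, smul_eq_mul]
    congr 1
    ring
  -- The weights `νᵢ` are chosen to replace these coefficients by the constant `β`, so that the
  -- bases assemble into the short vector `y` of the von Neumann algorithm. As `|β| ≤ ‖u‖` and `‖y‖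
  -- ≤ ε`, the norm of `u + β y` is at most `(1 + ε)‖u‖`.
  have hnew : v + (r.terms.map (fun e => (e.coef / e.nrm *
        (β - (rv X e.gbase ⬝ᵥ (rm X r.Q *ᵥ u)) / e.nrm)) • rv X e.gbase)).sum =
      u + β • vnPoint X r.terms := by
    conv_lhs => rw [hv, add_assoc, ← List.sum_map_add]
    rw [vnPoint, List.smul_sum, List.map_map]
    congr 3
    ext e : 1
    simp only [Function.comp_apply]
    rw [← add_smul, smul_smul]
    congr 1
    ring
  rw [hnew]
  set y := vnPoint X r.terms
  have hpsd := hin.posDef_left.posSemidef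
  have hU0 := bil_self_nonneg hpsd u
  have hy0 := bil_self_nonneg hpsd y
  set U := bil (rm X r.Q) u u with hU
  -- The scaling compensates for exactly this factor: `(1 + ε)‖u‖` is at most the norm of `v` in
  -- `Q'`.
  have hUle : (1 + ε) ^ 2 * U ≤ bil (rm X Q) v v := by
    have h1 : U = k * k * bil (rm X r.R) a a := by
      rw [hU, bil, hQu, hu, smul_dotProduct, dotProduct_smul, bil, dotProduct_comm]
      simp only [smul_eq_mul]; ring
    have h2 : bil (rm X R) a a = bil (rm X Q) v v := by
      rw [bil, ha, mulVec_mulVec, hQR.mul_eq', one_mulVec, bil, dotProduct_comm]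
    have h3 := hle a
    rw [h2] at h3
    have h4 : (1 + ε) ^ 2 * U = k * bil (rm X r.R) a a := by
      rw [h1]
      calc _ = ((1 + ε) ^ 2 * k) * k * bil (rm X r.R) a a := by ring
        _ = _ := by rw [hk1, one_mul]
    rw [h4]
    calc k * bil (rm X r.R) a a ≤ k * ((1 + ε) ^ 2 * bil (rm X Q) v v) :=
          mul_le_mul_of_nonneg_left h3 (by positivity)
      _ = ((1 + ε) ^ 2 * k) * bil (rm X Q) v v := by ring
      _ = _ := by rw [hk1, one_mul]
  have hβU : β ^ 2 ≤ U := by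
    obtain ⟨e, he, rfl⟩ := hβ
    have h1 := bil_sq_le hpsd (rv X e.gbase) u
    rw [← hr.nrm_sq e he] at h1
    have h2 := pow_pos (hr.nrm_pos e he) 2
    rw [div_pow, div_le_iff₀ h2]
    rw [bil] at h1
    linarith
  have huy := bil_sq_le hpsd u y
  have hcross : β * bil (rm X r.Q) u y ≤ ε * U := by
    refine abs_le_of_sq_le_sq' ?_ (by positivity) |>.2
    rw [mul_pow, mul_pow]
    calc β ^ 2 * bil (rm X r.Q) u y ^ 2 ≤ U * (U * ε ^ 2) := by
          refine mul_le_mul hβU (huy.trans ?_) (by positivity) hU0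
          exact mul_le_mul_of_nonneg_left hr.norm_le hU0
      _ = ε ^ 2 * U ^ 2 := by ring
  have hyy : β ^ 2 * bil (rm X r.Q) y y ≤ U * ε ^ 2 :=
    mul_le_mul hβU hr.norm_le hy0 hU0
  rw [bil_add_left, bil_add_right, bil_add_right, bil_smul_left, bil_smul_left, bil_smul_right,
    bil_smul_right, bil_comm hin.transpose_left y u]
  nlinarith

end Chain

/-! ### Vector programs and restricted vectors -/

section Restricted

open Matrix

variable {n : ℕ} {f : Finset (Fin n) → ℝ} {EO : ℕ} {X : List (Fin n)}

theorem sum_map_eq_sum_subtype (hX : X.Nodup) (F : Fin n → ℝ) :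
    (X.map F).sum = ∑ v : {v // v ∈ X}, F v := by
  rw [← List.sum_toFinset F hX]
  exact Finset.sum_subtype X.toFinset (by simp) F

theorem card_subtype_mem (hX : X.Nodup) : Fintype.card {v // v ∈ X} = X.length := by
  rw [Fintype.card_subtype, ← List.toFinset_card_of_nodup hX]
  congr 1
  ext v
  simp

theorem dot_runs (hX : X.Nodup) (x y : Vec n) :
    (dot X x y).Runs f EO (fun r t => r = rv X x ⬝ᵥ rv X y ∧ t = X.length) := by
  refine ⟨?_, time_dot f EO X x y⟩
  rw [result_dot, sum_map_eq_sum_subtype hX]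
  rfl

theorem matVec_runs (hX : X.Nodup) (Q : Mat n) (x : Vec n) :
    (matVec X Q x).Runs f EO (fun r t => rv X r = rm X Q *ᵥ rv X x ∧
      t = X.length * (X.length + 1)) := by
  refine ⟨?_, time_matVec f EO X Q x⟩
  rw [result_matVec]
  ext u
  simp only [rv, u.2, if_true]
  rw [sum_map_eq_sum_subtype hX]
  rfl

theorem normQ_runs (hX : X.Nodup) (Q : Mat n) (x : Vec n) :
    (normQ X Q x).Runs f EO (fun r t => r = Real.sqrt (bil (rm X Q) (rv X x) (rv X x)) ∧
      t = X.length * (X.length + 1) + X.length + 1) := by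
  refine Runs.bind (matVec_runs hX Q x) ?_
  rintro w _ ⟨hw, rfl⟩
  refine Runs.bind (dot_runs hX x w) ?_
  rintro s _ ⟨rfl, rfl⟩
  refine ⟨?_, ?_⟩
  · simp [hw, bil]
  · simp [add_assoc]

theorem tab_runs (F : Fin n → ℝ) :
    (tab X F).Runs f EO (fun r t => (∀ v ∈ X, r v = F v) ∧ t = X.length) := by
  refine ⟨fun v hv => ?_, time_tab f EO X F⟩
  simp [hv]

theorem tab2_runs (F : Fin n → Fin n → ℝ) :
    (tab2 X F).Runs f EO (fun r t => (∀ u ∈ X, ∀ v ∈ X, r u v = F u v) ∧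
      t = X.length * (X.length + 1)) := by
  refine ⟨fun u hu v hv => ?_, time_tab2 f EO X F⟩
  simp [hu, hv]

theorem argminIndex_runs (qs : List ℝ) (hqs : qs ≠ []) :
    (argminIndex (n := n) qs).Runs f EO (fun i t => i < qs.length ∧
      (∀ q ∈ qs, qs.getD i 0 ≤ q) ∧ t = qs.length) := by
  have hpos : 0 < qs.length := List.length_pos_iff.2 hqs
  refine (Runs.loop (l := List.range qs.length) (fun pre i t => i < qs.length ∧
    (∀ j ∈ pre, qs.getD i 0 ≤ qs.getD j 0) ∧ t = pre.length) (by simpa using hpos) ?_).mono ?_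
  · rintro pre b post hl i t ⟨hi, hle, rfl⟩
    have hb : b < qs.length := List.mem_range.1 (by rw [hl]; simp)
    refine Runs.pure ⟨?_, ?_, by simp⟩
    · split_ifs <;> assumption
    · intro j hj
      rw [List.mem_append, List.mem_singleton] at hj
      split_ifs with h
      · rcases hj with hj | rfl
        · exact h.le.trans (hle j hj)
        · exact le_rfl
      · rcases hj with hj | rfl
        · exact hle j hj
        · exact not_lt.1 h
  · rintro i t ⟨hi, hle, ht⟩
    refine ⟨hi, fun q hq => ?_, by simpa using ht⟩
    obtain ⟨j, hj, rfl⟩ := List.mem_iff_getElem.1 hq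
    have := hle j (List.mem_range.2 hj)
    rwa [List.getD_eq_getElem _ _ hj] at this

end Restricted

/-! ### The enlarged functions -/

section Enlarge

variable {n : ℕ}

/-- The function `g_μ`. -/
def enl (X : Finset (Fin n)) (g : Finset (Fin n) → ℝ) (mu : ℝ) (S : Finset (Fin n)) : ℝ :=
  if S = ∅ ∨ S = X then 0 else g S + mu

theorem enl_empty (X : Finset (Fin n)) (g : Finset (Fin n) → ℝ) (mu : ℝ) : enl X g mu ∅ = 0 := by
  simp [enl]

theorem enl_self (X : Finset (Fin n)) (g : Finset (Fin n) → ℝ) (mu : ℝ) : enl X g mu X = 0 := by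
  simp [enl]

theorem length_enlarge (mu : ℝ) (ps : List ℝ) : (enlarge mu ps).length = ps.length := by
  induction ps with
  | nil => rfl
  | cons p ps ih =>
    cases ps with
    | nil => rfl
    | cons p' ps => simpa [enlarge] using ih

theorem getD_enlarge (mu : ℝ) (ps : List ℝ) (i : ℕ) (hi : i < ps.length) :
    (enlarge mu ps).getD i 0 = if i + 1 = ps.length then 0 else ps.getD i 0 + mu := by
  induction ps generalizing i with
  | nil => simp at hi
  | cons p ps ih =>
    cases ps with
    | nil =>
      have : i = 0 := by simpa using hi
      subst this
      simp [enlarge]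
    | cons p' ps =>
      cases i with
      | zero => simp [enlarge]
      | succ i =>
        have := ih i (by simpa using hi)
        simpa [enlarge] using this

theorem getD_prefixValues (g : Finset (Fin n) → ℝ) (l : List (Fin n)) (i : ℕ) (hi : i < l.length) :
    (prefixValues g l).getD i 0 = g (l.take (i + 1)).toFinset := by
  rw [List.getD_eq_getElem _ _ (by rwa [length_prefixValues])]
  simp [prefixValues]

theorem toFinset_take_eq_iff {X : Finset (Fin n)} {l : List (Fin n)} (hl : l.Nodup)
    (hX : l.toFinset = X) {i : ℕ} (hi : i ≤ l.length) : (l.take i).toFinset = X ↔ i = l.length := by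
  constructor
  · intro h
    have h1 := List.toFinset_card_of_nodup (hl.sublist (List.take_sublist i l))
    have h2 := List.toFinset_card_of_nodup hl
    rw [h, ← hX, h2, List.length_take] at h1
    omega
  · rintro rfl
    simpa using hX

theorem enlarge_prefixValues {X : Finset (Fin n)} (g : Finset (Fin n) → ℝ) (mu : ℝ)
    {l : List (Fin n)} (hl : l.Nodup) (hX : l.toFinset = X) :
    enlarge mu (prefixValues g l) = prefixValues (enl X g mu) l := by
  refine List.ext_getElem (by rw [length_enlarge, length_prefixValues, length_prefixValues]) ?_
  intro i h1 h2
  have hi : i < l.length := by rwa [length_prefixValues] at h2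
  rw [← List.getD_eq_getElem _ 0 h1, ← List.getD_eq_getElem _ 0 h2, getD_prefixValues _ _ _ hi,
    getD_enlarge _ _ _ (by rwa [length_prefixValues]), length_prefixValues,
    getD_prefixValues _ _ _ hi]
  have hne : (l.take (i + 1)).toFinset ≠ ∅ := by
    rw [Ne, List.toFinset_eq_empty_iff, List.take_eq_nil_iff]
    rintro (h | rfl)
    · omega
    · simp at hi
  simp [enl, hne, toFinset_take_eq_iff hl hX (show i + 1 ≤ l.length by omega)]

/-- If the values along an ordering by increasing weight are nonnegative and the last value is zero,
then the weighted sum of the marginal values is nonpositive. -/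
theorem sum_weight_mul_extremeBase_le {a : Fin n} {l : List (Fin n)} (w : Vec n) {M : ℝ}
    (G : Finset (Fin n) → ℝ) (hl : (a :: l).Nodup)
    (hs : (a :: l).Pairwise (fun u v => w u ≤ w v)) (hM : ∀ v ∈ a :: l, w v ≤ M)
    (hG : ∀ p ∈ prefixValues G (a :: l), 0 ≤ p) :
    ((a :: l).map (fun v => w v * extremeBase G (a :: l) v)).sum ≤
      M * G (a :: l).toFinset - w a * G ∅ := by
  induction l generalizing a G with
  | nil =>
    have h1 := hG (G {a}) (by simp [prefixValues])
    have h2 := hM a (by simp)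
    simp only [List.map_cons, List.map_nil, List.sum_cons, List.sum_nil, extremeBase_cons_self]
    simp only [List.toFinset_cons, List.toFinset_nil, insert_empty_eq]
    nlinarith
  | cons b l ih =>
    rw [List.nodup_cons] at hl
    rw [List.pairwise_cons] at hs
    rw [prefixValues_cons] at hG
    have h1 := hG (G {a}) (by simp)
    -- Summation by parts: passing from `w a` to the larger weight `w b` multiplies the nonnegative
    -- prefix value `G {a}` by `w b - w a ≥ 0`.
    have h2 := ih (fun U => G (insert a U)) hl.2 hs.2
      (fun v hv => hM v (List.mem_cons_of_mem _ hv)) (fun p hp => hG p (List.mem_cons_of_mem _ hp))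
    have h3 := hs.1 b (by simp)
    rw [List.map_cons, List.sum_cons, extremeBase_cons_self]
    have h4 : (b :: l).map (fun v => w v * extremeBase G (a :: b :: l) v) =
        (b :: l).map (fun v => w v * extremeBase (fun U => G (insert a U)) (b :: l) v) := by
      refine List.map_congr_left (fun v hv => ?_)
      rw [extremeBase_cons_of_ne]
      rintro rfl
      exact hl.1 hv
    rw [h4]
    simp only [insert_empty_eq] at h2
    rw [List.toFinset_cons (a := a)]
    nlinarith

/-- The base for an ordering that lists `W` first has sum `g W` on `W` and `g X - g W` on the rest,
and the norm is at least the second sum minus the first. -/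
theorem neg_two_mul_add_le_complexityL {X : Finset (Fin n)} {g : Finset (Fin n) → ℝ}
    (hg : IsSubmodularOn X g) (h0 : g ∅ = 0) {W : Finset (Fin n)} (hW : W ⊆ X) :
    -2 * g W + g X ≤ complexityL X g := by
  set l := W.toList ++ (X \ W).toList with hl
  have hnd : l.Nodup := by
    rw [hl, List.nodup_append]
    refine ⟨W.nodup_toList, (X \ W).nodup_toList, ?_⟩
    rintro u hu v hv rfl
    simp at hu hv
    exact hv.2 hu
  have hX : l.toFinset = X := by
    ext v
    simp only [hl, List.mem_toFinset, List.mem_append, Finset.mem_toList, Finset.mem_sdiff]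
    constructor
    · rintro (h | h)
      · exact hW h
      · exact h.1
    · intro h
      by_cases hv : v ∈ W
      · exact Or.inl hv
      · exact Or.inr ⟨h, hv⟩
  have hz := extremeBase_mem_basePolytope hg h0 hnd hX
  have h1 := le_complexityL hz
  have h2 : ∑ v ∈ W, extremeBase g l v = g W := by
    have := sum_extremeBase g W.nodup_toList
    rw [Finset.toList_toFinset, h0, sub_zero] at this
    rw [← this]
    refine Finset.sum_congr rfl (fun v hv => ?_)
    rw [hl, extremeBase_append_left]
    simpa using hv
  have h3 := Finset.sum_sdiff (f := extremeBase g l) hW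
  have h4 := Finset.sum_sdiff (f := fun v => |extremeBase g l v|) hW
  have h5 := hz.2
  have h6 : -∑ v ∈ W, extremeBase g l v ≤ ∑ v ∈ W, |extremeBase g l v| := by
    rw [← Finset.sum_neg_distrib]
    exact Finset.sum_le_sum (fun v _ => neg_le_abs _)
  have h7 : ∑ v ∈ X \ W, extremeBase g l v ≤ ∑ v ∈ X \ W, |extremeBase g l v| :=
    Finset.sum_le_sum (fun v _ => le_abs_self _)
  linarith

end Enlarge

/-! ### Bases used by the von Neumann algorithm -/

section ValidTerm

variable {n : ℕ}

/-- The properties of a base used by the von Neumann algorithm, where `mu` is the present value of the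
parameter. -/
structure ValidTerm (X : List (Fin n)) (g : Finset (Fin n) → ℝ) (mu : ℝ) (e : VNTerm n) : Prop where
  order_perm : e.order.Perm X
  base_eq : ∀ v ∈ X, e.base v = extremeBase g e.order v
  exists_shift : ∃ r : Vec n, (∀ v ∈ X, 0 ≤ r v) ∧ ∑ v ∈ X.toFinset, r v ≤ mu ∧
    ∀ v ∈ X, e.gbase v - r v ≤ e.base v
  sum_gbase : ∑ v ∈ X.toFinset, e.gbase v = 0
  sum_abs_gbase : ∑ v ∈ X.toFinset, |e.gbase v| ≤ 2 * complexityL X.toFinset g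

theorem ValidTerm.mono {X : List (Fin n)} {g : Finset (Fin n) → ℝ} {mu mu' : ℝ} {e : VNTerm n}
    (h : ValidTerm X g mu e) (hmu : mu ≤ mu') : ValidTerm X g mu' e := by
  obtain ⟨r, h0, hr, hv⟩ := h.exists_shift
  exact ⟨h.order_perm, h.base_eq, ⟨r, h0, hr.trans hmu, hv⟩, h.sum_gbase, h.sum_abs_gbase⟩

/-- `mu` is the parameter that belongs to the set `W`. -/
structure MuOK (X : List (Fin n)) (g : Finset (Fin n) → ℝ) (mu : ℝ) (W : Finset (Fin n)) : Prop where
  nonneg : 0 ≤ mu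
  univ : -g X.toFinset ≤ mu
  subset : W ⊆ X.toFinset
  eq_neg : mu = -g W

/-- Since `g_μ ≤ g + μ` everywhere and equality holds at proper nonempty sets, the marginal values
of `g_μ` exceed those of `g` by at most `μ` at the first element and not at all later. The shift is
thus concentrated on one coordinate. Only `r(X) ≤ μ` is recorded, so a base stays usable when
sliding increases `μ` (`ValidTerm.mono`). -/
theorem validTerm_mk {X : List (Fin n)} {g : Finset (Fin n) → ℝ} (hX : X.Nodup) (hne : X ≠ [])
    (hg : IsSubmodularOn X.toFinset g) (h0 : g ∅ = 0) {mu : ℝ} {W : Finset (Fin n)}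
    (hmu : MuOK X g mu W) {e : VNTerm n} (hp : e.order.Perm X)
    (hb : ∀ v ∈ X, e.base v = extremeBase g e.order v)
    (hgb : ∀ v ∈ X, e.gbase v = extremeBase (enl X.toFinset g mu) e.order v) :
    ValidTerm X g mu e := by
  have hnd : e.order.Nodup := hp.nodup_iff.2 hX
  have htf : e.order.toFinset = X.toFinset := List.toFinset_eq_of_perm _ _ hp
  have hne' : e.order ≠ [] := fun h => hne (by simpa [h] using hp.symm)
  obtain ⟨a, l, hal⟩ := List.exists_cons_of_ne_nil hne'
  have haX : a ∈ X := hp.mem_iff.1 (by rw [hal]; simp)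
  have hle : ∀ S, enl X.toFinset g mu S ≤ g S + mu := by
    intro S
    rw [enl]
    split_ifs with h
    · rcases h with rfl | rfl
      · rw [h0]; linarith [hmu.nonneg]
      · linarith [hmu.univ]
    · exact le_rfl
  have hsum : ∑ v ∈ X.toFinset, e.gbase v = 0 := by
    rw [Finset.sum_congr rfl (fun v hv => hgb v (List.mem_toFinset.1 hv)), ← htf,
      sum_extremeBase _ hnd, htf, enl_empty, enl_self, sub_zero]
  have hshift : ∀ v ∈ X, e.gbase v - (if v = a then mu else 0) ≤ e.base v := by
    intro v hv
    have hv' : v ∈ e.order := hp.mem_iff.2 hv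
    rw [hgb v hv, hb v hv, extremeBase, extremeBase]
    have h1 := hle (e.order.take (e.order.idxOf v + 1)).toFinset
    split_ifs with h
    · have h2 : e.order.idxOf v = 0 := by rw [hal, h]; simp
      simp only [h2, List.take_zero, List.toFinset_nil, enl_empty, h0] at h1 ⊢
      linarith
    · have hi := List.idxOf_lt_length_of_mem hv'
      have h2 : e.order.idxOf v ≠ 0 := by
        rw [hal, List.idxOf_cons_ne _ (Ne.symm h)]
        omega
      have h3 : (e.order.take (e.order.idxOf v)).toFinset ≠ ∅ := by
        rw [Ne, List.toFinset_eq_empty_iff, List.take_eq_nil_iff, not_or]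
        exact ⟨h2, hne'⟩
      have h4 : (e.order.take (e.order.idxOf v)).toFinset ≠ X.toFinset := by
        rw [Ne, toFinset_take_eq_iff hnd htf hi.le]
        omega
      have h5 : enl X.toFinset g mu (e.order.take (e.order.idxOf v)).toFinset =
          g (e.order.take (e.order.idxOf v)).toFinset + mu := by
        simp [enl, h3, h4]
      rw [h5]
      linarith
  refine ⟨hp, hb, ⟨fun v => if v = a then mu else 0, ?_, ?_, hshift⟩, hsum, ?_⟩
  · intro v _
    simp only
    split_ifs
    exacts [hmu.nonneg, le_rfl]
  · rw [Finset.sum_ite_eq' X.toFinset a (fun _ => mu)]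
    simp [haX]
  · have hz := extremeBase_mem_basePolytope hg h0 hnd htf
    have h1 := le_complexityL hz
    have h2 := neg_two_mul_add_le_complexityL hg h0 hmu.subset
    -- The positive part of `gbase - base` is at most the shift, so its absolute value is at most
    -- twice the shift minus the difference itself. After summation the excess over `‖base‖₁` is at
    -- most `2μ + g(X) = -2g(W) + g(X)`, which is at most `L`.
    have h3 : ∀ v ∈ X.toFinset, |e.gbase v| ≤ |extremeBase g e.order v| +
        (2 * (if v = a then mu else 0) - (e.gbase v - e.base v)) := by
      intro v hv
      have hv' := List.mem_toFinset.1 hv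
      have h4 := hshift v hv'
      have h5 : 0 ≤ (if v = a then mu else 0) := by
        split_ifs
        exacts [hmu.nonneg, le_rfl]
      rw [← hb v hv']
      set r := (if v = a then mu else 0)
      rcases abs_cases (e.gbase v) with h | h <;> rcases abs_cases (e.base v) with h' | h' <;>
        linarith
    refine (Finset.sum_le_sum h3).trans ?_
    rw [Finset.sum_add_distrib, Finset.sum_sub_distrib, Finset.sum_sub_distrib, hsum,
      ← Finset.mul_sum, Finset.sum_ite_eq' X.toFinset a (fun _ => mu),
      Finset.sum_congr rfl (fun v hv => hb v (List.mem_toFinset.1 hv)), hz.2]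
    simp only [List.mem_toFinset, haX, if_true]
    have := hmu.eq_neg
    linarith

/-- A convex combination of the bases that almost vanishes proves that `W` is an approximate
minimizer. -/
theorem approx_of_sum_abs_le {X : List (Fin n)} {g : Finset (Fin n) → ℝ} {mu δ : ℝ}
    {W : Finset (Fin n)} (hmu : mu = -g W) {wts : List (VNTerm n × ℝ)}
    (hv : ∀ w ∈ wts, ValidTerm X g mu w.1) (h0 : ∀ w ∈ wts, 0 ≤ w.2)
    (h1 : (wts.map Prod.snd).sum = 1)
    (hle : ∑ v ∈ X.toFinset, |(wts.map (fun w => w.2 * w.1.gbase v)).sum| ≤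
      2 * (δ * complexityL X.toFinset g)) :
    g W ≤ ∑ v ∈ X.toFinset, min 0 (wts.map (fun w => w.2 * w.1.base v)).sum +
      δ * complexityL X.toFinset g := by
  -- The shifts of the individual bases combine with the weights into one shift of total mass at
  -- most the total weight times `μ`.
  have key : ∃ r : Vec n, (∀ v ∈ X, 0 ≤ r v) ∧
      ∑ v ∈ X.toFinset, r v ≤ (wts.map Prod.snd).sum * mu ∧
      (∀ v ∈ X, (wts.map (fun w => w.2 * w.1.gbase v)).sum - r v ≤
        (wts.map (fun w => w.2 * w.1.base v)).sum) ∧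
      ∑ v ∈ X.toFinset, (wts.map (fun w => w.2 * w.1.gbase v)).sum = 0 := by
    clear hle h1
    induction wts with
    | nil => exact ⟨fun _ => 0, by simp⟩
    | cons w wts ih =>
      obtain ⟨r, hr0, hr1, hr2, hr3⟩ := ih (fun w hw => hv w (by simp [hw]))
        (fun w hw => h0 w (by simp [hw]))
      obtain ⟨r', h0', h1', h2'⟩ := (hv w (by simp)).exists_shift
      have hw := h0 w (by simp)
      refine ⟨fun v => w.2 * r' v + r v, fun v hvX => ?_, ?_, fun v hvX => ?_, ?_⟩
      · exact add_nonneg (mul_nonneg hw (h0' v hvX)) (hr0 v hvX)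
      · rw [Finset.sum_add_distrib, ← Finset.mul_sum, List.map_cons, List.sum_cons, add_mul]
        exact add_le_add (mul_le_mul_of_nonneg_left h1' hw) hr1
      · simp only [List.map_cons, List.sum_cons]
        have h3 := mul_le_mul_of_nonneg_left (h2' v hvX) hw
        have h4 := hr2 v hvX
        linarith
      · simp only [List.map_cons, List.sum_cons]
        rw [Finset.sum_add_distrib, hr3, ← Finset.mul_sum, (hv w (by simp)).sum_gbase]
        simp
  obtain ⟨r, hr0, hr1, hr2, hr3⟩ := key
  rw [h1, one_mul, hmu] at hr1
  -- The combination of the `gbase` has coordinate sum zero, so its negative part is minus half its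
  -- norm, which is at least `-δL`. Subtracting the shift costs at most `μ = -g W` more.
  have h2 : ∀ v ∈ X.toFinset, ((wts.map (fun w => w.2 * w.1.gbase v)).sum -
      |(wts.map (fun w => w.2 * w.1.gbase v)).sum|) / 2 - r v ≤
      min 0 (wts.map (fun w => w.2 * w.1.base v)).sum := by
    intro v hvX
    have h3 := hr2 v (List.mem_toFinset.1 hvX)
    have h4 := hr0 v (List.mem_toFinset.1 hvX)
    have h5 := neg_abs_le (wts.map (fun w => w.2 * w.1.gbase v)).sum
    have h6 := le_abs_self (wts.map (fun w => w.2 * w.1.gbase v)).sum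
    refine le_min ?_ ?_ <;> linarith
  have h3 := Finset.sum_le_sum h2
  rw [Finset.sum_sub_distrib, ← Finset.sum_div, Finset.sum_sub_distrib, hr3] at h3
  linarith

end ValidTerm

/-! ### The sliding von Neumann algorithm -/

section VonNeumann

open Matrix

variable {n : ℕ} {f g : Finset (Fin n) → ℝ} {EO ca : ℕ} {X : List (Fin n)}

theorem marginals_runs {G : Finset (Fin n) → ℝ} (h0 : G ∅ = 0) {l : List (Fin n)} (hl : l.Nodup) :
    (marginals l (prefixValues G l) 0).Runs f EO (fun r t =>
      (∀ v ∈ l, r v = extremeBase G l v) ∧ t ≤ l.length) := by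
  refine ⟨fun v hv => ?_, time_marginals_le f EO l _ _⟩
  have := result_marginals G f hl v
  rwa [h0, if_pos hv] at this

/-- The normalization of `g_μ` to `0` at both the empty and the full set makes the boundary terms of
the summation by parts vanish. -/
theorem dotProduct_extremeBase_nonpos (hX : X.Nodup) (hne : X ≠ []) {mu : ℝ} {l : List (Fin n)}
    (hp : l.Perm X) {w x : Vec n} (hs : l.Pairwise (fun u v => w u ≤ w v))
    (hx : ∀ v ∈ X, x v = extremeBase (enl X.toFinset g mu) l v)
    (h : ∀ q ∈ prefixValues (enl X.toFinset g mu) l, 0 ≤ q) :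
    rv X w ⬝ᵥ rv X x ≤ 0 := by
  have htf : l.toFinset = X.toFinset := List.toFinset_eq_of_perm _ _ hp
  have hnd : l.Nodup := hp.nodup_iff.2 hX
  have hne' : l ≠ [] := fun h => hne (by simpa [h] using hp.symm)
  have h1 : rv X w ⬝ᵥ rv X x = (l.map (fun v => w v * extremeBase (enl X.toFinset g mu) l v)).sum := by
    have h2 : (l.map (fun v => w v * extremeBase (enl X.toFinset g mu) l v)).sum =
        (X.map (fun v => w v * x v)).sum := by
      rw [(hp.map _).sum_eq]
      congr 1
      exact List.map_congr_left (fun v hv => by rw [hx v hv])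
    rw [h2, sum_map_eq_sum_subtype hX]
    rfl
  rw [h1]
  obtain ⟨a, l', rfl⟩ := List.exists_cons_of_ne_nil hne'
  -- Any upper bound for the weights will do, because it is multiplied by the value `0` at the full
  -- set.
  obtain ⟨M, hM⟩ : ∃ M, ∀ v ∈ a :: l', w v ≤ M := by
    refine ⟨∑ v : Fin n, |w v|, fun v _ => (le_abs_self _).trans ?_⟩
    exact Finset.single_le_sum (f := fun v => |w v|) (fun v _ => abs_nonneg _) (Finset.mem_univ v)
  have h3 := sum_weight_mul_extremeBase_le w _ hnd hs hM h
  rw [htf, enl_self, enl_empty] at h3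
  simpa using h3

/-- The choice of the parameter by sliding. -/
theorem slide (hX : X.Nodup) (hne : X ≠ []) {mu : ℝ} {W : Finset (Fin n)} (hmu : MuOK X g mu W)
    {l : List (Fin n)} (hp : l.Perm X) {w x : Vec n} (hs : l.Pairwise (fun u v => w u ≤ w v))
    (hx : ∀ v ∈ X, x v = extremeBase (enl X.toFinset g mu) l v) {i : ℕ} (hi : i < l.length)
    (hmin : ∀ q ∈ enlarge mu (prefixValues g l), (enlarge mu (prefixValues g l)).getD i 0 ≤ q)
    {mu' : ℝ} {W' : Finset (Fin n)}
    (hmu' : mu' = if 0 < rv X w ⬝ᵥ rv X x then -((prefixValues g l).getD i 0) else mu)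
    (hW' : W' = if 0 < rv X w ⬝ᵥ rv X x then (l.take (i + 1)).toFinset else W) :
    MuOK X g mu' W' ∧ mu ≤ mu' ∧
      ∀ z : Vec n, (∀ v ∈ X, z v = extremeBase (enl X.toFinset g mu') l v) →
        rv X w ⬝ᵥ rv X z ≤ 0 := by
  have htf : l.toFinset = X.toFinset := List.toFinset_eq_of_perm _ _ hp
  have hnd : l.Nodup := hp.nodup_iff.2 hX
  by_cases hip : 0 < rv X w ⬝ᵥ rv X x
  · rw [if_pos hip] at hmu' hW'
    -- A positive inner product is impossible if all prefix values are nonnegative, so sliding takes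
    -- place only at a negative value of `g_μ`.
    have hex : ∃ q ∈ enlarge mu (prefixValues g l), q < 0 := by
      by_contra hcon
      push Not at hcon
      rw [enlarge_prefixValues g mu hnd htf] at hcon
      exact absurd (dotProduct_extremeBase_nonpos hX hne hp hs hx hcon) (not_le.2 hip)
    obtain ⟨q, hq, hq0⟩ := hex
    have h1 := (hmin q hq).trans_lt hq0
    have hlen := length_prefixValues g l
    rw [getD_enlarge _ _ _ (by omega)] at h1
    -- The minimum is not attained at the full set, where the enlarged value is `0`. Hence the least
    -- value is `g(W') + μ < 0`, and the new parameter `-g(W')` is strictly larger.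
    split_ifs at h1 with hlast
    · exact absurd h1 (lt_irrefl _)
    have hlt : mu < mu' := by rw [hmu']; linarith
    refine ⟨⟨hmu.nonneg.trans hlt.le, hmu.univ.trans hlt.le, ?_, ?_⟩, hlt.le, ?_⟩
    · rw [hW', ← htf]
      intro v hv
      exact List.mem_toFinset.2 (List.mem_of_mem_take (List.mem_toFinset.1 hv))
    · rw [hmu', hW', getD_prefixValues _ _ _ hi]
    · intro z hz
      refine dotProduct_extremeBase_nonpos hX hne hp hs hz ?_
      rw [← enlarge_prefixValues g mu' hnd htf]
      intro p hp
      obtain ⟨j, hj, rfl⟩ := List.mem_iff_getElem.1 hp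
      rw [length_enlarge] at hj
      rw [← List.getD_eq_getElem _ 0, getD_enlarge _ _ _ hj]
      split_ifs with hjl
      · exact le_rfl
      · have h2 := hmin ((enlarge mu (prefixValues g l)).getD j 0) (by
          rw [List.getD_eq_getElem _ _ (by rwa [length_enlarge])]
          exact List.getElem_mem _)
        rw [getD_enlarge _ _ _ hj, getD_enlarge _ _ _ (by omega), if_neg hlast, if_neg hjl] at h2
        rw [hmu']
        linarith
  · rw [if_neg hip] at hmu' hW'
    subst hmu' hW'
    refine ⟨hmu, le_rfl, fun z hz => ?_⟩
    have : rv X z = rv X x := by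
      ext v
      exact (hz v v.2).trans (hx v v.2).symm
    rw [this]
    exact not_lt.1 hip

/-- In terms of `a = ‖y‖²`, `b = ⟨y, z⟩ ≤ 0` and `c = ‖z‖² ≤ 1`, the least squared norm on the
segment `[y, z]` is `(ac - b²)/(a - 2b + c)`. The bound `a/(a + 1)` says that `1/‖y‖²` grows by at
least `1`. -/
theorem vonNeumann_step_le {a b c : ℝ} (ha : 0 < a) (hb : b ≤ 0) (hc0 : 0 ≤ c) (hc1 : c ≤ 1) :
    0 ≤ (a - b) / (a - 2 * b + c) ∧ (a - b) / (a - 2 * b + c) ≤ 1 ∧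
      (1 - (a - b) / (a - 2 * b + c)) ^ 2 * a +
        2 * ((1 - (a - b) / (a - 2 * b + c)) * ((a - b) / (a - 2 * b + c))) * b +
        ((a - b) / (a - 2 * b + c)) ^ 2 * c ≤ a / (a + 1) := by
  have hD : 0 < a - 2 * b + c := by linarith
  refine ⟨div_nonneg (by linarith) hD.le, (div_le_one hD).2 (by linarith), ?_⟩
  have h2 : (a - b) / (a - 2 * b + c) * (a - 2 * b + c) = a - b := div_mul_cancel₀ _ hD.ne'
  generalize (a - b) / (a - 2 * b + c) = lam at *
  have h1 : (1 - lam) ^ 2 * a + 2 * ((1 - lam) * lam) * b + lam ^ 2 * c =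
      (a * c - b ^ 2) / (a - 2 * b + c) := by
    rw [eq_div_iff hD.ne']
    linear_combination (lam * (a - 2 * b + c) - (a - b)) * h2
  rw [h1, div_le_div_iff₀ hD (by linarith)]
  nlinarith [mul_nonneg ha.le (neg_nonneg.2 hb), mul_nonneg ha.le (sub_nonneg.2 hc1),
    mul_nonneg (mul_nonneg ha.le ha.le) (sub_nonneg.2 hc1), sq_nonneg b, mul_nonneg ha.le (sq_nonneg b)]

/-- The state of the von Neumann algorithm after `t` steps. -/
structure VNInv (X : List (Fin n)) (g : Finset (Fin n) → ℝ) (Q : Mat n) (t : ℕ) (s : VNState n) :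
    Prop where
  mu_ok : MuOK X g s.mu s.W
  length_eq : s.terms.length = t + 1
  valid : ∀ e ∈ s.terms, ValidTerm X g s.mu e
  coef_nonneg : ∀ e ∈ s.terms, 0 ≤ e.coef
  nrm_nonneg : ∀ e ∈ s.terms, 0 ≤ e.nrm
  nrm_sq : ∀ e ∈ s.terms, e.nrm ^ 2 = bil (rm X Q) (rv X e.gbase) (rv X e.gbase)
  coef_sum : (s.terms.map VNTerm.coef).sum = 1
  y_eq : rv X s.y = vnPoint X s.terms
  norm_le : bil (rm X Q) (rv X s.y) (rv X s.y) ≤ 1 / ((t : ℝ) + 1)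
  nrm_pos : rv X s.y ≠ 0 → ∀ e ∈ s.terms, 0 < e.nrm

theorem vnPoint_scale (X : List (Fin n)) (terms : List (VNTerm n)) (a : ℝ) :
    vnPoint X (terms.map (fun e => { e with coef := a * e.coef })) = a • vnPoint X terms := by
  rw [vnPoint, vnPoint, List.smul_sum, List.map_map, List.map_map]
  congr 1
  refine List.map_congr_left (fun e _ => ?_)
  simp only [Function.comp_apply, smul_smul]
  congr 1
  ring

/-- Also covers the zero base: with `0⁻¹ = 0` the normalized vector is then zero and still of norm
at most `1`. -/
theorem bil_normalized {Q : Mat n} (hQ : (rm X Q).PosDef) {x : Vec n} {r : ℝ}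
    (hr : r = Real.sqrt (bil (rm X Q) (rv X x) (rv X x))) :
    0 ≤ r ∧ r ^ 2 = bil (rm X Q) (rv X x) (rv X x) ∧ (r = 0 → rv X x = 0) ∧
      0 ≤ bil (rm X Q) (r⁻¹ • rv X x) (r⁻¹ • rv X x) ∧
      bil (rm X Q) (r⁻¹ • rv X x) (r⁻¹ • rv X x) ≤ 1 := by
  have h0 := bil_self_nonneg hQ.posSemidef (rv X x)
  have h1 : r ^ 2 = bil (rm X Q) (rv X x) (rv X x) := by rw [hr, Real.sq_sqrt h0]
  refine ⟨hr ▸ Real.sqrt_nonneg _, h1, fun h => ?_, bil_self_nonneg hQ.posSemidef _, ?_⟩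
  · rw [h] at h1
    exact (bil_self_eq_zero hQ).1 (by simpa using h1.symm)
  · rw [bil_smul_left, bil_smul_right, ← h1]
    by_cases h : r = 0
    · simp [h]
    · rw [show r⁻¹ * (r⁻¹ * r ^ 2) = 1 by field_simp]

/-- One step of the von Neumann algorithm. -/
theorem VNInv.step (hX : X.Nodup) (hne : X ≠ []) (hg : IsSubmodularOn X.toFinset g) (h0 : g ∅ = 0)
    {Q : Mat n} (hQ : (rm X Q).PosDef) {t : ℕ} {s : VNState n} (h : VNInv X g Q t s)
    (hpos : 0 < bil (rm X Q) (rv X s.y) (rv X s.y)) {mu : ℝ} {W : Finset (Fin n)}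
    (hmu : MuOK X g mu W) (hle : s.mu ≤ mu) {l : List (Fin n)} (hp : l.Perm X) {base x y : Vec n}
    (hb : ∀ v ∈ X, base v = extremeBase g l v)
    (hx : ∀ v ∈ X, x v = extremeBase (enl X.toFinset g mu) l v)
    (hneg : (rm X Q *ᵥ rv X s.y) ⬝ᵥ rv X x ≤ 0) {r lam : ℝ}
    (hr : r = Real.sqrt (bil (rm X Q) (rv X x) (rv X x)))
    (hlam : lam = ((rv X s.y - r⁻¹ • rv X x) ⬝ᵥ (rm X Q *ᵥ rv X s.y)) /
      bil (rm X Q) (rv X s.y - r⁻¹ • rv X x) (rv X s.y - r⁻¹ • rv X x))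
    (hy : rv X y = (1 - lam) • rv X s.y + lam • (r⁻¹ • rv X x)) :
    VNInv X g Q (t + 1) ⟨mu, W, y, ⟨l, base, x, lam, r⟩ ::
      s.terms.map (fun e => { e with coef := (1 - lam) * e.coef })⟩ := by
  obtain ⟨hr0, hrsq, hrz, hc0, hc1⟩ := bil_normalized hQ hr
  have hsymm := transpose_eq_of_posSemidef hQ.posSemidef
  obtain ⟨z, hz⟩ : ∃ z, z = r⁻¹ • rv X x := ⟨_, rfl⟩
  rw [← hz] at hc0 hc1 hlam hy
  set a := bil (rm X Q) (rv X s.y) (rv X s.y) with ha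
  set b := bil (rm X Q) (rv X s.y) z with hbb
  set c := bil (rm X Q) z z with hcc
  have hb0 : b ≤ 0 := by
    rw [hbb, hz, bil_smul_right, bil_comm hsymm, bil, dotProduct_comm]
    exact mul_nonpos_of_nonneg_of_nonpos (inv_nonneg.2 hr0) hneg
  have hsub : ∀ u : {v // v ∈ X} → ℝ, u - z = u + (-1 : ℝ) • z := fun u => by
    rw [neg_one_smul, sub_eq_add_neg]
  have hlam' : lam = (a - b) / (a - 2 * b + c) := by
    rw [hlam]
    change bil (rm X Q) _ _ / _ = _
    rw [hsub, bil_add_left, bil_add_left, bil_add_right, bil_add_right, bil_smul_left,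
      bil_smul_left, bil_smul_right, bil_smul_right, bil_comm hsymm z (rv X s.y)]
    congr 1
    · ring
    · ring
  obtain ⟨hl0, hl1, hnew⟩ := vonNeumann_step_le hpos hb0 hc0 hc1
  rw [← hlam'] at hl0 hl1 hnew
  have hys : rv X s.y ≠ 0 := by
    intro h
    rw [ha, h] at hpos
    simp [bil] at hpos
  refine ⟨hmu, ?_, ?_, ?_, ?_, ?_, ?_, ?_, ?_, ?_⟩
  · simp [h.length_eq]
  · intro e he
    rcases List.mem_cons.1 he with rfl | he
    · exact validTerm_mk hX hne hg h0 hmu hp hb hx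
    · obtain ⟨e', he', rfl⟩ := List.mem_map.1 he
      have := (h.valid e' he').mono hle
      exact ⟨this.1, this.2, this.3, this.4, this.5⟩
  · intro e he
    rcases List.mem_cons.1 he with rfl | he
    · exact hl0
    · obtain ⟨e', he', rfl⟩ := List.mem_map.1 he
      exact mul_nonneg (by linarith) (h.coef_nonneg e' he')
  · intro e he
    rcases List.mem_cons.1 he with rfl | he
    · exact hr0
    · obtain ⟨e', he', rfl⟩ := List.mem_map.1 he
      exact h.nrm_nonneg e' he'
  · intro e he
    rcases List.mem_cons.1 he with rfl | he
    · exact hrsq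
    · obtain ⟨e', he', rfl⟩ := List.mem_map.1 he
      exact h.nrm_sq e' he'
  · rw [List.map_cons, List.sum_cons, List.map_map]
    have : (s.terms.map (VNTerm.coef ∘ fun e => { e with coef := (1 - lam) * e.coef })).sum =
        (1 - lam) * (s.terms.map VNTerm.coef).sum := by
      rw [← List.sum_map_mul_left]
      rfl
    rw [this, h.coef_sum]
    ring
  · have h1 := vnPoint_scale X s.terms (1 - lam)
    rw [← h.y_eq] at h1
    rw [vnPoint] at h1 ⊢
    rw [List.map_cons, List.sum_cons, h1, hy, hz, smul_smul, add_comm, div_eq_mul_inv]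
  · simp only
    rw [hy, bil_add_left, bil_add_right, bil_add_right]
    simp only [bil_smul_left, bil_smul_right]
    have h1 : bil (rm X Q) z (rv X s.y) = b := bil_comm hsymm _ _
    rw [h1, ← ha, ← hbb, ← hcc]
    have h2 : (1 - lam) * ((1 - lam) * a) + lam * ((1 - lam) * b) +
        ((1 - lam) * (lam * b) + lam * (lam * c)) ≤ a / (a + 1) := by
      refine le_trans (le_of_eq ?_) hnew
      ring
    refine h2.trans ?_
    have h3 := h.norm_le
    rw [← ha] at h3
    have ht : (0 : ℝ) < (t : ℝ) + 1 := by positivity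
    rw [le_div_iff₀ ht] at h3
    push_cast
    rw [div_le_div_iff₀ (by linarith) (by linarith)]
    linarith
  · intro hy0
    simp only at hy0
    -- A zero base gives `z = 0`, hence `lam = 1` and a zero new point. A nonzero point thus
    -- certifies that all bases in its combination have positive norm, as the rescaling requires.
    have hrpos : 0 < r := by
      refine lt_of_le_of_ne hr0 (fun hr' => hy0 ?_)
      have hz0 : z = 0 := by rw [hz, hrz hr'.symm, smul_zero]
      have hb' : b = 0 := by rw [hbb, hz0]; simp [bil]
      have hc' : c = 0 := by rw [hcc, hz0]; simp [bil]
      have : lam = 1 := by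
        rw [hlam', hb', hc']
        simp only [sub_zero, mul_zero, add_zero]
        exact div_self hpos.ne'
      rw [hy, hz0, this]
      simp
    intro e he
    rcases List.mem_cons.1 he with rfl | he
    · exact hrpos
    · obtain ⟨e', he', rfl⟩ := List.mem_map.1 he
      exact h.nrm_pos hys e' he'

/-- After `t` steps the squared norm is at most `1/(t + 1)`, so the norm is small enough when the
limit runs out, even if the test never succeeds. Rescaling the coefficients makes the cost of a step
grow with the number of stored terms, hence the summand `t + k + 1` per step. -/
theorem vonNeumannLoop_runs (hX : X.Nodup) (hne : X ≠ []) (hg : IsSubmodularOn X.toFinset g)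
    (h0 : g ∅ = 0) {acc : Access n} (hacc : ∀ l : List (Fin n), l.Perm X →
      (acc l).Runs f EO (fun r t => r = prefixValues g l ∧ t ≤ ca))
    {Q : Mat n} (hQ : (rm X Q).PosDef) {ε : ℝ} (hε : 0 ≤ ε) (k t : ℕ) (s : VNState n)
    (h : VNInv X g Q t s) (hk : 1 / (((t + k : ℕ) : ℝ) + 1) ≤ ε ^ 2) :
    (vonNeumannLoop X acc Q ε k s).Runs f EO (fun s' τ => ∃ t' ≤ t + k, VNInv X g Q t' s' ∧
      s.mu ≤ s'.mu ∧ bil (rm X Q) (rv X s'.y) (rv X s'.y) ≤ ε ^ 2 ∧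
      τ ≤ k * (25 * (X.length * X.length) + ca + (t + k + 1)) + 4 * (X.length * X.length)) := by
  have hm : 1 ≤ X.length := List.length_pos_iff.2 hne
  have hmm : X.length ≤ X.length * X.length := Nat.le_mul_of_pos_left _ hm
  have hmul : X.length * (X.length + 1) = X.length * X.length + X.length := by ring
  induction k generalizing t s with
  | zero =>
    refine Runs.pure ⟨t, le_rfl, h, le_rfl, ?_, by omega⟩
    exact h.norm_le.trans (by simpa using hk)
  | succ k ih =>
    rw [vonNeumannLoop]
    refine Runs.bind (matVec_runs hX Q s.y) ?_
    rintro w _ ⟨hw, rfl⟩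
    refine Runs.bind (dot_runs hX s.y w) ?_
    rintro yy _ ⟨hyy, rfl⟩
    rw [hw] at hyy
    change yy = bil (rm X Q) (rv X s.y) (rv X s.y) at hyy
    refine Runs.bind (Runs.exact _) ?_
    rintro _ t₁ ⟨-, ht₁⟩
    rw [time_tick] at ht₁
    have hyy0 : 0 ≤ yy := hyy ▸ bil_self_nonneg hQ.posSemidef _
    split_ifs with hsmall
    · refine Runs.pure ⟨t, by omega, h, le_rfl, ?_, ?_⟩
      · rw [← hyy, ← Real.sq_sqrt hyy0]
        exact pow_le_pow_left₀ (Real.sqrt_nonneg _) hsmall 2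
      · rw [Nat.add_one_mul]
        omega
    · refine Runs.bind (sortByWeight_runs f EO X w) ?_
      rintro l t₂ ⟨hp, hs, ht₂⟩
      have htf : l.toFinset = X.toFinset := List.toFinset_eq_of_perm _ _ hp
      have hnd : l.Nodup := hp.nodup_iff.2 hX
      have hll := hp.length_eq
      refine Runs.bind (hacc l hp) ?_
      rintro ps t₃ ⟨rfl, ht₃⟩
      refine Runs.bind (Runs.exact _) ?_
      rintro _ t₄ ⟨-, ht₄⟩
      rw [time_tick] at ht₄
      have hM : ∀ mu, (marginals l (enlarge mu (prefixValues g l)) 0).Runs f EO (fun r t =>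
          (∀ v ∈ X, r v = extremeBase (enl X.toFinset g mu) l v) ∧ t ≤ X.length) := by
        intro mu
        rw [enlarge_prefixValues g mu hnd htf]
        refine (marginals_runs (enl_empty _ _ _) hnd).mono ?_
        rintro r t ⟨hr, ht⟩
        exact ⟨fun v hv => hr v (hp.mem_iff.2 hv), by omega⟩
      refine Runs.bind (hM s.mu) ?_
      rintro g₀ t₅ ⟨hg₀, ht₅⟩
      refine Runs.bind (dot_runs hX w g₀) ?_
      rintro ip _ ⟨hip, rfl⟩
      have hne' : enlarge s.mu (prefixValues g l) ≠ [] := by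
        rw [← List.length_pos_iff, length_enlarge, length_prefixValues]
        omega
      refine Runs.bind (argminIndex_runs _ hne') ?_
      rintro i _ ⟨hi, hmin, rfl⟩
      rw [length_enlarge, length_prefixValues] at hi ⊢
      refine Runs.bind (Runs.exact _) ?_
      rintro _ t₆ ⟨-, ht₆⟩
      rw [time_tick] at ht₆
      rw [hip]
      obtain ⟨hmu, hle, hneg⟩ := slide hX hne h.mu_ok hp hs hg₀ hi hmin rfl rfl
      generalize (if 0 < rv X w ⬝ᵥ rv X g₀ then -((prefixValues g l).getD i 0) else s.mu) = mu at *
      generalize (if 0 < rv X w ⬝ᵥ rv X g₀ then (l.take (i + 1)).toFinset else s.W) = W at *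
      refine Runs.bind (marginals_runs h0 hnd) ?_
      rintro base t₇ ⟨hb, ht₇⟩
      refine Runs.bind (hM mu) ?_
      rintro x t₈ ⟨hx, ht₈⟩
      refine Runs.bind (normQ_runs hX Q x) ?_
      rintro r _ ⟨hr, rfl⟩
      refine Runs.bind (tab_runs _) ?_
      rintro d _ ⟨hd, rfl⟩
      have hd' : rv X d = rv X s.y - r⁻¹ • rv X x := by
        ext v
        simp only [rv, Pi.sub_apply, Pi.smul_apply, smul_eq_mul]
        rw [hd v v.2, div_eq_inv_mul]
      refine Runs.bind (dot_runs hX d w) ?_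
      rintro num _ ⟨hnum, rfl⟩
      refine Runs.bind (matVec_runs hX Q d) ?_
      rintro dq _ ⟨hdq, rfl⟩
      refine Runs.bind (dot_runs hX d dq) ?_
      rintro den _ ⟨hden, rfl⟩
      refine Runs.bind (tab_runs _) ?_
      rintro y _ ⟨hy, rfl⟩
      have hy' : rv X y = (1 - num / den) • rv X s.y + (num / den) • (r⁻¹ • rv X x) := by
        ext v
        simp only [rv, Pi.add_apply, Pi.smul_apply, smul_eq_mul]
        rw [hy v v.2, div_eq_inv_mul (x v)]
      refine Runs.bind (Runs.exact _) ?_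
      rintro _ t₉ ⟨-, ht₉⟩
      rw [time_tick, h.length_eq] at ht₉
      have hpos : 0 < bil (rm X Q) (rv X s.y) (rv X s.y) := by
        rw [← hyy]
        refine lt_of_le_of_ne hyy0 (fun hz => hsmall ?_)
        rw [← hz, Real.sqrt_zero]
        exact hε
      have hstep := h.step hX hne hg h0 hQ hpos hmu hle hp
        (fun v hv => hb v (hp.mem_iff.2 hv)) hx (by rw [← hw]; exact hneg x hx) hr
        (lam := num / den) (by rw [hnum, hden, hdq, hd', hw]; rfl) hy'
      refine (ih (t + 1) _ hstep (by convert hk using 4; omega)).mono ?_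
      rintro s' τ ⟨t', ht', hinv, hmu', hle', hτ⟩
      refine ⟨t', by omega, hinv, hle.trans hmu', hle', ?_⟩
      rw [Nat.add_one_mul]
      have : t + 1 + k + 1 = t + (k + 1) + 1 := by omega
      rw [this] at hτ
      rw [hmul, hll]
      rw [hmul] at ht₂
      rw [hll] at ht₇
      generalize X.length * X.length = q at *
      generalize k * (25 * q + ca + (t + (k + 1) + 1)) = T at *
      linarith

theorem slidingVonNeumann_runs (hX : X.Nodup) (hne : X ≠ []) (hg : IsSubmodularOn X.toFinset g)
    (h0 : g ∅ = 0) {acc : Access n} (hacc : ∀ l : List (Fin n), l.Perm X →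
      (acc l).Runs f EO (fun r t => r = prefixValues g l ∧ t ≤ ca))
    {Q : Mat n} (hQ : (rm X Q).PosDef) {ε : ℝ} (hε : 0 ≤ ε) {N : ℕ}
    (hN : 1 / ((N : ℝ) + 1) ≤ ε ^ 2) {mu : ℝ} {W : Finset (Fin n)} (hmu : MuOK X g mu W) :
    (slidingVonNeumann X acc (prefixValues g X) Q ε N mu W).Runs f EO (fun s τ =>
      ∃ t ≤ N, VNInv X g Q t s ∧ mu ≤ s.mu ∧ bil (rm X Q) (rv X s.y) (rv X s.y) ≤ ε ^ 2 ∧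
      τ ≤ N * (25 * (X.length * X.length) + ca + (N + 1)) + 12 * (X.length * X.length)) := by
  have hm : 1 ≤ X.length := List.length_pos_iff.2 hne
  have hmm : X.length ≤ X.length * X.length := Nat.le_mul_of_pos_left _ hm
  have hmul : X.length * (X.length + 1) = X.length * X.length + X.length := by ring
  unfold slidingVonNeumann
  refine Runs.bind (Runs.exact _) ?_
  rintro _ t₁ ⟨-, ht₁⟩
  rw [time_tick] at ht₁
  refine Runs.bind (marginals_runs h0 hX) ?_
  rintro base t₂ ⟨hb, ht₂⟩
  rw [enlarge_prefixValues g mu hX rfl]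
  refine Runs.bind (marginals_runs (enl_empty _ _ _) hX) ?_
  rintro x t₃ ⟨hx, ht₃⟩
  refine Runs.bind (normQ_runs hX Q x) ?_
  rintro r _ ⟨hr, rfl⟩
  refine Runs.bind (tab_runs _) ?_
  rintro y _ ⟨hy, rfl⟩
  obtain ⟨hr0, hrsq, hrz, hc0, hc1⟩ := bil_normalized hQ hr
  have hy' : rv X y = r⁻¹ • rv X x := by
    ext v
    simp only [rv, Pi.smul_apply, smul_eq_mul]
    rw [hy v v.2, div_eq_inv_mul]
  have hinv : VNInv X g Q 0 ⟨mu, W, y, [⟨X, base, x, 1, r⟩]⟩ := by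
    refine ⟨hmu, rfl, ?_, ?_, ?_, ?_, by simp, ?_, ?_, ?_⟩
    · intro e he
      rw [List.mem_singleton] at he
      subst he
      exact validTerm_mk hX hne hg h0 hmu (List.Perm.refl X) hb hx
    · simp
    · simpa using hr0
    · simpa using hrsq
    · simp [vnPoint, hy']
    · simp only
      rw [hy']
      simpa using hc1
    · intro hne0 e he
      rw [List.mem_singleton] at he
      subst he
      refine lt_of_le_of_ne hr0 (fun h => hne0 ?_)
      simp only
      rw [hy', hrz h.symm, smul_zero]
  refine (vonNeumannLoop_runs hX hne hg h0 hacc hQ hε N 0 _ hinv (by simpa using hN)).mono ?_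
  rintro s τ ⟨t, ht, h1, h2, h3, hτ⟩
  refine ⟨t, by omega, h1, h2, h3, ?_⟩
  rw [zero_add] at hτ
  rw [hmul]
  omega

end VonNeumann

/-! ### Rescaling and pulling back -/

section Rescaling

open Matrix

variable {n : ℕ} {f g : Finset (Fin n) → ℝ} {EO ca : ℕ} {X : List (Fin n)} {ε : ℝ}

/-- Maintaining the inverse by rank-one updates keeps the cost quadratic in `|X|` per base. The
partial sums remain positive definite because the coefficients are nonnegative. -/
theorem rescale_runs (hX : X.Nodup) (hne : X ≠ []) (hε : 0 ≤ ε) {Q R : Mat n}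
    (hQR : IsInvPair (rm X Q) (rm X R)) {terms : List (VNTerm n)}
    (hc : ∀ e ∈ terms, 0 ≤ e.coef) :
    (rescale X ε Q R terms).Runs f EO (fun r τ => IsInvPair (rm X r.1) (rm X r.2) ∧
      rm X r.2 = ((1 + ε) ^ 2)⁻¹ • (rm X R + gram X terms) ∧
      τ ≤ terms.length * (8 * (X.length * X.length)) + 4 * (X.length * X.length)) := by
  have hm : 1 ≤ X.length := List.length_pos_iff.2 hne
  have hmm : X.length ≤ X.length * X.length := Nat.le_mul_of_pos_left _ hm
  have hmul : X.length * (X.length + 1) = X.length * X.length + X.length := by ring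
  have hε2 : (0 : ℝ) < (1 + ε) ^ 2 := by positivity
  unfold rescale
  refine Runs.bind (Runs.loop (l := terms) (fun pre r t => IsInvPair (rm X r.1) (rm X r.2) ∧
    rm X r.2 = rm X R + gram X pre ∧ t ≤ pre.length * (8 * (X.length * X.length)))
    ⟨hQR, by simp [gram], by simp⟩ ?_) ?_
  · rintro pre e post hl r t ⟨h1, h2, h3⟩
    have hce : 0 ≤ e.coef / e.nrm ^ 2 := div_nonneg (hc e (by rw [hl]; simp)) (by positivity)
    refine Runs.bind (matVec_runs hX r.1 e.gbase) ?_
    rintro q _ ⟨hq, rfl⟩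
    refine Runs.bind (dot_runs hX e.gbase q) ?_
    rintro s _ ⟨hs, rfl⟩
    rw [hq] at hs
    change s = bil (rm X r.1) (rv X e.gbase) (rv X e.gbase) at hs
    refine Runs.bind (tab2_runs _) ?_
    rintro Q' _ ⟨hQ', rfl⟩
    refine Runs.bind (tab2_runs _) ?_
    rintro R' _ ⟨hR', rfl⟩
    have hQ'' : rm X Q' = rm X r.1 - (e.coef / e.nrm ^ 2 / (1 + e.coef / e.nrm ^ 2 *
        bil (rm X r.1) (rv X e.gbase) (rv X e.gbase))) •
        vecMulVec (rm X r.1 *ᵥ rv X e.gbase) (rm X r.1 *ᵥ rv X e.gbase) := by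
      rw [← hq, ← hs]
      ext u v
      simp only [rm, rv, of_apply, Matrix.sub_apply, Matrix.smul_apply, vecMulVec_apply, smul_eq_mul]
      rw [hQ' u u.2 v v.2]
      ring
    have hR'' : rm X R' = rm X r.2 + (e.coef / e.nrm ^ 2) • vecMulVec (rv X e.gbase) (rv X e.gbase) := by
      ext u v
      simp only [rm, rv, of_apply, Matrix.add_apply, Matrix.smul_apply, vecMulVec_apply, smul_eq_mul]
      rw [hR' u u.2 v v.2]
      ring
    refine Runs.pure ⟨?_, ?_, ?_⟩
    · simp only
      rw [hQ'', hR'']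
      exact h1.rankOne hce _
    · simp only
      rw [hR'', h2, gram, gram, List.map_append, List.sum_append, add_assoc]
      simp
    · rw [List.length_append, List.length_singleton, Nat.add_one_mul]
      omega
  · rintro r t ⟨h1, h2, h3⟩
    refine Runs.bind (tab2_runs _) ?_
    rintro Q' _ ⟨hQ', rfl⟩
    refine Runs.bind (tab2_runs _) ?_
    rintro R' _ ⟨hR', rfl⟩
    have hQ'' : rm X Q' = ((1 + ε) ^ 2) • rm X r.1 := by
      ext u v
      exact hQ' u u.2 v v.2
    have hR'' : rm X R' = ((1 + ε) ^ 2)⁻¹ • rm X r.2 := by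
      ext u v
      simp only [rm, of_apply, Matrix.smul_apply, smul_eq_mul]
      rw [hR' u u.2 v v.2]
      ring
    refine Runs.pure ⟨?_, ?_, ?_⟩
    · simp only
      rw [hQ'', hR'']
      exact h1.smul (inv_pos.2 hε2) (mul_inv_cancel₀ hε2.ne')
    · simp only
      rw [hR'', h2]
    · omega

/-- The `Q`-norm of a base. -/
def qnorm (X : List (Fin n)) (Q : Mat n) (e : VNTerm n) : ℝ :=
  Real.sqrt (bil (rm X Q) (rv X e.gbase) (rv X e.gbase))

/-- The state of the search for a base of least norm among the bases in the list. -/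
def IsLeastTerm (X : List (Fin n)) (Q : Mat n) (S : List (VNTerm n)) (b : Option (VNTerm n × ℝ)) : Prop :=
  match b with
  | none => S = []
  | some (e, a) => e ∈ S ∧ a = qnorm X Q e ∧ ∀ e' ∈ S, a ≤ qnorm X Q e'

theorem leastNormTerm_runs (hX : X.Nodup) (hne : X ≠ []) (Q : Mat n) (hist : List (Round n)) {B : ℕ}
    (hB : ∀ r ∈ hist, r.terms.length ≤ B) :
    (leastNormTerm X Q hist).Runs f EO (fun b τ => IsLeastTerm X Q (hist.flatMap Round.terms) b ∧
      τ ≤ hist.length * (B * (5 * (X.length * X.length)) + 1)) := by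
  have hm : 1 ≤ X.length := List.length_pos_iff.2 hne
  have hmm : X.length ≤ X.length * X.length := Nat.le_mul_of_pos_left _ hm
  have hmul : X.length * (X.length + 1) = X.length * X.length + X.length := by ring
  unfold leastNormTerm
  refine Runs.loop (l := hist) (fun pre b τ => IsLeastTerm X Q (pre.flatMap Round.terms) b ∧
      τ ≤ pre.length * (B * (5 * (X.length * X.length)) + 1)) ⟨by simp [IsLeastTerm], by simp⟩ ?_
  rintro pre r post hl b t ⟨hb, ht⟩
  refine (Runs.loop (l := r.terms) (fun pre' b τ =>
    IsLeastTerm X Q (pre.flatMap Round.terms ++ pre') b ∧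
      τ ≤ pre'.length * (5 * (X.length * X.length))) ⟨by simpa using hb, by simp⟩ ?_).mono ?_
  · rintro pre' e post' hl' b' t' ⟨hb', ht'⟩
    refine Runs.bind (normQ_runs hX Q e.gbase) ?_
    rintro a _ ⟨ha, rfl⟩
    change a = qnorm X Q e at ha
    have htime : t' + (1 + (X.length * (X.length + 1) + X.length + 1 + 0)) ≤
        (pre' ++ [e]).length * (5 * (X.length * X.length)) := by
      rw [List.length_append, List.length_singleton, Nat.add_one_mul]
      omega
    rcases b' with _ | ⟨e', a'⟩
    · refine Runs.pure ⟨?_, htime⟩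
      have hb'' : pre.flatMap Round.terms ++ pre' = [] := hb'
      rw [← List.append_assoc, hb'']
      simp [IsLeastTerm, ha]
    · refine Runs.pure ⟨?_, htime⟩
      obtain ⟨h1, h2, h3⟩ := hb'
      rw [← List.append_assoc]
      split_ifs with hlt
      · refine ⟨by simp, ha, fun e₁ he₁ => ?_⟩
        rcases List.mem_append.1 he₁ with he₁ | he₁
        · exact hlt.le.trans (h3 e₁ he₁)
        · rw [List.mem_singleton] at he₁
          rw [he₁, ha]
      · refine ⟨List.mem_append_left _ h1, h2, fun e₁ he₁ => ?_⟩
        rcases List.mem_append.1 he₁ with he₁ | he₁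
        · exact h3 e₁ he₁
        · rw [List.mem_singleton] at he₁
          rw [he₁, ← ha]
          exact not_lt.1 hlt
  · rintro b' t' ⟨hb', ht'⟩
    refine ⟨by simpa using hb', ?_⟩
    have h1 : r.terms.length * (5 * (X.length * X.length)) ≤ B * (5 * (X.length * X.length)) :=
      Nat.mul_le_mul_right _ (hB r (by rw [hl]; simp))
    rw [List.length_append, List.length_singleton, Nat.add_one_mul]
    omega

/-- The vector `∑ wᵢ gᵢ`. -/
def wsum (X : List (Fin n)) (wts : List (VNTerm n × ℝ)) : {v // v ∈ X} → ℝ :=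
  (wts.map (fun p => p.2 • rv X p.1.gbase)).sum

/-- The weights are nonnegative because `β` is the maximum of the quotients. It is attained by one
of the bases, which is what `pullBack_bil_le` needs to bound `|β|`. -/
theorem pullBackRound_runs (hX : X.Nodup) (hne : X ≠ []) (hε : 0 ≤ ε) {Q R : Mat n} {r : Round n}
    {h : List (Round n)} (hc : Chain X ε Q R (r :: h)) (hr : r.terms ≠ []) (v : Vec n)
    (wts : List (VNTerm n × ℝ)) :
    (pullBackRound X ε r Q v wts).Runs f EO (fun s τ => ∃ ws : List (VNTerm n × ℝ),
      s.2 = ws ++ wts ∧ ws.length = r.terms.length ∧ (∀ p ∈ ws, p.1 ∈ r.terms ∧ 0 ≤ p.2) ∧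
      rv X s.1 = rv X v + wsum X ws ∧
      bil (rm X r.Q) (rv X s.1) (rv X s.1) ≤ bil (rm X Q) (rv X v) (rv X v) ∧
      τ ≤ r.terms.length * (4 * (X.length * X.length)) + 7 * (X.length * X.length)) := by
  have hm : 1 ≤ X.length := List.length_pos_iff.2 hne
  have hmm : X.length ≤ X.length * X.length := Nat.le_mul_of_pos_left _ hm
  have hmul : X.length * (X.length + 1) = X.length * X.length + X.length := by ring
  unfold pullBackRound
  refine Runs.bind (matVec_runs hX Q v) ?_
  rintro a _ ⟨ha, rfl⟩
  refine Runs.bind (matVec_runs hX r.R a) ?_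
  rintro a' _ ⟨ha', rfl⟩
  refine Runs.bind (tab_runs _) ?_
  rintro u _ ⟨hu, rfl⟩
  refine Runs.bind (matVec_runs hX r.Q u) ?_
  rintro qu _ ⟨hqu, rfl⟩
  have hu' : rv X u = ((1 + ε) ^ 2)⁻¹ • (rm X r.R *ᵥ (rm X Q *ᵥ rv X v)) := by
    rw [← ha, ← ha']
    ext i
    simp only [rv, Pi.smul_apply, smul_eq_mul]
    rw [hu i i.2, div_eq_inv_mul]
  set tv : VNTerm n → ℝ := fun e => (rv X e.gbase ⬝ᵥ (rm X r.Q *ᵥ rv X u)) / e.nrm with htv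
  refine Runs.bind (Runs.loop (l := r.terms) (fun pre m t =>
    m.1 = (pre.map (fun e => (e, tv e))).reverse ∧
    (match m.2 with
      | none => pre = []
      | some β => (∃ e ∈ pre, β = tv e) ∧ ∀ e ∈ pre, tv e ≤ β) ∧
    t = pre.length * (X.length + 1)) ⟨by simp, rfl, by simp⟩ ?_) ?_
  · rintro pre e post hl m t ⟨h1, h2, rfl⟩
    refine Runs.bind (dot_runs hX e.gbase qu) ?_
    rintro c _ ⟨hce, rfl⟩
    have hce' : c / e.nrm = tv e := by rw [hce, hqu]
    refine Runs.pure ⟨by simp [h1, hce'], ?_, ?_⟩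
    · rcases m with ⟨m₁, _ | β⟩
      · simp only at h2
        subst h2
        simp only [List.nil_append, List.mem_singleton]
        exact ⟨⟨e, rfl, hce'⟩, fun e' he' => by rw [he', hce']⟩
      · obtain ⟨⟨e₁, he₁, hβ⟩, h3⟩ := h2
        simp only
        refine ⟨?_, fun e' he' => ?_⟩
        · rcases max_choice β (c / e.nrm) with hmax | hmax
          · exact ⟨e₁, by simp [he₁], by rw [hmax, hβ]⟩
          · exact ⟨e, by simp, by rw [hmax, hce']⟩
        · rcases List.mem_append.1 he' with he' | he'
          · exact (h3 e' he').trans (le_max_left _ _)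
          · rw [List.mem_singleton] at he'
            rw [he', ← hce']
            exact le_max_right _ _
    · rw [List.length_append, List.length_singleton, Nat.add_one_mul]
      omega
  · rintro ⟨m₁, m₂⟩ t ⟨h1, h2, rfl⟩
    rcases m₂ with _ | β
    · exact absurd h2 hr
    · obtain ⟨hβ, hmax⟩ := h2
      simp only at h1
      simp only [Option.getD_some]
      set F : VNTerm n × ℝ → VNTerm n × ℝ := fun p => (p.1, p.1.coef / p.1.nrm * (β - p.2)) with hF
      refine (Runs.loop (l := m₁) (fun pre s t => s.2 = (pre.map F).reverse ++ wts ∧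
        rv X s.1 = rv X v + wsum X (pre.map F) ∧ t = pre.length * (X.length + 1))
        ⟨by simp, by simp [wsum], by simp⟩ ?_).mono ?_
      · rintro pre p post hl s t ⟨h3, h4, rfl⟩
        refine Runs.bind (tab_runs _) ?_
        rintro v' _ ⟨hv', rfl⟩
        refine Runs.pure ⟨?_, ?_, ?_⟩
        · simp [h3, hF]
        · simp only [wsum, List.map_append, List.sum_append] at h4 ⊢
          rw [← add_assoc, ← h4]
          ext i
          simp only [rv, Pi.add_apply, List.map_cons, List.map_nil, List.sum_cons, List.sum_nil,
            add_zero, Pi.smul_apply, smul_eq_mul, hF]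
          exact hv' i i.2
        · rw [List.length_append, List.length_singleton, Nat.add_one_mul]
          omega
      · rintro s t ⟨h3, h4, rfl⟩
        have hch := hc.2.2.1
        have hlen : m₁.length = r.terms.length := by rw [h1]; simp
        have hws : wsum X (m₁.map F) = (r.terms.map (fun e => (e.coef / e.nrm *
            (β - (rv X e.gbase ⬝ᵥ (rm X r.Q *ᵥ rv X u)) / e.nrm)) • rv X e.gbase)).sum := by
          rw [wsum, h1, List.map_reverse, List.map_reverse, List.sum_reverse, List.map_map,
            List.map_map]
          rfl
        refine ⟨(m₁.map F).reverse, h3, by simp [hlen], ?_, ?_, ?_, ?_⟩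
        · intro p hp
          rw [List.mem_reverse, List.mem_map] at hp
          obtain ⟨p', hp', rfl⟩ := hp
          rw [h1, List.mem_reverse, List.mem_map] at hp'
          obtain ⟨e, he, rfl⟩ := hp'
          refine ⟨he, mul_nonneg (div_nonneg (hch.coef_nonneg e he) (hch.nrm_pos e he).le) ?_⟩
          exact sub_nonneg.2 (hmax e he)
        · rw [h4, wsum, wsum, List.map_reverse, List.sum_reverse]
        · rw [h4, hws]
          exact pullBack_bil_le hε hc (rv X v) (rv X u) hu' hβ
        · rw [hlen]
          have h5 : r.terms.length * (X.length + 1) ≤ r.terms.length * (2 * (X.length * X.length)) :=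
            Nat.mul_le_mul_left _ (by omega)
          have h6 : r.terms.length * (4 * (X.length * X.length)) =
            2 * (r.terms.length * (2 * (X.length * X.length))) := by ring
          omega

/-- The starting base has weight `1` and all later weights are nonnegative, so the total weight is
at least `1` while the norm never increases. -/
theorem pullBack_runs (hX : X.Nodup) (hne : X ≠ []) (hε : 0 ≤ ε) {Q R : Mat n}
    {hist : List (Round n)} (hc : Chain X ε Q R hist) (hhist : hist ≠ [])
    (hterms : ∀ r ∈ hist, r.terms ≠ []) {B : ℕ} (hB : ∀ r ∈ hist, r.terms.length ≤ B) :
    (pullBack X ε Q hist).Runs f EO (fun wts τ => ∃ e ∈ hist.flatMap Round.terms,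
      (∀ e' ∈ hist.flatMap Round.terms, bil (rm X Q) (rv X e.gbase) (rv X e.gbase) ≤
        bil (rm X Q) (rv X e'.gbase) (rv X e'.gbase)) ∧
      (∀ p ∈ wts, p.1 ∈ hist.flatMap Round.terms ∧ 0 ≤ p.2) ∧
      1 ≤ (wts.map Prod.snd).sum ∧
      wsum X wts ⬝ᵥ wsum X wts ≤ bil (rm X Q) (rv X e.gbase) (rv X e.gbase) ∧
      wts.length ≤ hist.length * B + 1 ∧
      τ ≤ hist.length * (B * (9 * (X.length * X.length)) + 9 * (X.length * X.length))) := by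
  have hm : 1 ≤ X.length := List.length_pos_iff.2 hne
  have hmm : X.length ≤ X.length * X.length := Nat.le_mul_of_pos_left _ hm
  unfold pullBack
  refine Runs.bind (leastNormTerm_runs hX hne Q hist hB) ?_
  rintro b t₀ ⟨hb, ht₀⟩
  rcases b with _ | ⟨e, a⟩
  · exfalso
    obtain ⟨r, h, rfl⟩ := List.exists_cons_of_ne_nil hhist
    have h1 : (r :: h).flatMap Round.terms = [] := hb
    simp at h1
    exact hterms r (by simp) h1.1
  · obtain ⟨he, ha, hmin⟩ := hb
    simp only
    have hpsd := hc.isInvPair.posDef_left.posSemidef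
    -- The current matrix always belongs to the part of the history still to be undone. When nothing
    -- is left it is the identity, and the bound on its norm becomes a Euclidean one.
    refine Runs.bind (Runs.loop (l := hist) (fun pre s t =>
      (∀ post, hist = pre ++ post → ∃ R, Chain X ε s.1 R post) ∧
      bil (rm X s.1) (rv X s.2.1) (rv X s.2.1) ≤ bil (rm X Q) (rv X e.gbase) (rv X e.gbase) ∧
      rv X s.2.1 = wsum X s.2.2 ∧ (∀ p ∈ s.2.2, p.1 ∈ hist.flatMap Round.terms ∧ 0 ≤ p.2) ∧
      1 ≤ (s.2.2.map Prod.snd).sum ∧ s.2.2.length ≤ pre.length * B + 1 ∧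
      t ≤ pre.length * (B * (4 * (X.length * X.length)) + 8 * (X.length * X.length)))
      ⟨?_, le_rfl, by simp [wsum], by simpa using List.mem_flatMap.1 he, by simp, by simp, by simp⟩ ?_) ?_
    · rintro post rfl
      exact ⟨R, hc⟩
    · rintro pre r post hl s t ⟨h1, h2, h3, h4, h5, h6, h7⟩
      obtain ⟨R', hR'⟩ := h1 (r :: post) hl
      have hrm : r ∈ hist := by rw [hl]; simp
      refine Runs.bind (pullBackRound_runs hX hne hε hR' (hterms r hrm) s.2.1 s.2.2) ?_
      rintro ⟨v', wts'⟩ t' ⟨ws, g1, g2, g3, g4, g5, g6⟩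
      simp only at g1 g4 g5
      subst g1
      have hBr := hB r hrm
      refine Runs.pure ⟨?_, g5.trans h2, ?_, ?_, ?_, ?_, ?_⟩
      · intro post' hpost'
        have : post' = post := by
          rw [hl, List.append_assoc] at hpost'
          have := List.append_cancel_left hpost'
          simpa using this.symm
        subst this
        exact ⟨r.R, hR'.2.2.2⟩
      · simp only
        rw [g4, h3, wsum, wsum, wsum, List.map_append, List.sum_append, add_comm]
      · intro p hp
        rcases List.mem_append.1 hp with hp | hp
        · exact ⟨List.mem_flatMap.2 ⟨r, hrm, (g3 p hp).1⟩, (g3 p hp).2⟩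
        · exact h4 p hp
      · simp only [List.map_append, List.sum_append]
        have : 0 ≤ (ws.map Prod.snd).sum := by
          refine List.sum_nonneg ?_
          intro x hx
          obtain ⟨p, hp, rfl⟩ := List.mem_map.1 hx
          exact (g3 p hp).2
        linarith
      · simp only [List.length_append, List.length_singleton, Nat.add_one_mul]
        omega
      · rw [List.length_append, List.length_singleton, Nat.add_one_mul]
        have : r.terms.length * (4 * (X.length * X.length)) ≤ B * (4 * (X.length * X.length)) :=
          Nat.mul_le_mul_right _ hBr
        omega
    · rintro s t ⟨h1, h2, h3, h4, h5, h6, h7⟩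
      obtain ⟨R', hR'⟩ := h1 [] (by simp)
      refine Runs.pure ⟨e, he, fun e' he' => ?_, h4, h5, ?_, h6, ?_⟩
      · have := hmin e' he'
        rw [ha, qnorm, qnorm] at this
        exact (Real.sqrt_le_sqrt_iff (bil_self_nonneg hpsd _)).1 this
      · rw [← h3]
        rw [hR'.1] at h2
        simpa [bil] using h2
      · rw [add_zero]
        refine (Nat.add_le_add ht₀ h7).trans ?_
        rw [← Nat.mul_add]
        refine Nat.mul_le_mul_left _ ?_
        have : B * (9 * (X.length * X.length)) = B * (5 * (X.length * X.length)) +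
          B * (4 * (X.length * X.length)) := by ring
        omega

end Rescaling

/-! ### The rescaling loop -/

section RescalingLoop

open Matrix

variable {n : ℕ} {f g : Finset (Fin n) → ℝ} {EO ca : ℕ} {X : List (Fin n)} {ε : ℝ}

theorem VNInv.roundOK {Q R : Mat n} {t : ℕ} {s : VNState n} (h : VNInv X g Q t s)
    (hy : rv X s.y ≠ 0) (hle : bil (rm X Q) (rv X s.y) (rv X s.y) ≤ ε ^ 2) :
    RoundOK X ε ⟨Q, R, s.terms⟩ :=
  ⟨h.coef_nonneg, h.nrm_pos hy, h.nrm_sq, h.coef_sum, by rw [← h.y_eq]; exact hle⟩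

/-- The properties of the weighted bases from which the dual point is computed. -/
structure WeightsOK (X : List (Fin n)) (g : Finset (Fin n) → ℝ) (mu δ : ℝ)
    (wts : List (VNTerm n × ℝ)) : Prop where
  valid : ∀ w ∈ wts, ValidTerm X g mu w.1
  nonneg : ∀ w ∈ wts, 0 ≤ w.2
  sum_pos : 0 < (wts.map Prod.snd).sum
  sum_abs_le : ∑ v, |wsum X wts v| ≤
    2 * (δ * complexityL X.toFinset g) * (wts.map Prod.snd).sum

theorem complexityL_nonneg_of_validTerm {mu : ℝ} {e : VNTerm n} (h : ValidTerm X g mu e) :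
    0 ≤ complexityL X.toFinset g := by
  have := h.sum_abs_gbase
  have h2 := Finset.sum_nonneg (fun v (_ : v ∈ X.toFinset) => abs_nonneg (e.gbase v))
  linarith

/-- If the von Neumann algorithm returns zero, the coefficients of the point give suitable weights. -/
theorem VNInv.weightsOK {Q : Mat n} (hQ : (rm X Q).PosDef) {t : ℕ} {s : VNState n}
    (h : VNInv X g Q t s) (hy : rv X s.y = 0) {δ : ℝ} (hδ : 0 < δ) :
    WeightsOK X g s.mu δ
      (s.terms.map (fun e => (e, if e.nrm = 0 then e.coef else e.coef / e.nrm))) := by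
  have hw0 : ∀ e ∈ s.terms, 0 ≤ (if e.nrm = 0 then e.coef else e.coef / e.nrm) := by
    intro e he
    split_ifs
    · exact h.coef_nonneg e he
    · exact div_nonneg (h.coef_nonneg e he) (h.nrm_nonneg e he)
  have hsum : wsum X (s.terms.map (fun e => (e, if e.nrm = 0 then e.coef else e.coef / e.nrm))) = 0 := by
    rw [← hy, h.y_eq, wsum, vnPoint, List.map_map]
    congr 1
    refine List.map_congr_left (fun e he => ?_)
    simp only [Function.comp_apply]
    split_ifs with h0
    · have h1 := h.nrm_sq e he
      rw [h0] at h1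
      have h2 : rv X e.gbase = 0 := (bil_self_eq_zero hQ).1 (by simpa using h1.symm)
      simp [h2]
    · rfl
  -- The weights cannot all vanish: a zero weight forces a zero coefficient, and the coefficients
  -- sum to `1`.
  have hpos : 0 < (s.terms.map (fun e => if e.nrm = 0 then e.coef else e.coef / e.nrm)).sum := by
    by_contra hcon
    have hz : ∀ e ∈ s.terms, e.coef = 0 := by
      intro e he
      have h1 := List.single_le_sum (l := s.terms.map
        (fun e => if e.nrm = 0 then e.coef else e.coef / e.nrm)) (by
          intro x hx
          obtain ⟨e, he, rfl⟩ := List.mem_map.1 hx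
          exact hw0 e he) _ (List.mem_map_of_mem he)
      have h2 : (if e.nrm = 0 then e.coef else e.coef / e.nrm) = 0 :=
        le_antisymm (h1.trans (not_lt.1 hcon)) (hw0 e he)
      split_ifs at h2 with h0
      · exact h2
      · exact (div_eq_zero_iff.1 h2).resolve_right h0
    have h1 := h.coef_sum
    rw [List.map_congr_left (g := fun _ => (0 : ℝ)) hz] at h1
    simp at h1
  have hs : ((s.terms.map (fun e => (e, if e.nrm = 0 then e.coef else e.coef / e.nrm))).map
      Prod.snd).sum = (s.terms.map (fun e => if e.nrm = 0 then e.coef else e.coef / e.nrm)).sum := by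
    rw [List.map_map]
    rfl
  refine ⟨?_, ?_, by rwa [hs], ?_⟩
  · intro w hw
    obtain ⟨e, he, rfl⟩ := List.mem_map.1 hw
    exact h.valid e he
  · intro w hw
    obtain ⟨e, he, rfl⟩ := List.mem_map.1 hw
    exact hw0 e he
  · rw [hsum, hs]
    obtain ⟨e, he⟩ : ∃ e, e ∈ s.terms := by
      have := h.length_eq
      exact List.exists_mem_of_length_pos (by omega)
    have := complexityL_nonneg_of_validTerm (h.valid e he)
    simp only [Pi.zero_apply, abs_zero, Finset.sum_const_zero]
    positivity

/-- Absorbs the linear factor `5p` from `Chain.least_norm_le` at the price of replacing `16^p` by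
`4^p`, which is still the square of `2^p ≥ 2m/δ`. -/
theorem five_mul_four_pow_le (p : ℕ) (hp : 1 ≤ p) : 5 * (p : ℝ) * 4 ^ p ≤ 4 * (16 ^ p - 1) := by
  induction p, hp using Nat.le_induction with
  | base => norm_num
  | succ p hp ih =>
    have h1 : (4 : ℝ) ≤ 4 ^ p := by
      calc (4 : ℝ) = 4 ^ 1 := by norm_num
        _ ≤ 4 ^ p := pow_le_pow_right₀ (by norm_num) hp
    have h2 : (16 : ℝ) ^ p = 4 ^ p * 4 ^ p := by rw [← mul_pow]; norm_num
    rw [h2] at ih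
    rw [pow_succ, pow_succ, h2]
    push_cast
    nlinarith

theorem sum_sq_le_sq_sum_abs {ι : Type*} [Fintype ι] (x : ι → ℝ) :
    x ⬝ᵥ x ≤ (∑ i, |x i|) ^ 2 := by
  rw [dotProduct, sq, Finset.sum_mul]
  refine Finset.sum_le_sum (fun i _ => ?_)
  rw [← abs_mul_abs_self]
  exact mul_le_mul_of_nonneg_left (Finset.single_le_sum (f := fun i => |x i|)
    (fun i _ => abs_nonneg _) (Finset.mem_univ i)) (abs_nonneg _)

theorem sum_abs_sq_le {ι : Type*} [Fintype ι] (x : ι → ℝ) :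
    (∑ i, |x i|) ^ 2 ≤ Fintype.card ι * (x ⬝ᵥ x) := by
  have := sq_sum_le_card_mul_sum_sq (s := Finset.univ) (f := fun i => |x i|)
  simpa [dotProduct, sq] using this

/-- The weights that result from the pull-back after `5 m p` rescalings. -/
theorem weightsOK_of_pullBack (hX : X.Nodup) (hne : X ≠ []) (hε : ε = 1 / (20 * (X.length : ℝ)))
    {Q R : Mat n} {hist : List (Round n)} (hc : Chain X ε Q R hist) {p : ℕ} (hp : 1 ≤ p)
    (hlen : hist.length = 5 * X.length * p) {mu δ : ℝ} (hδ : 0 < δ)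
    (hpδ : 2 * (X.length : ℝ) / δ ≤ 2 ^ p)
    (hvalid : ∀ r ∈ hist, ∀ e ∈ r.terms, ValidTerm X g mu e) {wts : List (VNTerm n × ℝ)}
    {e : VNTerm n} (he : e ∈ hist.flatMap Round.terms)
    (hmin : ∀ e' ∈ hist.flatMap Round.terms, bil (rm X Q) (rv X e.gbase) (rv X e.gbase) ≤
        bil (rm X Q) (rv X e'.gbase) (rv X e'.gbase))
    (hwts : ∀ p ∈ wts, p.1 ∈ hist.flatMap Round.terms ∧ 0 ≤ p.2)
    (hone : 1 ≤ (wts.map Prod.snd).sum)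
    (hle : wsum X wts ⬝ᵥ wsum X wts ≤ bil (rm X Q) (rv X e.gbase) (rv X e.gbase)) :
    WeightsOK X g mu δ wts := by
  have hm : 1 ≤ X.length := List.length_pos_iff.2 hne
  have hm' : (1 : ℝ) ≤ X.length := by exact_mod_cast hm
  have hcard := card_subtype_mem hX
  have hvalid' : ∀ e ∈ hist.flatMap Round.terms, ValidTerm X g mu e := by
    intro e he
    obtain ⟨r, hr, her⟩ := List.mem_flatMap.1 he
    exact hvalid r hr e her
  set L := complexityL X.toFinset g with hL
  have hL0 : 0 ≤ L := complexityL_nonneg_of_validTerm (hvalid' e he)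
  have hgM : ∀ r ∈ hist, ∀ e ∈ r.terms, rv X e.gbase ⬝ᵥ rv X e.gbase ≤ 4 * L ^ 2 := by
    intro r hr e he
    have h1 := (hvalid r hr e he).sum_abs_gbase
    rw [List.sum_toFinset _ hX, sum_map_eq_sum_subtype hX] at h1
    refine (sum_sq_le_sq_sum_abs _).trans ?_
    have h2 : 4 * L ^ 2 = (2 * L) ^ 2 := by ring
    rw [h2]
    exact pow_le_pow_left₀ (Finset.sum_nonneg (fun _ _ => abs_nonneg _)) h1 2
  set c := bil (rm X Q) (rv X e.gbase) (rv X e.gbase) with hcc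
  -- The base was used in some round with positive norm, so it is not zero on `X`, and its norm in
  -- the final matrix is positive too.
  have hc0 : 0 < c := by
    refine bil_self_pos hc.isInvPair.posDef_left (fun h0 => ?_)
    obtain ⟨r, hr, her⟩ := List.mem_flatMap.1 he
    have : ∀ {Q R : Mat n} {hist : List (Round n)}, Chain X ε Q R hist → r ∈ hist → RoundOK X ε r := by
      clear hc hlen hvalid he hmin hwts hvalid' hgM hr
      intro Q R hist
      induction hist generalizing Q R with
      | nil => simp
      | cons r' hist ih =>
        intro hc hr
        rcases List.mem_cons.1 hr with rfl | hr
        · exact hc.2.2.1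
        · exact ih hc.2.2.2 hr
    have hrOK := this hc hr
    have h1 := hrOK.nrm_sq e her
    rw [h0] at h1
    have h2 := hrOK.nrm_pos e her
    simp [bil] at h1
    exact h2.ne' h1
  have hkey := hc.least_norm_le hcard hm hε hlen (M := 4 * L ^ 2) (by positivity) hc0 hgM
    (fun r hr e' he' => hmin e' (List.mem_flatMap.2 ⟨r, hr, he'⟩))
  refine ⟨fun w hw => hvalid' _ (hwts w hw).1, fun w hw => (hwts w hw).2, by linarith, ?_⟩
  have hp' : (0 : ℝ) < p := by exact_mod_cast hp
  have h1 : c * 4 ^ p ≤ 16 * L ^ 2 := by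
    have h2 := mul_le_mul_of_nonneg_left (five_mul_four_pow_le p hp) hc0.le
    have h3 : (c * 4 ^ p) * (5 * p) ≤ (16 * L ^ 2) * (5 * p) := by linarith
    exact le_of_mul_le_mul_right h3 (by positivity)
  have h2 : 4 * (X.length : ℝ) ^ 2 ≤ δ ^ 2 * 4 ^ p := by
    rw [div_le_iff₀ hδ] at hpδ
    have := pow_le_pow_left₀ (by positivity) hpδ 2
    rw [mul_pow, mul_pow, ← pow_mul, mul_comm p 2, pow_mul] at this
    norm_num at this
    linarith
  -- The passage from the Euclidean to the sum norm costs a factor `m` in the square. Together with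
  -- `c 4^p ≤ 16L²` and `4m² ≤ δ² 4^p` this leaves `2δL`.
  have h3 : (∑ v, |wsum X wts v|) ^ 2 ≤ (2 * (δ * L)) ^ 2 := by
    refine (sum_abs_sq_le _).trans ?_
    rw [hcard]
    have h4 : (X.length : ℝ) * (wsum X wts ⬝ᵥ wsum X wts) ≤ X.length * c :=
      mul_le_mul_of_nonneg_left hle (by positivity)
    refine h4.trans ?_
    have h5 : (0 : ℝ) < 4 ^ p := by positivity
    refine le_of_mul_le_mul_right ?_ h5
    calc (X.length : ℝ) * c * 4 ^ p ≤ X.length * (16 * L ^ 2) := by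
          rw [mul_assoc]
          exact mul_le_mul_of_nonneg_left h1 (by positivity)
      _ ≤ (X.length : ℝ) ^ 2 * (16 * L ^ 2) := by
          refine mul_le_mul_of_nonneg_right ?_ (by positivity)
          nlinarith
      _ = 4 * L ^ 2 * (4 * (X.length : ℝ) ^ 2) := by ring
      _ ≤ 4 * L ^ 2 * (δ ^ 2 * 4 ^ p) := mul_le_mul_of_nonneg_left h2 (by positivity)
      _ = (2 * (δ * L)) ^ 2 * 4 ^ p := by ring
  have h4 := le_of_sq_le_sq h3 (by positivity)
  refine h4.trans ?_
  exact le_mul_of_one_le_right (by positivity) hone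

/-- A bound for the time of one round. -/
def roundTime (m N ca : ℕ) : ℕ :=
  N * (25 * (m * m) + ca + (N + 1)) + (N + 1) * (17 * (m * m) + 1) + 29 * (m * m)

/-- One multiple of `roundTime` per round covers the loop and another covers the final pull-back,
hence the factor `2`. The parameter `μ` only grows, so bases from earlier rounds stay valid; an
exact zero ends the loop early and its coefficients serve as weights. -/
theorem rescalingLoop_runs (hX : X.Nodup) (hne : X ≠ []) (hg : IsSubmodularOn X.toFinset g)
    (h0 : g ∅ = 0) {acc : Access n} (hacc : ∀ l : List (Fin n), l.Perm X →
      (acc l).Runs f EO (fun r t => r = prefixValues g l ∧ t ≤ ca))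
    (hε : ε = 1 / (20 * (X.length : ℝ))) {N : ℕ} (hN : 1 / ((N : ℝ) + 1) ≤ ε ^ 2)
    {p : ℕ} (hp : 1 ≤ p) {δ : ℝ} (hδ : 0 < δ) (hpδ : 2 * (X.length : ℝ) / δ ≤ 2 ^ p)
    (k : ℕ) (mu : ℝ) (W : Finset (Fin n)) (Q R : Mat n) (hist : List (Round n))
    (hmu : MuOK X g mu W) (hc : Chain X ε Q R hist) (hlen : hist.length + k = 5 * X.length * p)
    (hterms : ∀ r ∈ hist, r.terms ≠ [] ∧ r.terms.length ≤ N + 1 ∧ ∀ e ∈ r.terms, ValidTerm X g mu e) :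
    (rescalingLoop X acc (prefixValues g X) ε N k mu W Q R hist).Runs f EO (fun r τ =>
      ∃ mu', MuOK X g mu' r.1 ∧ WeightsOK X g mu' δ r.2 ∧
        r.2.length ≤ 5 * X.length * p * (N + 1) + 1 ∧
        τ + hist.length * roundTime X.length N ca ≤
          2 * (5 * X.length * p * roundTime X.length N ca)) := by
  have hm : 1 ≤ X.length := List.length_pos_iff.2 hne
  have hmm : X.length ≤ X.length * X.length := Nat.le_mul_of_pos_left _ hm
  have hε0 : 0 ≤ ε := by rw [hε]; positivity
  induction k generalizing mu W Q R hist with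
  | zero =>
    rw [add_zero] at hlen
    have hT : 1 ≤ 5 * X.length * p := Nat.mul_pos (by omega) hp
    have hhist : hist ≠ [] := by
      rintro rfl
      rw [List.length_nil] at hlen
      omega
    unfold rescalingLoop
    refine Runs.bind (pullBack_runs hX hne hε0 hc hhist (fun r hr => (hterms r hr).1)
      (fun r hr => (hterms r hr).2.1)) ?_
    rintro wts t ⟨e, he, h1, h2, h3, h4, h5, h6⟩
    refine Runs.pure ⟨mu, hmu, ?_, ?_, ?_⟩
    · exact weightsOK_of_pullBack hX hne hε hc hp hlen hδ hpδ (fun r hr => (hterms r hr).2.2) he h1 h2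
        h3 h4
    · rwa [hlen] at h5
    · rw [hlen] at h6 ⊢
      have : (N + 1) * (9 * (X.length * X.length)) + 9 * (X.length * X.length) ≤
          roundTime X.length N ca := by
        unfold roundTime
        have : (N + 1) * (9 * (X.length * X.length)) ≤ (N + 1) * (17 * (X.length * X.length) + 1) :=
          Nat.mul_le_mul_left _ (by omega)
        omega
      have := Nat.mul_le_mul_left (5 * X.length * p) this
      omega
  | succ k ih =>
    rw [rescalingLoop]
    have hpd := hc.isInvPair.posDef_left
    refine Runs.bind (slidingVonNeumann_runs hX hne hg h0 hacc hpd hε0 hN hmu) ?_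
    rintro s t₁ ⟨t, ht, hinv, hmule, hnorm, ht₁⟩
    refine Runs.bind (P := fun a t => a = ∑ v : {v // v ∈ X}, |s.y v| ∧ t = X.length)
      ⟨by rw [result_sumOver, sum_map_eq_sum_subtype hX], by rw [time_sumOver]⟩ ?_
    rintro a _ ⟨ha, rfl⟩
    refine Runs.bind (Runs.exact _) ?_
    rintro _ t₂ ⟨-, ht₂⟩
    rw [time_tick] at ht₂
    have htlen := hinv.length_eq
    set rt := roundTime X.length N ca with hrt
    have hkT : 1 ≤ 5 * X.length * p := by omega
    split_ifs with ha0
    · refine Runs.bind (Runs.exact _) ?_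
      rintro _ t₃ ⟨-, ht₃⟩
      rw [time_tick] at ht₃
      have hy : rv X s.y = 0 := by
        rw [ha, Finset.sum_eq_zero_iff_of_nonneg (fun _ _ => abs_nonneg _)] at ha0
        ext v
        exact abs_eq_zero.1 (ha0 v (Finset.mem_univ v))
      refine Runs.pure ⟨s.mu, hinv.mu_ok, hinv.weightsOK hpd hy hδ, ?_, ?_⟩
      · simp only [List.length_map]
        have : N + 1 ≤ 5 * X.length * p * (N + 1) := Nat.le_mul_of_pos_left _ hkT
        omega
      · have h1 : t₁ + (X.length + (t₂ + (t₃ + 0))) ≤ rt := by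
          rw [hrt, roundTime]
          have : (N + 1) * 1 ≤ (N + 1) * (17 * (X.length * X.length) + 1) :=
            Nat.mul_le_mul_left _ (by omega)
          omega
        have h2 : (hist.length + 1) * rt ≤ 5 * X.length * p * rt := Nat.mul_le_mul_right _ (by omega)
        rw [Nat.add_one_mul] at h2
        omega
    · have hy : rv X s.y ≠ 0 := by
        intro hy
        refine ha0 ?_
        rw [ha]
        refine Finset.sum_eq_zero (fun v _ => ?_)
        have : s.y v = 0 := congrFun hy v
        rw [this, abs_zero]
      refine Runs.bind (rescale_runs hX hne hε0 hc.isInvPair hinv.coef_nonneg) ?_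
      rintro ⟨Q', R'⟩ t₃ ⟨hI, hR', ht₃⟩
      refine (ih s.mu s.W Q' R' (⟨Q, R, s.terms⟩ :: hist) hinv.mu_ok
        ⟨hI, hR', hinv.roundOK hy hnorm, hc⟩ (by simp only [List.length_cons]; omega) ?_).mono ?_
      · intro r hr
        rcases List.mem_cons.1 hr with rfl | hr
        · refine ⟨?_, by simp only; omega, hinv.valid⟩
          rw [Ne, ← List.length_eq_zero_iff]
          simp only
          omega
        · obtain ⟨h1, h2, h3⟩ := hterms r hr
          exact ⟨h1, h2, fun e he => (h3 e he).mono hmule⟩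
      · rintro r τ ⟨mu', h1, h2, h3, h4⟩
        refine ⟨mu', h1, h2, h3, ?_⟩
        rw [List.length_cons, Nat.add_one_mul] at h4
        have h5 : s.terms.length * (8 * (X.length * X.length)) ≤ (N + 1) * (8 * (X.length * X.length)) :=
          Nat.mul_le_mul_right _ (by omega)
        have h6 : (N + 1) * (8 * (X.length * X.length)) ≤ (N + 1) * (17 * (X.length * X.length) + 1) :=
          Nat.mul_le_mul_left _ (by omega)
        have h7 : t₁ + (X.length + (t₂ + t₃)) ≤ rt := by
          rw [hrt, roundTime]
          omega
        omega

end RescalingLoop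

/-! ### Reduction of the convex combination -/

section Caratheodory

open Matrix

variable {n : ℕ} {f : Finset (Fin n) → ℝ} {EO : ℕ} {X : List (Fin n)} {shift : ℝ}

/-- The vector of the basis in position `v`. -/
def caraCol (shift : ℝ) (slot : Fin n → Option (VNTerm n)) (v : Fin n) : Vec n :=
  match slot v with
  | none => Pi.single v 1
  | some e => fun u => e.base u + shift

/-- The matrix of the basis. -/
def caraMat (X : List (Fin n)) (shift : ℝ) (slot : Fin n → Option (VNTerm n)) :
    Matrix {v // v ∈ X} {v // v ∈ X} ℝ :=
  of (fun u v => caraCol shift slot v u)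

theorem caraMat_update (shift : ℝ) (slot : Fin n → Option (VNTerm n)) {r : Fin n} (hr : r ∈ X)
    (e : VNTerm n) (u v : {v // v ∈ X}) :
    caraMat X shift (Function.update slot r (some e)) u v =
      if v = ⟨r, hr⟩ then e.base u + shift else caraMat X shift slot u v := by
  by_cases h : v = ⟨r, hr⟩
  · subst h
    simp [caraMat, caraCol]
  · have h' : (v : Fin n) ≠ r := fun h' => h (Subtype.ext h')
    simp [caraMat, caraCol, h, h']

/-- Replacing column `r` by `a` amounts to one Gauss-Jordan elimination of the coordinates `d` of
`a` in the old basis, applied to the rows of the inverse. -/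
theorem pivot_runs {B : Mat n} {M M' : Matrix {v // v ∈ X} {v // v ∈ X} ℝ}
    {d : Vec n} {r : Fin n} (hr : r ∈ X) (hB : rm X B * M = 1) {a : {v // v ∈ X} → ℝ}
    (hd : rv X d = rm X B *ᵥ a) (hdr : d r ≠ 0)
    (hM' : ∀ u v, M' u v = if v = ⟨r, hr⟩ then a u else M u v) :
    (pivot X d r B).Runs f EO (fun B' τ => rm X B' * M' = 1 ∧ τ = X.length * (X.length + 1)) := by
  unfold pivot
  refine (tab2_runs _).mono ?_
  rintro B' _ ⟨hB', rfl⟩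
  refine ⟨?_, rfl⟩
  ext u v
  have h1 : ∀ x : {v // v ∈ X} → ℝ, (rm X B' *ᵥ x) u =
      if u = ⟨r, hr⟩ then (rm X B *ᵥ x) ⟨r, hr⟩ / d r
      else (rm X B *ᵥ x) u - d u * ((rm X B *ᵥ x) ⟨r, hr⟩ / d r) := by
    intro x
    simp only [mulVec, dotProduct, rm, of_apply]
    by_cases hu : u = ⟨r, hr⟩
    · rw [if_pos hu, Finset.sum_div]
      refine Finset.sum_congr rfl (fun w _ => ?_)
      rw [hB' u u.2 w w.2, if_pos (congrArg Subtype.val hu)]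
      ring
    · rw [if_neg hu, Finset.sum_div, Finset.mul_sum, ← Finset.sum_sub_distrib]
      refine Finset.sum_congr rfl (fun w _ => ?_)
      rw [hB' u u.2 w w.2, if_neg (fun h => hu (Subtype.ext h))]
      ring
  have h2 : (rm X B' * M') u v = (rm X B' *ᵥ (fun w => M' w v)) u := rfl
  rw [h2, h1]
  by_cases hv : v = ⟨r, hr⟩
  · have h3 : (fun w => M' w v) = a := by
      ext w
      rw [hM', if_pos hv]
    rw [h3, ← hd, hv]
    simp only [rv]
    by_cases hu : u = ⟨r, hr⟩
    · rw [if_pos hu, hu, one_apply_eq, div_self hdr]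
    · rw [if_neg hu, one_apply_ne hu, div_self hdr]
      ring
  · have h3 : (fun w => M' w v) = fun w => M w v := by
      ext w
      rw [hM', if_neg hv]
    have h4 : ∀ u, (rm X B *ᵥ (fun w => M w v)) u = (1 : Matrix {v // v ∈ X} {v // v ∈ X} ℝ) u v := by
      intro u
      rw [← hB]
      rfl
    rw [h3, h4, h4, one_apply_ne (Ne.symm hv)]
    by_cases hu : u = ⟨r, hr⟩
    · rw [if_pos hu, hu, one_apply_ne (Ne.symm hv), zero_div]
    · rw [if_neg hu]
      ring

theorem mulVec_exchange {ι : Type*} [Fintype ι] [DecidableEq ι] {M M' : Matrix ι ι ℝ} {a : ι → ℝ} {r : ι}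
    (hM' : ∀ u v, M' u v = if v = r then a u else M u v) {c c' : ι → ℝ} {x : ℝ} (hr : c r = 0)
    (hc' : ∀ v, c' v = if v = r then x else c v) : M' *ᵥ c' = M *ᵥ c + x • a := by
  ext u
  simp only [mulVec, dotProduct, Pi.add_apply, Pi.smul_apply, smul_eq_mul]
  have h1 : ∀ v, M' u v * c' v = M u v * c v + if v = r then x * a u else 0 := by
    intro v
    rw [hM', hc']
    split_ifs with h
    · rw [h, hr]; ring
    · ring
  rw [Finset.sum_congr rfl (fun v _ => h1 v), Finset.sum_add_distrib, Finset.sum_ite_eq']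
  simp

/-- The invariant of the reduction: `z` is the weighted sum of the vectors that have been treated, and
all stored terms satisfy `P`. -/
structure CaraInv (X : List (Fin n)) (shift : ℝ) (P : VNTerm n → Prop) (z : {v // v ∈ X} → ℝ)
    (s : CaraState n) : Prop where
  inv_mul : rm X s.inv * caraMat X shift s.slot = 1
  nonneg : ∀ v ∈ X, 0 ≤ s.coef v
  zero : ∀ v ∈ X, s.slot v = none → s.coef v = 0
  prop : ∀ v ∈ X, ∀ e, s.slot v = some e → P e
  mulVec_eq : caraMat X shift s.slot *ᵥ rv X s.coef = z

theorem CaraInv.exchange {P : VNTerm n → Prop} {z z' : {v // v ∈ X} → ℝ} {s : CaraState n}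
    (h : CaraInv X shift P z s) {e : VNTerm n} (he : P e) {r : Fin n} (hr : r ∈ X) {c : Vec n}
    (hc0 : ∀ v ∈ X, 0 ≤ c v) (hcz : ∀ v ∈ X, s.slot v = none → c v = 0) (hcr : c r = 0)
    {x : ℝ} (hx : 0 ≤ x) {B : Mat n}
    (hB : rm X B * caraMat X shift (Function.update s.slot r (some e)) = 1)
    (hz : z' = caraMat X shift s.slot *ᵥ rv X c + x • (fun u : {v // v ∈ X} => e.base u + shift)) :
    CaraInv X shift P z' ⟨Function.update s.slot r (some e), Function.update c r x, B⟩ := by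
  refine ⟨hB, fun v hv => ?_, fun v hv hn => ?_, fun v hv e' he' => ?_, ?_⟩
  · by_cases hvr : v = r
    · subst hvr; simpa using hx
    · simpa [hvr] using hc0 v hv
  · by_cases hvr : v = r
    · subst hvr; simp at hn
    · simp only [Function.update_of_ne hvr] at hn ⊢
      exact hcz v hv hn
  · by_cases hvr : v = r
    · subst hvr
      simp only [Function.update_self, Option.some.injEq] at he'
      exact he' ▸ he
    · simp only [Function.update_of_ne hvr] at he'
      exact h.prop v hv e' he'
  · simp only
    rw [hz]
    refine mulVec_exchange (r := ⟨r, hr⟩) (c := rv X c) (caraMat_update shift s.slot hr e)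
      (show rv X c ⟨r, hr⟩ = 0 from hcr) (fun v => ?_)
    by_cases hvr : v = ⟨r, hr⟩
    · subst hvr; simp [rv]
    · have h' : (v : Fin n) ≠ r := fun h' => hvr (Subtype.ext h')
      simp [rv, hvr, h']

/-- An artificial position with a nonzero coordinate can be given up at once, as its coefficient is
zero. If there is none, artificial coefficients stay zero along `d`, and the new vector is absorbed
into the old ones until a coefficient drops to zero. The remaining weight `lam - θ` then goes to the
new vector, which takes over that position. -/
theorem caraAdd_runs (hX : X.Nodup) (hne : X ≠ []) {P : VNTerm n → Prop} {z : {v // v ∈ X} → ℝ}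
    {s : CaraState n} (h : CaraInv X shift P z s) {e : VNTerm n} (he : P e) {lam : ℝ}
    (hlam : 0 ≤ lam) :
    (caraAdd X shift s e lam).Runs f EO (fun s' τ =>
      CaraInv X shift P (z + lam • (fun u : {v // v ∈ X} => e.base u + shift)) s' ∧
      τ ≤ 11 * (X.length * X.length)) := by
  have hm : 1 ≤ X.length := List.length_pos_iff.2 hne
  have hmm : X.length ≤ X.length * X.length := Nat.le_mul_of_pos_left _ hm
  have hmul : X.length * (X.length + 1) = X.length * X.length + X.length := by ring
  unfold caraAdd
  refine Runs.bind (tab_runs _) ?_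
  rintro a _ ⟨ha, rfl⟩
  refine Runs.bind (matVec_runs hX s.inv a) ?_
  rintro d _ ⟨hd, rfl⟩
  have ha' : rv X a = fun u : {v // v ∈ X} => e.base u + shift := by
    ext u
    exact ha u u.2
  rw [ha'] at hd
  have hMd : caraMat X shift s.slot *ᵥ rv X d = fun u : {v // v ∈ X} => e.base u + shift := by
    rw [hd, mulVec_mulVec, mul_eq_one_comm.1 h.inv_mul, one_mulVec]
  have hMadd : ∀ (c : Vec n) (x : ℝ), (∀ v ∈ X, c v = s.coef v + x * d v) →
      caraMat X shift s.slot *ᵥ rv X c = z + x • (fun u : {v // v ∈ X} => e.base u + shift) := by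
    intro c x hc
    have : rv X c = rv X s.coef + x • rv X d := by
      ext v
      exact hc v v.2
    rw [this, mulVec_add, mulVec_smul, hMd, h.mulVec_eq]
  refine Runs.bind (Runs.loop (l := X) (fun pre r t => (match r with
      | none => ∀ v ∈ pre, s.slot v = none → d v = 0
      | some r => r ∈ X ∧ s.slot r = none ∧ d r ≠ 0) ∧ t = pre.length) ⟨by simp, rfl⟩ ?_) ?_
  · rintro pre v post hl r t ⟨h1, rfl⟩
    refine Runs.pure ⟨?_, by simp⟩
    by_cases hv : (s.slot v).isNone = true ∧ d v ≠ 0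
    · rw [if_pos hv]
      exact ⟨by rw [hl]; simp, by simpa using hv.1, hv.2⟩
    · rw [if_neg hv]
      rcases r with _ | r
      · intro u hu hun
        rcases List.mem_append.1 hu with hu | hu
        · exact h1 u hu hun
        · rw [List.mem_singleton] at hu
          subst hu
          by_contra hdu
          exact hv ⟨by simp [hun], hdu⟩
      · exact h1
  rintro r _ ⟨hr, rfl⟩
  rcases r with _ | r
  · simp only at hr ⊢
    refine Runs.bind (Runs.loop (l := X) (fun pre w t => (match w with
      | none => ∀ v ∈ pre, 0 ≤ d v
      | some (r, θ) => r ∈ X ∧ d r < 0 ∧ θ = s.coef r / (-d r) ∧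
          ∀ v ∈ pre, d v < 0 → θ ≤ s.coef v / (-d v)) ∧ t = pre.length) ⟨by simp, rfl⟩ ?_) ?_
    · rintro pre v post hl w t ⟨h1, rfl⟩
      have hvX : v ∈ X := by rw [hl]; simp
      refine Runs.pure ⟨?_, by simp⟩
      rcases w with _ | ⟨r, θ⟩
      · simp only at h1 ⊢
        by_cases hdv : d v < 0
        · rw [if_pos hdv]
          refine ⟨hvX, hdv, rfl, fun u hu hdu => ?_⟩
          rcases List.mem_append.1 hu with hu | hu
          · exact absurd hdu (not_lt.2 (h1 u hu))
          · rw [List.mem_singleton] at hu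
            rw [hu]
        · rw [if_neg hdv]
          intro u hu
          rcases List.mem_append.1 hu with hu | hu
          · exact h1 u hu
          · rw [List.mem_singleton] at hu
            rw [hu]
            exact not_lt.1 hdv
      · simp only at h1 ⊢
        obtain ⟨g1, g2, g3, g4⟩ := h1
        by_cases hdv : d v < 0
        · rw [if_pos hdv]
          by_cases hlt : s.coef v / (-d v) < θ
          · rw [if_pos hlt]
            refine ⟨hvX, hdv, rfl, fun u hu hdu => ?_⟩
            rcases List.mem_append.1 hu with hu | hu
            · exact hlt.le.trans (g4 u hu hdu)
            · rw [List.mem_singleton] at hu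
              rw [hu]
          · rw [if_neg hlt]
            refine ⟨g1, g2, g3, fun u hu hdu => ?_⟩
            rcases List.mem_append.1 hu with hu | hu
            · exact g4 u hu hdu
            · rw [List.mem_singleton] at hu
              rw [hu]
              exact not_lt.1 hlt
        · rw [if_neg hdv]
          refine ⟨g1, g2, g3, fun u hu hdu => ?_⟩
          rcases List.mem_append.1 hu with hu | hu
          · exact g4 u hu hdu
          · rw [List.mem_singleton] at hu
            exact absurd (hu ▸ hdu) hdv
    · rintro w _ ⟨hw, rfl⟩
      have hadd : ∀ (c : Vec n) (x : ℝ), (∀ v ∈ X, c v = s.coef v + x * d v) →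
          (∀ v ∈ X, 0 ≤ s.coef v + x * d v) →
          CaraInv X shift P (z + x • (fun u : {v // v ∈ X} => e.base u + shift)) ⟨s.slot, c, s.inv⟩ := by
        intro c x hc hc0
        refine ⟨h.inv_mul, fun v hv => by simpa [hc v hv] using hc0 v hv, fun v hv hn => ?_, h.prop,
          hMadd c x hc⟩
        simp only at hn ⊢
        rw [hc v hv, h.zero v hv hn, hr v hv hn]
        simp
      rcases w with _ | ⟨r, θ⟩
      · simp only at hw ⊢
        refine Runs.bind (tab_runs _) ?_
        rintro c _ ⟨hc, rfl⟩
        refine Runs.pure ⟨hadd c lam hc (fun v hv => ?_), by omega⟩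
        exact add_nonneg (h.nonneg v hv) (mul_nonneg hlam (hw v hv))
      · simp only at hw ⊢
        obtain ⟨hrX, hdr, hθ, hmin⟩ := hw
        have hθ0 : 0 ≤ θ := hθ ▸ div_nonneg (h.nonneg r hrX) (by linarith)
        have hle : ∀ x, 0 ≤ x → x ≤ θ → ∀ v ∈ X, 0 ≤ s.coef v + x * d v := by
          intro x hx0 hx v hv
          by_cases hdv : d v < 0
          · have h1 := hx.trans (hmin v hv hdv)
            rw [le_div_iff₀ (by linarith)] at h1
            linarith
          · exact add_nonneg (h.nonneg v hv) (mul_nonneg hx0 (not_lt.1 hdv))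
        split_ifs with hlt
        · refine Runs.bind (tab_runs _) ?_
          rintro c _ ⟨hc, rfl⟩
          exact Runs.pure ⟨hadd c lam hc (hle lam hlam hlt), by omega⟩
        · refine Runs.bind (tab_runs _) ?_
          rintro c _ ⟨hc, rfl⟩
          have hinv := hadd c θ hc (hle θ hθ0 le_rfl)
          refine Runs.bind (pivot_runs hrX h.inv_mul hd hdr.ne
            (caraMat_update shift s.slot hrX e)) ?_
          rintro B _ ⟨hB, rfl⟩
          refine Runs.pure ⟨h.exchange he hrX hinv.nonneg hinv.zero ?_
            (x := lam - θ) (sub_nonneg.2 (not_le.1 hlt).le) hB ?_, by omega⟩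
          · simp only
            rw [hc r hrX, hθ, div_neg, neg_mul, div_mul_cancel₀ _ hdr.ne, add_neg_cancel]
          · rw [hMadd c θ hc, add_assoc, ← add_smul]
            congr 2
            ring
  · simp only at hr ⊢
    obtain ⟨hrX, hrn, hdr⟩ := hr
    refine Runs.bind (pivot_runs hrX h.inv_mul hd hdr
      (caraMat_update shift s.slot hrX e)) ?_
    rintro B _ ⟨hB, rfl⟩
    refine Runs.pure ⟨h.exchange he hrX h.nonneg h.zero (h.zero r hrX hrn) hlam hB ?_, by omega⟩
    rw [h.mulVec_eq]

/-- The combination is a convex combination of at most `|X|` of the bases and represents the same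
point. -/
theorem caratheodory_runs (hX : X.Nodup) (hne : X ≠ []) {gX : ℝ} {P : VNTerm n → Prop}
    (hP : ∀ e, P e → ∑ v ∈ X.toFinset, e.base v = gX) {terms : List (VNTerm n × ℝ)}
    (hterms : ∀ p ∈ terms, P p.1 ∧ 0 ≤ p.2) :
    (caratheodory X gX terms).Runs f EO (fun out τ => out.length ≤ X.length ∧
      (∀ t ∈ out, 0 ≤ t.coef ∧ ∃ e, P e ∧ t.order = e.order ∧ t.base = e.base) ∧
      (out.map Term.coef).sum = (terms.map Prod.snd).sum ∧
      (∀ v ∈ X, combPoint out v = (terms.map (fun p => p.2 * p.1.base v)).sum) ∧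
      τ ≤ terms.length * (12 * (X.length * X.length)) + 4 * (X.length * X.length)) := by
  have hm : 1 ≤ X.length := List.length_pos_iff.2 hne
  have hmm : X.length ≤ X.length * X.length := Nat.le_mul_of_pos_left _ hm
  have hmul : X.length * (X.length + 1) = X.length * X.length + X.length := by ring
  unfold caratheodory
  refine Runs.bind (tab2_runs _) ?_
  rintro B _ ⟨hB, rfl⟩
  simp only
  set shift := (1 - gX) / (X.length : ℝ) with hshift
  have hone : ∀ e, P e → ∑ u : {v // v ∈ X}, (e.base u + shift) = 1 := by
    intro e he
    have h1 := hP e he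
    rw [List.sum_toFinset _ hX, sum_map_eq_sum_subtype hX] at h1
    rw [Finset.sum_add_distrib, h1, Finset.sum_const, Finset.card_univ, card_subtype_mem hX,
      nsmul_eq_mul, hshift]
    have : (X.length : ℝ) ≠ 0 := by positivity
    field_simp
    ring
  refine Runs.bind (Runs.loop (l := terms) (fun pre s t => CaraInv X shift P
    (pre.map (fun p => p.2 • (fun u : {v // v ∈ X} => p.1.base u + shift))).sum s ∧
    t ≤ pre.length * (12 * (X.length * X.length))) ⟨?_, by simp⟩ ?_) ?_
  · refine ⟨?_, by simp, by simp, by simp, ?_⟩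
    · have h1 : rm X B = 1 := by
        ext u v
        simp only [rm, of_apply]
        rw [hB u u.2 v v.2, one_apply]
        simp [Subtype.ext_iff]
      have h2 : caraMat X shift (fun _ => none) = 1 := by
        ext u v
        simp only [caraMat, caraCol, of_apply, one_apply, Pi.single_apply]
        simp [Subtype.ext_iff]
      simp only
      rw [h1, h2, one_mul]
    · have : rv X (fun _ => (0 : ℝ)) = 0 := rfl
      simp [this]
  · rintro pre p post hl s t ⟨h1, h2⟩
    obtain ⟨hp, hp0⟩ := hterms p (by rw [hl]; simp)
    refine (caraAdd_runs hX hne h1 hp hp0).mono ?_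
    rintro s' t' ⟨h3, h4⟩
    refine ⟨by simpa using h3, ?_⟩
    rw [List.length_append, List.length_singleton, Nat.add_one_mul]
    omega
  · rintro s t ⟨h1, h2⟩
    have hcol1 : ∀ v ∈ X, ∑ u : {v // v ∈ X}, caraCol shift s.slot v u = 1 := by
      intro v hv
      unfold caraCol
      rcases hsl : s.slot v with _ | e
      · rw [Finset.sum_eq_single ⟨v, hv⟩]
        · simp
        · intro u _ hu
          have : (u : Fin n) ≠ v := fun h => hu (Subtype.ext h)
          simp [this]
        · simp
      · exact hone e (h1.prop v hv e hsl)
    -- Columns and treated vectors all have coordinate sum `1`, including the artificial unit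
    -- vectors, so the coordinate sum of the combined vector is the sum of the coefficients on
    -- either side.
    have hsum : ∑ v : {v // v ∈ X}, s.coef v = (terms.map Prod.snd).sum := by
      have h3 : ∑ u, (caraMat X shift s.slot *ᵥ rv X s.coef) u = ∑ v : {v // v ∈ X}, s.coef v := by
        simp only [mulVec, dotProduct]
        rw [Finset.sum_comm]
        refine Finset.sum_congr rfl (fun v _ => ?_)
        rw [← Finset.sum_mul]
        simp only [caraMat, of_apply]
        rw [hcol1 v v.2, one_mul]
        rfl
      rw [← h3, h1.mulVec_eq]
      clear h1 h2 h3 hcol1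
      induction terms with
      | nil => simp
      | cons p terms ih =>
        simp only [List.map_cons, List.sum_cons, Pi.add_apply, Pi.smul_apply, smul_eq_mul]
        rw [Finset.sum_add_distrib, ih (fun p hp => hterms p (by simp [hp])), ← Finset.mul_sum,
          hone _ (hterms p (by simp)).1, mul_one]
    refine (Runs.loop (l := X) (fun pre out t' => out.length ≤ pre.length ∧
      (∀ t ∈ out, 0 ≤ t.coef ∧ ∃ e, P e ∧ t.order = e.order ∧ t.base = e.base) ∧
      (out.map Term.coef).sum = (pre.map s.coef).sum ∧
      (∀ u ∈ X, combPoint out u = (pre.map (fun v => s.coef v * (caraCol shift s.slot v u - shift))).sum) ∧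
      t' = pre.length) ⟨by simp, by simp, by simp, by simp [combPoint], rfl⟩ ?_).mono ?_
    · rintro pre v post hl out t' ⟨g1, g2, g3, g4, rfl⟩
      have hv : v ∈ X := by rw [hl]; simp
      rcases hsl : s.slot v with _ | e
      · simp only
        have hz := h1.zero v hv hsl
        refine Runs.pure ⟨by simp; omega, g2, by simp [g3, hz], fun u hu => ?_, by simp⟩
        rw [g4 u hu]
        simp [hz]
      · simp only
        refine Runs.pure ⟨by simpa using g1, ?_, ?_, fun u hu => ?_, by simp⟩
        · intro t ht
          rcases List.mem_cons.1 ht with rfl | ht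
          · exact ⟨h1.nonneg v hv, e, h1.prop v hv e hsl, rfl, rfl⟩
          · exact g2 t ht
        · simp [g3, add_comm]
        · have := g4 u hu
          simp only [combPoint] at this ⊢
          rw [List.map_cons, List.sum_cons, this]
          simp [caraCol, hsl, add_comm]
    · rintro out t' ⟨g1, g2, g3, g4, rfl⟩
      refine ⟨g1, g2, ?_, fun u hu => ?_, by omega⟩
      · rw [g3, sum_map_eq_sum_subtype hX, hsum]
      · rw [g4 u hu, sum_map_eq_sum_subtype hX]
        have h3 := congrFun h1.mulVec_eq ⟨u, hu⟩
        simp only [mulVec, dotProduct, caraMat, of_apply, rv] at h3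
        -- As the total of the coefficients is preserved, the shift contributes equally on both
        -- sides and can be removed.
        have h4 : ∑ v : {v // v ∈ X}, s.coef v * (caraCol shift s.slot v u - shift) =
            ∑ v : {v // v ∈ X}, caraCol shift s.slot v u * s.coef v -
              shift * ∑ v : {v // v ∈ X}, s.coef v := by
          rw [Finset.mul_sum, ← Finset.sum_sub_distrib]
          refine Finset.sum_congr rfl (fun v _ => ?_)
          ring
        rw [h4, h3, hsum]
        clear h1 h2 h3 h4 hcol1 hsum g3 g4
        induction terms with
        | nil => simp
        | cons p terms ih =>
          have := ih (fun p hp => hterms p (by simp [hp]))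
          simp only [List.map_cons, List.sum_cons, Pi.add_apply, Pi.smul_apply, smul_eq_mul] at this ⊢
          linarith

end Caratheodory

/-! ### The oracle given by geometric rescaling -/

section RescalingOracle

open Matrix

variable {n : ℕ} {f g : Finset (Fin n) → ℝ} {EO ca : ℕ} {X : List (Fin n)}

theorem wsum_apply (wts : List (VNTerm n × ℝ)) (v : {v // v ∈ X}) :
    wsum X wts v = (wts.map (fun p => p.2 * p.1.gbase v)).sum := by
  induction wts with
  | nil => rfl
  | cons p wts ih =>
    simp only [wsum, List.map_cons, List.sum_cons, Pi.add_apply, Pi.smul_apply, smul_eq_mul] at ih ⊢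
    rw [ih]
    rfl

/-- The normalized weights certify that `W` is an approximate minimizer. -/
theorem WeightsOK.approx (hX : X.Nodup) {mu δ : ℝ} {W : Finset (Fin n)} (hmu : MuOK X g mu W)
    {wts : List (VNTerm n × ℝ)} (h : WeightsOK X g mu δ wts) {α : ℝ}
    (hα : α = (wts.map Prod.snd).sum) :
    g W ≤ ∑ v ∈ X.toFinset, min 0 ((wts.map (fun w => (w.1, w.2 / α))).map
      (fun w => w.2 * w.1.base v)).sum + δ * complexityL X.toFinset g := by
  have hα0 : 0 < α := hα ▸ h.sum_pos
  refine approx_of_sum_abs_le (mu := mu) hmu.eq_neg ?_ ?_ ?_ ?_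
  · intro w hw
    obtain ⟨w', hw', rfl⟩ := List.mem_map.1 hw
    exact h.valid w' hw'
  · intro w hw
    obtain ⟨w', hw', rfl⟩ := List.mem_map.1 hw
    exact div_nonneg (h.nonneg w' hw') hα0.le
  · have : (wts.map (fun w => (w.1, w.2 / α))).map Prod.snd = (wts.map Prod.snd).map (· / α) := by
      simp [List.map_map, Function.comp_def]
    rw [this]
    simp only [div_eq_mul_inv]
    rw [List.sum_map_mul_right, List.map_id', ← hα, mul_inv_cancel₀ hα0.ne']
  · have h1 : ∀ v : Fin n, ((wts.map (fun w => (w.1, w.2 / α))).map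
        (fun w => w.2 * w.1.gbase v)).sum = (wts.map (fun w => w.2 * w.1.gbase v)).sum * α⁻¹ := by
      intro v
      rw [List.map_map, ← List.sum_map_mul_right]
      congr 1
      refine List.map_congr_left (fun w _ => ?_)
      simp only [Function.comp_apply]
      ring
    simp only [h1, abs_mul]
    rw [← Finset.sum_mul, List.sum_toFinset _ hX, sum_map_eq_sum_subtype hX, abs_of_pos (inv_pos.2 hα0),
      ← div_eq_mul_inv, div_le_iff₀ hα0, hα]
    simpa only [wsum_apply] using h.sum_abs_le

theorem getLastD_prefixValues (hne : X ≠ []) : (prefixValues g X).getLastD 0 = g X.toFinset := by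
  have hm := List.length_pos_iff.2 hne
  have h1 : (prefixValues g X).getLastD 0 = (prefixValues g X).getD (X.length - 1) 0 := by
    rw [List.getLastD_eq_getLast?, List.getLast?_eq_getElem?, length_prefixValues,
      List.getD_eq_getElem?_getD]
  rw [h1, getD_prefixValues _ _ _ (by omega), show X.length - 1 + 1 = X.length by omega, List.take_length]

/-- Here `w` stands for `mp`, `q` for `m²` and `ℓ` for the number of weighted bases, so that the
estimate is polynomial in two main quantities. -/
theorem rescaling_time_le {w q ca rt ℓ p m : ℕ} (hw : 1 ≤ w) (hq : 1 ≤ q) (hp : p ≤ w) (hm : m ≤ w)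
    (hmq : m ≤ q) (hrt : rt = 400 * q * (25 * q + ca + (400 * q + 1)) +
      (400 * q + 1) * (17 * q + 1) + 29 * q) (hℓ : ℓ ≤ 5 * w * (400 * q + 1) + 1) :
    p + m + ca + (q + m) + 2 * (5 * w * rt) + 2 * ℓ + (ℓ * (12 * q) + 4 * q) ≤
      w * (2000000 * (q * q) + 4001 * (q * ca)) := by
  obtain ⟨q', rfl⟩ := Nat.exists_eq_add_of_le hq
  obtain ⟨w', rfl⟩ := Nat.exists_eq_add_of_le hw
  have h1 : ℓ * (12 * (1 + q') + 2) ≤ (5 * (1 + w') * (400 * (1 + q') + 1) + 1) * (12 * (1 + q') + 2) :=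
    Nat.mul_le_mul_right _ hℓ
  subst hrt
  ring_nf at *
  nlinarith [Nat.zero_le (w' * q'), Nat.zero_le (w' * q' ^ 2), Nat.zero_le (q' ^ 2),
    Nat.zero_le (w' * ca), Nat.zero_le (q' * ca), Nat.zero_le (w' * q' * ca)]

theorem rescalingOracle_runs (hX : X.Nodup) (hne : X ≠ []) (hg : IsSubmodularOn X.toFinset g)
    (h0 : g ∅ = 0) {acc : Access n} (hacc : ∀ l : List (Fin n), l.Perm X →
      (acc l).Runs f EO (fun r t => r = prefixValues g l ∧ t ≤ ca)) {δ : ℝ} (hδ : 0 < δ) :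
    (rescalingOracle n X acc δ).Runs f EO (fun out τ => IsApproxOutput 1 X g δ out ∧
      τ ≤ X.length * max 1 (Nat.clog 2 ⌈2 * (X.length : ℝ) / δ⌉₊) *
        (2000000 * ((X.length * X.length) * (X.length * X.length)) +
          4001 * (X.length * X.length * ca))) := by
  have hm : 1 ≤ X.length := List.length_pos_iff.2 hne
  have hm' : (1 : ℝ) ≤ X.length := by exact_mod_cast hm
  have hmm : X.length ≤ X.length * X.length := Nat.le_mul_of_pos_left _ hm
  have hmul : X.length * (X.length + 1) = X.length * X.length + X.length := by ring
  unfold rescalingOracle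
  simp only
  set p := max 1 (Nat.clog 2 ⌈2 * (X.length : ℝ) / δ⌉₊) with hp
  have hp1 : 1 ≤ p := le_max_left _ _
  have hpδ : 2 * (X.length : ℝ) / δ ≤ 2 ^ p := by
    have h1 : ⌈2 * (X.length : ℝ) / δ⌉₊ ≤ 2 ^ p :=
      (Nat.le_pow_clog (by norm_num) _).trans (Nat.pow_le_pow_right (by norm_num) (le_max_right _ _))
    have h2 := Nat.ceil_le.1 h1
    exact_mod_cast h2
  refine Runs.bind (Runs.exact _) ?_
  rintro _ t₁ ⟨-, ht₁⟩
  rw [time_tick] at ht₁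
  refine Runs.bind (hacc X (List.Perm.refl X)) ?_
  rintro ps t₂ ⟨rfl, ht₂⟩
  rw [getLastD_prefixValues hne]
  refine Runs.bind (tab2_runs _) ?_
  rintro one _ ⟨hone, rfl⟩
  have hone' : rm X one = 1 := by
    ext u v
    simp only [rm, of_apply]
    rw [hone u u.2 v v.2, one_apply]
    simp [Subtype.ext_iff]
  have hmu : MuOK X g (max 0 (-g X.toFinset)) (if g X.toFinset < 0 then X.toFinset else ∅) := by
    refine ⟨le_max_left _ _, le_max_right _ _, ?_, ?_⟩
    · split_ifs <;> simp
    · split_ifs with h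
      · exact max_eq_right (by linarith)
      · rw [h0, neg_zero]
        exact max_eq_left (by linarith)
  -- The step limit `400m²` is `1/ε²`, matching the bound `1/(N + 1)` for the squared norm.
  have hN : 1 / (((400 * X.length ^ 2 : ℕ) : ℝ) + 1) ≤ (1 / (20 * (X.length : ℝ))) ^ 2 := by
    rw [div_pow, one_pow]
    refine one_div_le_one_div_of_le (by positivity) ?_
    push_cast
    nlinarith
  refine Runs.bind (rescalingLoop_runs hX hne hg h0 hacc rfl hN hp1 hδ hpδ (5 * X.length * p) _ _
    one one [] hmu ⟨hone', hone'⟩ (by simp) (by simp)) ?_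
  rintro ⟨W, wts⟩ t₃ ⟨mu, hmu', hw, hlen, ht₃⟩
  simp only at hmu' hw hlen ⊢
  refine Runs.bind (P := fun α t => α = (wts.map Prod.snd).sum ∧ t = wts.length)
    ⟨by simp [result_loop, foldl_add_eq], by rw [time_loop_eq (c := 0) (by simp)]; simp⟩ ?_
  rintro α _ ⟨hα, rfl⟩
  have hα0 : 0 < α := hα ▸ hw.sum_pos
  refine Runs.bind (Runs.exact _) ?_
  rintro _ t₄ ⟨-, ht₄⟩
  rw [time_tick] at ht₄
  refine Runs.bind (caratheodory_runs hX hne (gX := g X.toFinset)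
    (P := fun e => e.order.Perm X ∧ ∀ v ∈ X, e.base v = extremeBase g e.order v) ?_
    (terms := wts.map (fun w => (w.1, w.2 / α))) ?_) ?_
  · rintro e ⟨hp, hb⟩
    have htf : e.order.toFinset = X.toFinset := List.toFinset_eq_of_perm _ _ hp
    rw [Finset.sum_congr rfl (fun v hv => hb v (List.mem_toFinset.1 hv)), ← htf,
      sum_extremeBase g (hp.nodup_iff.2 hX), h0, sub_zero]
  · intro w hwm
    obtain ⟨w', hw', rfl⟩ := List.mem_map.1 hwm
    exact ⟨⟨(hw.valid w' hw').order_perm, (hw.valid w' hw').base_eq⟩,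
      div_nonneg (hw.nonneg w' hw') hα0.le⟩
  · rintro out t₅ ⟨h1, h2, h3, h4, h5⟩
    refine Runs.pure ⟨⟨hmu'.subset, by simpa using h1, fun e he => (h2 e he).1, ?_, ?_, ?_, ?_⟩, ?_⟩
    · simp only
      rw [h3]
      have : (wts.map (fun w => (w.1, w.2 / α))).map Prod.snd = (wts.map Prod.snd).map (· / α) := by
        simp [List.map_map, Function.comp_def]
      rw [this]
      simp only [div_eq_mul_inv]
      rw [List.sum_map_mul_right, List.map_id', ← hα, mul_inv_cancel₀ hα0.ne']
    · intro e he
      obtain ⟨-, e', he', ho, -⟩ := h2 e he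
      rw [ho]
      exact he'.1
    · intro e he v hv
      obtain ⟨-, e', he', ho, hb⟩ := h2 e he
      rw [ho, hb]
      exact he'.2 v hv
    · simp only
      rw [Finset.sum_congr rfl (fun v hv => by rw [h4 v (List.mem_toFinset.1 hv)])]
      exact hw.approx hX hmu' hα
    · rw [List.length_map] at h5
      rw [List.length_nil, zero_mul, add_zero] at ht₃
      have hxp : 5 * X.length * p = 5 * (X.length * p) := by ring
      rw [hxp] at ht₃ hlen
      have hsq : 400 * X.length ^ 2 = 400 * (X.length * X.length) := by ring
      rw [hsq] at ht₃ hlen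
      have key := rescaling_time_le (w := X.length * p) (q := X.length * X.length) (ca := ca)
        (rt := roundTime X.length (400 * (X.length * X.length)) ca) (ℓ := wts.length) (p := p)
        (m := X.length) (Nat.mul_pos hm hp1) (by omega) (Nat.le_mul_of_pos_left _ hm)
        (Nat.le_mul_of_pos_right _ hp1) hmm rfl hlen
      rw [hmul]
      omega

theorem rescalingOracle_isApproxSFM : rescalingOracle.IsApproxSFM 1 := by
  intro n X acc f g δ hX hne hg h0 hacc hδ
  -- The analysis of the program carries a time bound for the access. For correctness any finite one
  -- will do, such as the total over all orderings of `X`.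
  refine (rescalingOracle_runs (f := f) (EO := 0)
    (ca := (X.permutations.map (fun l => (acc l).time f 0)).sum) hX hne hg h0 ?_ hδ).1
  intro l hl
  refine ⟨hacc l (hl.nodup_iff.2 hX) hl.subset, ?_⟩
  exact List.le_sum_of_mem (List.mem_map.2 ⟨l, List.mem_permutations.2 hl, rfl⟩)

/-- With `k = log₂ n + 1`, the quotient `2m/δ` is at most `2` to the power `1 + k + (2 + 2k) · 4b`,
and `b ≤ k + 1`. The exponent is quadratic in `k`, which is the source of the factor `log² n`. -/
theorem clog_le {n m b : ℕ} (hn : 2 ≤ n) (hm : m ≤ n) (hb : b ≤ Nat.log 2 n + 2) :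
    max 1 (Nat.clog 2 ⌈2 * (m : ℝ) / (1 / ((4 * (((1 : ℕ) : ℝ) * n) * n) ^ 4) ^ b)⌉₊) ≤
      20 * (Nat.log 2 n + 1) ^ 2 := by
  set k := Nat.log 2 n + 1 with hk
  have hk2 : 2 ≤ k := by
    have : 1 ≤ Nat.log 2 n := Nat.log_pos (by norm_num) hn
    omega
  have hnk : n ≤ 2 ^ k := (Nat.lt_pow_succ_log_self (by norm_num) n).le
  have h1 : 2 * m * ((4 * n * n) ^ 4) ^ b ≤ 2 ^ (1 + k + (2 + 2 * k) * (4 * b)) := by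
    rw [pow_add, pow_add, pow_mul, ← pow_mul, ← pow_mul, pow_one]
    refine Nat.mul_le_mul (Nat.mul_le_mul_left 2 (hm.trans hnk)) ?_
    rw [pow_mul 2 (2 + 2 * k)]
    refine Nat.pow_le_pow_left ?_ _
    calc 4 * n * n ≤ 4 * 2 ^ k * 2 ^ k := Nat.mul_le_mul (Nat.mul_le_mul_left 4 hnk) hnk
      _ = 2 ^ (2 + 2 * k) := by ring
  have h2 : 2 * (m : ℝ) / (1 / ((4 * (((1 : ℕ) : ℝ) * n) * n) ^ 4) ^ b) =
      ((2 * m * ((4 * n * n) ^ 4) ^ b : ℕ) : ℝ) := by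
    push_cast
    rw [div_div_eq_mul_div, div_one, one_mul]
  rw [h2, Nat.ceil_natCast]
  refine max_le (by nlinarith) ((Nat.clog_le_of_le_pow h1).trans ?_)
  have h3 : (2 + 2 * k) * (4 * b) ≤ (2 + 2 * k) * (4 * (k + 1)) := Nat.mul_le_mul_left _ (by omega)
  nlinarith

/-- The oracle needs `O(mp)` rounds of `O(m²)` steps, each costing `O(m²)` plus an access of cost
`O(m(n + EO))`. One factor `m` is kept as the required `|X|`, and the others are bounded by `n`. -/
theorem oracleBound_rescaling (hf : IsSubmodular f) (hn : 2 ≤ n) :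
    OracleBound 1 rescalingOracle f EO (20 * ((Nat.log 2 n : ℝ) + 1) ^ 2 *
      (2100000 * (n : ℝ) ^ 5 + 4001 * ((n : ℝ) ^ 4 * EO))) := by
  intro s X b hs hne hX hrep hb
  have hm : 1 ≤ X.length := List.length_pos_iff.2 hne
  have hground : s.ground.Nonempty := by
    obtain ⟨v, hv⟩ := List.exists_mem_of_length_pos hm
    exact ⟨v, mem_ground.2 (hrep v hv)⟩
  have hmn : X.length ≤ n := by
    have := hX.length_le_card
    simpa using this
  have hrun := rescalingOracle_runs (f := f) (EO := EO) (g := s.fdown (s.negEll f) f)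
    (acc := s.downAccess (s.negEll f)) (ca := X.length * (3 * n + EO + 1))
    (δ := 1 / ((4 * (((1 : ℕ) : ℝ) * n) * n) ^ 4) ^ b) hX hne
    (fun S _ T _ => hs.fdown_submodular hf S T) (hs.fdown_empty hground)
    (fun l hl => by
      refine (downAccess_runs s (s.negEll f) f EO l (hl.nodup_iff.2 hX)).mono ?_
      rintro r t ⟨hr, ht⟩
      exact ⟨hr, by rwa [hl.length_eq] at ht⟩)
    (by positivity)
  have ht := hrun.2
  have hp := clog_le hn hmn hb
  generalize max 1 (Nat.clog 2 ⌈2 * (X.length : ℝ) / (1 / ((4 * (((1 : ℕ) : ℝ) * n) * n) ^ 4) ^ b)⌉₊)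
    = p at ht hp
  generalize (rescalingOracle n X (s.downAccess (s.negEll f))
    (1 / ((4 * (((1 : ℕ) : ℝ) * n) * n) ^ 4) ^ b)).time f EO = τ at ht ⊢
  generalize X.length = m at *
  have h1 : 2000000 * (m * m * (m * m)) + 4001 * (m * m * (m * (3 * n + EO + 1))) ≤
      2000000 * (n * n * (n * n)) + 4001 * (n * n * (n * (4 * n + EO))) := by
    have h0 : 3 * n + EO + 1 ≤ 4 * n + EO := by omega
    generalize 3 * n + EO + 1 = x at h0 ⊢
    generalize 4 * n + EO = y at h0 ⊢
    gcongr
  have h2 : τ ≤ m * (20 * (Nat.log 2 n + 1) ^ 2) *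
      (2000000 * (n * n * (n * n)) + 4001 * (n * n * (n * (4 * n + EO)))) :=
    ht.trans (Nat.mul_le_mul (Nat.mul_le_mul_left _ hp) h1)
  have h3 : (τ : ℝ) ≤ (m : ℝ) * (20 * ((Nat.log 2 n : ℝ) + 1) ^ 2) *
      (2000000 * (n * n * (n * n)) + 4001 * (n * n * (n * (4 * n + EO)))) := by
    exact_mod_cast h2
  have h4 := mul_le_mul_of_nonneg_left h3 (Nat.cast_nonneg (α := ℝ) n)
  refine h4.trans ?_
  have h5 : (0 : ℝ) ≤ (n : ℝ) ^ 5 := by positivity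
  have h6 : (n : ℝ) * (2000000 * (n * n * (n * n)) + 4001 * (n * n * (n * (4 * n + EO)))) ≤
      2100000 * (n : ℝ) ^ 5 + 4001 * ((n : ℝ) ^ 4 * EO) := by
    ring_nf
    linarith
  have h7 : (0 : ℝ) ≤ (m : ℝ) * (20 * ((Nat.log 2 n : ℝ) + 1) ^ 2) := by positivity
  have h8 := mul_le_mul_of_nonneg_left h6 h7
  refine le_trans (le_of_eq ?_) (h8.trans (le_of_eq ?_))
  · ring
  · ring

theorem natLog_add_one_le (hn : 2 ≤ n) : (Nat.log 2 n : ℝ) + 1 ≤ 3 * Real.log n := by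
  have hl2 := Real.log_two_gt_d9
  have h1 : ((2 ^ Nat.log 2 n : ℕ) : ℝ) ≤ n := by
    exact_mod_cast Nat.pow_log_le_self 2 (by omega)
  have h2 := Real.log_le_log (by positivity) h1
  push_cast at h2
  rw [Real.log_pow] at h2
  have h3 : Real.log 2 ≤ Real.log n := Real.log_le_log (by norm_num) (by exact_mod_cast hn)
  have h4 : (0 : ℝ) ≤ Nat.log 2 n := by positivity
  nlinarith

theorem bucketedSFM_rescaling_time (hf : IsSubmodular f) (h0 : f ∅ = 0) (EO : ℕ) (hn : 2 ≤ n) :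
    (((bucketedSFM 1 rescalingOracle n).time f EO : ℕ) : ℝ) ≤
      2000000000 * (((n : ℝ) ^ 5 * (EO : ℝ) + (n : ℝ) ^ 6) * Real.log (n : ℝ) ^ 2) := by
  have hn1 : (1 : ℝ) ≤ n := by exact_mod_cast (by omega : 1 ≤ n)
  have h1 := (bucketedSFM_runs le_rfl rescalingOracle_isApproxSFM EO hf h0).2 (by omega) _
    (by positivity) (oracleBound_rescaling hf hn)
  refine h1.trans ?_
  have hk := natLog_add_one_le hn
  have hk1 : (1 : ℝ) ≤ (Nat.log 2 n : ℝ) + 1 := by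
    have : (0 : ℝ) ≤ Nat.log 2 n := by positivity
    linarith
  generalize (Nat.log 2 n : ℝ) + 1 = k at *
  set S := (n : ℝ) ^ 5 * EO + (n : ℝ) ^ 6 with hS
  have hS0 : 0 ≤ S := by positivity
  have h2 : 3 * (n : ℝ) * (20 * k ^ 2 * (2100000 * (n : ℝ) ^ 5 + 4001 * ((n : ℝ) ^ 4 * EO))) ≤
      126000000 * (k ^ 2 * S) := by
    have : (n : ℝ) * (2100000 * (n : ℝ) ^ 5 + 4001 * ((n : ℝ) ^ 4 * EO)) ≤ 2100000 * S := by
      have : (0 : ℝ) ≤ (n : ℝ) ^ 5 * EO := by positivity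
      rw [hS]
      ring_nf at *
      linarith
    have h3 := mul_le_mul_of_nonneg_left this (by positivity : 0 ≤ 60 * k ^ 2)
    linarith
  have h3 : (n : ℝ) ^ 3 * EO + (n : ℝ) ^ 4 ≤ S :=
    add_le_add (mul_le_mul_of_nonneg_right (pow_le_pow_right₀ hn1 (by norm_num)) (by positivity))
      (pow_le_pow_right₀ hn1 (by norm_num))
  have h4 : S ≤ k ^ 2 * S := le_mul_of_one_le_left hS0 (one_le_pow₀ hk1)
  have h5 : k ^ 2 ≤ 9 * Real.log n ^ 2 := by
    have := pow_le_pow_left₀ (by linarith) hk 2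
    linarith
  have h6 := mul_le_mul_of_nonneg_right h5 hS0
  have h7 : 0 ≤ Real.log n ^ 2 * S := by positivity
  push_cast
  nlinarith

end RescalingOracle

end SFM

end

/-! ### Assembly of the two statements. -/

theorem theorem4p6 :
    (∀ K : ℕ, ∃ C : ℕ, ∀ A : SFM.ApproxAlg, A.IsApproxSFM K →
      ∀ (n : ℕ) (f : Finset (Fin n) → ℝ), SFM.IsSubmodular f → f ∅ = 0 → ∀ EO : ℕ,
        (∃ S, (SFM.bucketedSFM K A n).result f = some S ∧ SFM.IsMinimizer f S) ∧
        (2 ≤ n →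
          (((SFM.bucketedSFM K A n).time f EO : ℕ) : ENNReal) ≤
            (C : ENNReal) * ((n : ENNReal) *
                SFM.AOdown A f EO ((n : ℝ) ^ (-((C : ℝ) * Real.log (n : ℝ)))) +
              (n : ENNReal) ^ 3 * (EO : ENNReal) + (n : ENNReal) ^ 4))) ∧
    (SFM.rescalingOracle.IsApproxSFM 1 ∧
      ∃ C : ℝ, ∀ (n : ℕ) (f : Finset (Fin n) → ℝ), SFM.IsSubmodular f → f ∅ = 0 → ∀ EO : ℕ,
        (∃ S, (SFM.bucketedSFM 1 SFM.rescalingOracle n).result f = some S ∧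
          SFM.IsMinimizer f S) ∧
        (2 ≤ n →
          (((SFM.bucketedSFM 1 SFM.rescalingOracle n).time f EO : ℕ) : ℝ) ≤
            C * (((n : ℝ) ^ 5 * (EO : ℝ) + (n : ℝ) ^ 6) * Real.log (n : ℝ) ^ 2))) := by
  -- One constant serves twice: as a factor it dominates `140 + 17K`, and in the exponent of the
  -- accuracy it dominates `20(K + 4)`.
  refine ⟨fun K => ⟨20 * K + 140, fun A hA n f hf h0 EO => ⟨?_, ?_⟩⟩, ?_⟩
  · exact (SFM.bucketedSFM_runs (SFM.one_le_of_isApproxSFM hA) hA EO hf h0).1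
  · exact SFM.bucketedSFM_time hA hf h0 EO
  · refine ⟨SFM.rescalingOracle_isApproxSFM, 2000000000, fun n f hf h0 EO => ⟨?_, fun hn => ?_⟩⟩
    · exact (SFM.bucketedSFM_runs le_rfl SFM.rescalingOracle_isApproxSFM EO hf h0).1
    · exact SFM.bucketedSFM_rescaling_time hf h0 EO hn
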